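/- Let $\alpha,\delta\in\mathbb{R}$, $\beta>0$, $\omega(k)=-i\beta k^3+i\alpha k^2+i\delta k$ and $\Delta=\alpha^2+3\beta\delta$. Let $\lambda=0$ if $\Delta>0$, and let $\lambda>\frac{2\sqrt{-\Delta}}{3\beta}$ be any fixed number if $\Delta\le 0$. Let $\Gamma$ be the contour which comes down from $\infty$ along $\gamma_1(m)=\frac{\alpha-\sqrt{3\beta^2m^2+\Delta}}{3\beta}+im$, $m\ge\lambda$, runs to the right along the segment from $\gamma_1(\lambda)$ to $\gamma_3(\lambda)$ at height $\operatorname{Im}k=\lambda$, and goes up to $\infty$ along $\gamma_3(m)=\frac{\alpha+\sqrt{3\beta^2m^2+\Delta}}{3\beta}+im$, $m\ge\lambda$. For $r\ge 0$ let $\|f\|_{H^r(\mathbb{R})}^2=\frac1{2\pi}\int_{\mathbb{R}}(1+k^2)^r|\widehat f(k)|^2\,dk$ and, for an open interval $U$, let $\|f\|_{H^r(U)}$ be the infimum of $\|F\|_{H^r(\mathbb{R})}$ over all $F$ with $F=f$ a.e. on $U$. Let $s\ge 0$. There is a constant $c>0$, depending only on $\alpha,\beta,\delta,s$, such that the following holds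 for every $T'>0$, every such $\lambda$ and every $g_0\in H^{\frac{s+1}{3}}(\mathbb{R})$ which vanishes (a.e.) outside $[0,T')$. The function $$q(x,t)=-\frac{i}{2\pi}\int_{\Gamma}e^{ikx-\omega(k)t}\,\omega'(k)\left(\int_0^{T'}e^{\omega(k)t'}g_0(t')\,dt'\right)dk,\qquad x>0,\ t\in[0,T'],$$ which is the (weak) solution, given by the Fokas method, of the reduced initial-boundary value problem $$iq_t+i\beta q_{xxx}+\alpha q_{xx}+i\delta q_x=0\ \text{ on }(0,\infty)\times(0,T'),\qquad q(x,0)=0,\qquad q(0,t)=g_0(t),$$ solves this problem (the equation holds classically, $q$ is continuous on $(0,\infty)\times[0,T']$ and vanishes at $t=0$, and $q(x,\cdot)\to g_0$ in $L^2(0,T')$ as $x\to0^+$), and for every $t\in[0,T']$ $$\|q(\cdot,t)\|_{H^s(0,\infty)}\le c\left(1+\sqrt{T'}\,e^{cT'}\right)\|g_0\|_{H^{\frac{s+1}{3}}(\mathbb{R})}.$$ If moreover $s\notin\{\tfrac12+3n: n=0,1,2,\dots\}$, that is, $\frac{s+1}{3}-\frac12$ is not an integer, then for every $t\in[0,T']$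 also $$\|q(\cdot,t)\|_{H^s(0,\infty)}\le c\left(1+\sqrt{T'}\,e^{cT'}\right)\|g_0\|_{H^{\frac{s+1}{3}}(0,T')}.$$ -/

import Mathlib

open MeasureTheory Set Filter Topology
open scoped ENNReal

noncomputable section

namespace FokasHalfLine

/-! ### Sobolev norms -/

/-- The norm of `H^s(ℝ)`, `s ≥ 0`, of a square integrable function, through its `L²` Fourier
transform. Since `𝓕 F ξ = ∫ e^{-2π i ξ x} F x dx`, the angular frequency is `k = 2 π ξ`, so this is
`(1 / 2π ∫ (1 + k²)^s |F̂(k)|² dk)^{1/2}`. It is `∞` when `F` is not in `H^s(ℝ)`. -/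
def sobolevNorm (s : ℝ) (F : Lp ℂ 2 (volume : Measure ℝ)) : ℝ≥0∞ :=
  (∫⁻ ξ : ℝ, ENNReal.ofReal ((1 + (2 * Real.pi * ξ) ^ 2) ^ s) *
    ‖(FourierTransform.fourier F : Lp ℂ 2 (volume : Measure ℝ)) ξ‖ₑ ^ 2) ^ (1 / 2 : ℝ)

/-- The norm of the restriction space `H^s(U)`, `s ≥ 0`: the infimum of the norms in `H^s(ℝ)` of
the extensions of `f` from `U` to the line. It is `∞` when `f` is not in `H^s(U)`. For `U = univ`
it is the norm of `H^s(ℝ)`. -/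
def sobolevNormOn (s : ℝ) (U : Set ℝ) (f : ℝ → ℂ) : ℝ≥0∞ :=
  ⨅ (F : Lp ℂ 2 (volume : Measure ℝ)) (_ : ∀ᵐ x ∂(volume.restrict U), F x = f x), sobolevNorm s F

/-! ### The spectral function and the contour -/

/-- `ω(k) = -i β k³ + i α k² + i δ k`. -/
def omega (α β δ : ℝ) (k : ℂ) : ℂ :=
  -Complex.I * β * k ^ 3 + Complex.I * α * k ^ 2 + Complex.I * δ * k

/-- The height of the horizontal part of the contour: `0` if `α² + 3βδ > 0`, otherwise large enough
to pass above the zeros of `ω'` and the branch points. -/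
def AdmissibleHeight (α β δ h : ℝ) : Prop :=
  (0 < α ^ 2 + 3 * β * δ → h = 0) ∧
  (α ^ 2 + 3 * β * δ ≤ 0 → 2 * √(-(α ^ 2 + 3 * β * δ)) / (3 * β) < h)

/-- The left branch of the hyperbola `3 (Re k - α/(3β))² - (Im k)² = (α² + 3βδ)/(3β²)`. -/
def gammaLeft (α β δ : ℝ) (m : ℝ) : ℂ :=
  (((α - √(3 * β ^ 2 * m ^ 2 + α ^ 2 + 3 * β * δ)) / (3 * β) : ℝ) : ℂ) + Complex.I * m

/-- The right branch of the same hyperbola. -/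
def gammaRight (α β δ : ℝ) (m : ℝ) : ℂ :=
  (((α + √(3 * β ^ 2 * m ^ 2 + α ^ 2 + 3 * β * δ)) / (3 * β) : ℝ) : ℂ) + Complex.I * m

/-- The horizontal line at height `h`. -/
def gammaMid (h : ℝ) (m : ℝ) : ℂ := (m : ℂ) + Complex.I * h

/-- The integral of `f` along the path `γ`, the parameter increasing through `S`. -/
def pathIntegral (γ : ℝ → ℂ) (S : Set ℝ) (f : ℂ → ℂ) : ℂ :=
  ∫ m in S, f (γ m) * deriv γ m

/-- The integral along `Γ`: down the left branch to height `h`, to the right along the horizontal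
segment that joins the two branches, and up the right branch. -/
def contourIntegral (α β δ h : ℝ) (f : ℂ → ℂ) : ℂ :=
  -pathIntegral (gammaLeft α β δ) (Ioi h) f
    + pathIntegral (gammaMid h) (Ioo (gammaLeft α β δ h).re (gammaRight α β δ h).re) f
    + pathIntegral (gammaRight α β δ) (Ioi h) f

/-! ### The reduced problem -/

/-- `g̃(κ, T) = ∫_0^T e^{κ t'} g(t') dt'`. -/
def timeTransform (g : ℝ → ℂ) (κ : ℂ) (T : ℝ) : ℂ :=
  ∫ t' in (0 : ℝ)..T, Complex.exp (κ * t') * g t'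

/-- `q(x,t) = -(i/2π) ∫_Γ e^{ikx - ω(k)t} ω'(k) g̃₀(ω(k), T) dk`. -/
def fokasSolution (α β δ h T : ℝ) (g₀ : ℝ → ℂ) (x t : ℝ) : ℂ :=
  -(Complex.I / (2 * Real.pi)) * contourIntegral α β δ h (fun k =>
    Complex.exp (Complex.I * k * x - omega α β δ k * t) * deriv (omega α β δ) k *
      timeTransform g₀ (omega α β δ k) T)

/-- `q` solves `i q_t + i β q_xxx + α q_xx + i δ q_x = 0` in the classical sense on
`(0,∞) × (0,T)`, is continuous on `(0,∞) × [0,T]` with `q(x,0) = 0`, and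
takes the boundary value `g₀` as the limit in `L²(0,T)` of `q(x,·)` as `x → 0⁺`. -/
structure SolvesReducedProblem (α β δ T : ℝ) (g₀ : ℝ → ℂ) (q : ℝ → ℝ → ℂ) : Prop where
  differentiable_time : ∀ x ∈ Ioi (0 : ℝ), ∀ t ∈ Ioo 0 T, DifferentiableAt ℝ (fun t' => q x t') t
  contDiff_space : ∀ x ∈ Ioi (0 : ℝ), ∀ t ∈ Ioo 0 T, ContDiffAt ℝ 3 (fun x' => q x' t) x
  equation : ∀ x ∈ Ioi (0 : ℝ), ∀ t ∈ Ioo 0 T,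
    Complex.I * deriv (fun t' => q x t') t
      + Complex.I * β * iteratedDeriv 3 (fun x' => q x' t) x
      + α * iteratedDeriv 2 (fun x' => q x' t) x
      + Complex.I * δ * deriv (fun x' => q x' t) x = 0
  continuousOn : ContinuousOn (fun p : ℝ × ℝ => q p.1 p.2) (Ioi 0 ×ˢ Icc 0 T)
  initial : ∀ x ∈ Ioi (0 : ℝ), q x 0 = 0
  boundary : Tendsto (fun x => eLpNorm (fun t => q x t - g₀ t) 2 (volume.restrict (Ioo 0 T)))
    (𝓝[>] 0) (𝓝 0)

end FokasHalfLine

end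

namespace FokasHalfLine
open scoped FourierTransform

/-! ### The Fourier transform on `L²` -/

/-! For `x > 0` the integrand is entire in `k` and, up to a polynomial factor, decays like `e^{-x Im
k}` along the branches. The horizontal segment can therefore be moved to the height `largeHeight`,
which depends on the coefficients only (`fokasSolution_eq_largeHeight`); this is why no constant
depends on `λ`. The two branches lie on the curve `Re ω = 0`: there `ω = iτ` with `τ` real, monotone
and of size `m³`, the factor `e^{-ωt}` is unimodular, and the time transform of `g₀` is its Fourier
transform at a real frequency.

Sobolev bound. A branch contributes `∫ e^{iγ(m)x} G(m) dm` with `Im γ = m` and `|Re γ| ≲ m`. Each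
exponential is continued to `x ≤ 0` by a rescaled Schwartz function; the transform of the
continuation has size `m^{r-1} (m + |k|)^{-r}`. For `r = s + 3/2` the weighted kernel is dominated
by one that is homogeneous of degree `-1`, and the Schur test bounds the `H^s` norm by that of `m^s
G` in `L²` (`exists_sobolevNormOn_branch_le`). The substitution `τ ~ m³` turns `m^{2s} |G|² dm` into
`(1 + τ²)^{(s+1)/3} |ĝ₀|² dτ`, which is the origin of the index `(s+1)/3`
(`exists_rpow_mul_branchFreqDeriv_le`). The segment is compact and `Re ω ≤ 0` on it, so it costs
only the `L¹` norm of `g₀` and the growth of `e^{-ωt}`, that is, `√T' e^{cT'}`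
(`exists_sobolevNormOn_midPart_le`).

The problem is solved. The plane waves `e^{ikx-ωt}` satisfy the equation, and `e^{-mx}` allows
differentiation under the integral (`fokasSolution_classical`). At `t = 0` the contour can be pushed
up to infinity, where the integral vanishes (`fokasSolution_initial`). As `x → 0⁺`, `ω` is taken as
the variable of integration; the segment can then be replaced by an interval of real frequencies, up
to an error `O(x)`. What remains is a Fourier integral of the transform of `g₀` with a multiplier
bounded by `1` and tending to `1`, and Plancherel's theorem concludes (`fokasSolution_boundary`).

Norm on the interval. Let `σ = (s+1)/3 = n + θ` with `|θ| < 1/2`, which is possible exactly when `σ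
- 1/2` is not an integer. The symbol `(1+k²)^n (1-ik)^{2θ}` has modulus `(1+k²)^σ` and real part at
least `cos(πθ)` times it, and it is holomorphic in the upper half-plane. By a Paley–Wiener argument
the form it defines vanishes on pairs of functions supported on complementary half-lines, so the two
subspaces of `H^σ` make a positive angle (`sobolevNorm_le_of_disjoint_half_lines`). Splitting at `0`
and at `T'` compares `g₀` with any extension of its restriction, uniformly in `T'`
(`exists_sobolevNorm_le_of_ae_eq`). -/

theorem integral_smul_fourier_Lp (F : Lp ℂ 2 (volume : Measure ℝ)) (φ : SchwartzMap ℝ ℂ) :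
    ∫ ξ, φ ξ • (𝓕 F : Lp ℂ 2 (volume : Measure ℝ)) ξ = ∫ x, 𝓕 φ x • F x := by
  have h := DFunLike.congr_fun (Lp.fourier_toTemperedDistribution_eq F) φ
  rw [TemperedDistribution.fourier_apply, Lp.toTemperedDistribution_apply,
    Lp.toTemperedDistribution_apply] at h
  exact h.symm

theorem integral_smul_fourierInv_Lp (F : Lp ℂ 2 (volume : Measure ℝ)) (φ : SchwartzMap ℝ ℂ) :
    ∫ ξ, φ ξ • (𝓕⁻ F : Lp ℂ 2 (volume : Measure ℝ)) ξ = ∫ x, 𝓕⁻ φ x • F x := by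
  have h := DFunLike.congr_fun (Lp.fourierInv_toTemperedDistribution_eq F) φ
  rw [TemperedDistribution.fourierInv_apply, Lp.toTemperedDistribution_apply,
    Lp.toTemperedDistribution_apply] at h
  exact h.symm

theorem integral_smul_fourier_swap {f g : ℝ → ℂ} (hf : Integrable f) (hg : Integrable g) :
    ∫ ξ, g ξ • 𝓕 f ξ = ∫ x, 𝓕 g x • f x := by
  have h := VectorFourier.integral_fourierIntegral_smul_eq_flip (μ := volume) (ν := volume)
    (e := Real.fourierChar) (L := innerₗ ℝ) Real.continuous_fourierChar
    (by exact continuous_inner) hg hf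
  rw [flip_innerₗ] at h
  exact h.symm

/-- On `L¹ ∩ L²` the `L²` Fourier transform is the Fourier integral. -/
theorem fourier_toLp_ae_eq {f : ℝ → ℂ} (hf : Integrable f) (hf2 : MemLp f 2) :
    ((𝓕 (hf2.toLp f) : Lp ℂ 2 (volume : Measure ℝ)) : ℝ → ℂ) =ᵐ[volume] 𝓕 f := by
  refine ae_eq_of_integral_contDiff_smul_eq
    ((Lp.memLp (𝓕 (hf2.toLp f) : Lp ℂ 2 (volume : Measure ℝ))).locallyIntegrable (by norm_num))
    (Continuous.locallyIntegrable ?_) ?_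
  · exact VectorFourier.fourierIntegral_continuous Real.continuous_fourierChar
      (by exact continuous_inner) hf
  intro g g_smooth g_cpt
  have hg₁ : HasCompactSupport (Complex.ofRealCLM ∘ g) := g_cpt.comp_left rfl
  have hg₂ : ContDiff ℝ ((⊤ : ℕ∞) : WithTop ℕ∞) (Complex.ofRealCLM ∘ g) :=
    Complex.ofRealCLM.contDiff.comp g_smooth
  have h1 := integral_smul_fourier_Lp (hf2.toLp f) (hg₁.toSchwartzMap hg₂)
  have h2 := integral_smul_fourier_swap hf (hg₁.toSchwartzMap hg₂).integrable
  have h3 : ∫ x, 𝓕 (hg₁.toSchwartzMap hg₂) x • (hf2.toLp f) x =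
      ∫ x, 𝓕 (⇑(hg₁.toSchwartzMap hg₂)) x • f x := by
    refine integral_congr_ae ?_
    filter_upwards [hf2.coeFn_toLp] with x hx
    rw [hx, SchwartzMap.fourier_coe]
  rw [h3, ← h2] at h1
  simpa using h1

/-! ### Sobolev norms -/

/-- The Sobolev weight `(1 + k²)^s`, `k = 2πξ`. -/
noncomputable def sobolevWeight (s ξ : ℝ) : ℝ := (1 + (2 * Real.pi * ξ) ^ 2) ^ s

theorem sobolevWeight_pos (s ξ : ℝ) : 0 < sobolevWeight s ξ := by
  unfold sobolevWeight; positivity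

theorem one_le_sobolevWeight {s : ℝ} (hs : 0 ≤ s) (ξ : ℝ) : 1 ≤ sobolevWeight s ξ :=
  Real.one_le_rpow (by nlinarith [sq_nonneg (2 * Real.pi * ξ)]) hs

theorem continuous_sobolevWeight (s : ℝ) : Continuous (sobolevWeight s) := by
  unfold sobolevWeight
  exact Continuous.rpow_const (by fun_prop) fun ξ => Or.inl (by positivity)

theorem sobolevWeight_eq_mul_self (s ξ : ℝ) :
    sobolevWeight s ξ = sobolevWeight (s / 2) ξ * sobolevWeight (s / 2) ξ := by
  unfold sobolevWeight
  rw [← Real.rpow_add (by positivity)]; ring_nf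

theorem sobolevNorm_eq_of_ae {s : ℝ} {F : Lp ℂ 2 (volume : Measure ℝ)} {f : ℝ → ℂ}
    (h : ((𝓕 F : Lp ℂ 2 (volume : Measure ℝ)) : ℝ → ℂ) =ᵐ[volume] f) :
    sobolevNorm s F =
      (∫⁻ ξ, ENNReal.ofReal (sobolevWeight s ξ) * ‖f ξ‖ₑ ^ 2) ^ (1 / 2 : ℝ) := by
  unfold sobolevNorm sobolevWeight
  congr 1
  refine lintegral_congr_ae ?_
  filter_upwards [h] with ξ hξ
  rw [hξ]

theorem weighted_enorm_sq (s ξ : ℝ) (z : ℂ) :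
    ENNReal.ofReal (sobolevWeight s ξ) * ‖z‖ₑ ^ 2 =
      (ENNReal.ofReal (sobolevWeight (s / 2) ξ) * ‖z‖ₑ) ^ (2 : ℝ) := by
  rw [sobolevWeight_eq_mul_self, ENNReal.ofReal_mul (sobolevWeight_pos _ _).le]
  rw [ENNReal.rpow_ofNat]
  ring

theorem sobolevNorm_add_le (s : ℝ) (F G : Lp ℂ 2 (volume : Measure ℝ)) :
    sobolevNorm s (F + G) ≤ sobolevNorm s F + sobolevNorm s G := by
  have hFG : ((𝓕 (F + G) : Lp ℂ 2 (volume : Measure ℝ)) : ℝ → ℂ) =ᵐ[volume]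
      fun ξ => (𝓕 F : Lp ℂ 2 (volume : Measure ℝ)) ξ + (𝓕 G : Lp ℂ 2 (volume : Measure ℝ)) ξ := by
    rw [FourierTransform.fourier_add]
    exact Lp.coeFn_add _ _
  rw [sobolevNorm_eq_of_ae hFG, sobolevNorm_eq_of_ae (s := s) (F := F) (ae_eq_refl _),
    sobolevNorm_eq_of_ae (s := s) (F := G) (ae_eq_refl _)]
  simp only [weighted_enorm_sq]
  have hm : ∀ H : Lp ℂ 2 (volume : Measure ℝ), AEMeasurable (fun ξ =>
      ENNReal.ofReal (sobolevWeight (s / 2) ξ) * ‖H ξ‖ₑ) := fun H =>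
    ((continuous_sobolevWeight _).measurable.ennreal_ofReal.aemeasurable).mul
      (Lp.aestronglyMeasurable H).enorm
  refine le_trans ?_ (ENNReal.lintegral_Lp_add_le (hm _) (hm _) (by norm_num))
  gcongr with ξ
  simp only [Pi.add_apply]
  rw [← mul_add]
  gcongr
  exact enorm_add_le _ _

theorem sobolevNorm_sub_le (s : ℝ) (F G : Lp ℂ 2 (volume : Measure ℝ)) :
    sobolevNorm s (F - G) ≤ sobolevNorm s F + sobolevNorm s G := by
  have h : sobolevNorm s (-G) = sobolevNorm s G := by
    have hG : ((𝓕 (-G) : Lp ℂ 2 (volume : Measure ℝ)) : ℝ → ℂ) =ᵐ[volume]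
        fun ξ => -(𝓕 G : Lp ℂ 2 (volume : Measure ℝ)) ξ := by
      rw [show -G = (-1 : ℂ) • G by simp, FourierTransform.fourier_smul]
      filter_upwards [Lp.coeFn_smul (-1 : ℂ) (𝓕 G : Lp ℂ 2 (volume : Measure ℝ))] with ξ hξ
      rw [hξ]; simp
    rw [sobolevNorm_eq_of_ae hG, sobolevNorm_eq_of_ae (s := s) (F := G) (ae_eq_refl _)]
    simp
  rw [sub_eq_add_neg, ← h]
  exact sobolevNorm_add_le _ _ _

/-- Plancherel's theorem, the weight being at least `1`. -/
theorem enorm_le_sobolevNorm {s : ℝ} (hs : 0 ≤ s) (F : Lp ℂ 2 (volume : Measure ℝ)) :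
    ‖F‖ₑ ≤ sobolevNorm s F := by
  have h1 : ‖F‖ₑ = ‖(𝓕 F : Lp ℂ 2 (volume : Measure ℝ))‖ₑ := by
    rw [← ofReal_norm, ← ofReal_norm, Lp.norm_fourier_eq]
  rw [h1, Lp.enorm_def, eLpNorm_eq_lintegral_rpow_enorm_toReal (by norm_num) (by norm_num)]
  unfold sobolevNorm
  simp only [ENNReal.toReal_ofNat]
  gcongr with ξ
  rw [ENNReal.rpow_ofNat]
  refine le_mul_of_one_le_left' ?_
  rw [← ENNReal.ofReal_one]
  exact ENNReal.ofReal_le_ofReal (one_le_sobolevWeight hs ξ)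

theorem sobolevNormOn_le {s : ℝ} {U : Set ℝ} {f : ℝ → ℂ} (F : Lp ℂ 2 (volume : Measure ℝ))
    (h : ∀ᵐ x ∂(volume.restrict U), F x = f x) : sobolevNormOn s U f ≤ sobolevNorm s F :=
  iInf₂_le F h

theorem sobolevNormOn_congr {s : ℝ} {U : Set ℝ} {f g : ℝ → ℂ}
    (h : f =ᵐ[volume.restrict U] g) : sobolevNormOn s U f = sobolevNormOn s U g := by
  have : ∀ f g : ℝ → ℂ, f =ᵐ[volume.restrict U] g →
      sobolevNormOn s U f ≤ sobolevNormOn s U g := fun f g h =>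
    le_iInf₂ fun F hF => sobolevNormOn_le F (by filter_upwards [h, hF] with x h1 h2; rw [h2, h1])
  exact le_antisymm (this f g h) (this g f h.symm)

theorem sobolevNormOn_add_le (s : ℝ) (U : Set ℝ) (f g : ℝ → ℂ) :
    sobolevNormOn s U (fun x => f x + g x) ≤ sobolevNormOn s U f + sobolevNormOn s U g := by
  unfold sobolevNormOn
  rw [ENNReal.iInf_add]
  refine le_iInf fun F => ?_
  rw [ENNReal.iInf_add]
  refine le_iInf fun hF => ?_
  rw [ENNReal.add_iInf]
  refine le_iInf fun G => ?_
  rw [ENNReal.add_iInf]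
  refine le_iInf fun hG => ?_
  refine (sobolevNormOn_le (F + G) ?_).trans (sobolevNorm_add_le s F G)
  filter_upwards [hF, hG, ae_restrict_of_ae (Lp.coeFn_add F G)] with x h1 h2 h3
  rw [h3, Pi.add_apply, h1, h2]

/-- On the whole line the extension is unique in `L²`, so the infimum runs over a single class. -/
theorem sobolevNormOn_univ_eq {s : ℝ} {f : ℝ → ℂ} (F : Lp ℂ 2 (volume : Measure ℝ))
    (h : F =ᵐ[volume] f) : sobolevNormOn s univ f = sobolevNorm s F := by
  refine le_antisymm (sobolevNormOn_le F (by rw [Measure.restrict_univ]; exact h)) (le_iInf₂ fun G hG => ?_)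
  rw [Measure.restrict_univ] at hG
  have : F = G := Lp.ext (h.trans (EventuallyEq.symm hG))
  rw [this]

end FokasHalfLine

namespace FokasHalfLine
open scoped FourierTransform

/-! ### Extension of exponentials from the half-line -/

/-- There is a Schwartz function which coincides with `e^{-y}` on the half-line. -/
theorem exists_schwartzMap_eq_exp_neg :
    ∃ ψ : SchwartzMap ℝ ℂ, ∀ y : ℝ, 0 < y → ψ y = Complex.exp (-y) := by
  -- The cutoff is `1` for `y ≥ 0` and `0` for `y ≤ -1`, so only the compact interval `[-1, 1]` and
  -- the tail `y > 1` matter for the seminorms.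
  set f : ℝ → ℂ := fun y => ((Real.smoothTransition (y + 1) * Real.exp (-y) : ℝ) : ℂ) with hf
  have hsm : ContDiff ℝ ((⊤ : ℕ∞) : WithTop ℕ∞) f := by
    refine Complex.ofRealCLM.contDiff.comp ?_
    exact (Real.smoothTransition.contDiff.comp (contDiff_id.add contDiff_const)).mul
      (Real.contDiff_exp.comp contDiff_neg)
  have hexp : ∀ (n : ℕ) (y : ℝ), iteratedDeriv n (fun y : ℝ => Complex.exp (-y)) y =
      (-1) ^ n * Complex.exp (-y) := by
    intro n
    induction n with
    | zero => intro y; simp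
    | succ n ih =>
      intro y
      rw [iteratedDeriv_succ, show iteratedDeriv n (fun y : ℝ => Complex.exp (-y)) =
        fun y : ℝ => (-1) ^ n * Complex.exp (-y) from funext ih]
      have : HasDerivAt (fun y : ℝ => (-1 : ℂ) ^ n * Complex.exp (-(y : ℂ)))
          ((-1) ^ n * (Complex.exp (-(y : ℂ)) * (-1))) y :=
        ((Complex.ofRealCLM.hasDerivAt (x := y)).neg.cexp).const_mul _
      rw [this.deriv]; ring
  have hpos : ∀ (n : ℕ) (y : ℝ), 0 < y →
      iteratedDeriv n f y = (-1) ^ n * Complex.exp (-y) := by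
    intro n y hy
    rw [← hexp]
    refine Filter.EventuallyEq.iteratedDeriv_eq n ?_
    filter_upwards [lt_mem_nhds hy] with z hz
    simp [hf, Real.smoothTransition.one_of_one_le (x := z + 1) (by linarith)]
  have hneg : ∀ (n : ℕ) (y : ℝ), y < -1 → iteratedDeriv n f y = 0 := by
    intro n y hy
    have : iteratedDeriv n f y = iteratedDeriv n (fun _ : ℝ => (0 : ℂ)) y := by
      refine Filter.EventuallyEq.iteratedDeriv_eq n ?_
      filter_upwards [gt_mem_nhds hy] with z hz
      simp [hf, Real.smoothTransition.zero_of_nonpos (x := z + 1) (by linarith)]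
    rw [this]; simp
  refine ⟨⟨f, hsm, fun k n => ?_⟩, fun y hy => ?_⟩
  · have hc : Continuous fun x : ℝ => ‖x‖ ^ k * ‖iteratedDeriv n f x‖ :=
      (continuous_norm.pow k).mul (hsm.continuous_iteratedDeriv n (by exact_mod_cast le_top)).norm
    obtain ⟨C, hC⟩ := (isCompact_Icc (a := (-1 : ℝ)) (b := 1)).exists_bound_of_continuousOn
      hc.continuousOn
    refine ⟨max C (k.factorial), fun x => ?_⟩
    rw [norm_iteratedFDeriv_eq_norm_iteratedDeriv]
    rcases lt_or_ge x (-1) with h | h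
    · rw [hneg n x h]
      simp only [norm_zero, mul_zero]
      exact le_max_of_le_right (by positivity)
    rcases le_or_gt x 1 with h' | h'
    · refine le_max_of_le_left ((le_abs_self _).trans ?_)
      exact hC x ⟨h, h'⟩
    · refine le_max_of_le_right ?_
      have hx : (0 : ℝ) < x := by linarith
      rw [hpos n x hx, norm_mul, norm_pow, norm_neg, norm_one, one_pow, one_mul,
        ← Complex.ofReal_neg, Complex.norm_exp_ofReal, Real.norm_of_nonneg hx.le, Real.exp_neg,
        ← div_eq_mul_inv, div_le_iff₀ (Real.exp_pos _)]
      have := Real.pow_div_factorial_le_exp x hx.le k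
      rw [div_le_iff₀ (by positivity)] at this
      linarith
  · change f y = _
    simp [hf, Real.smoothTransition.one_of_one_le (x := y + 1) (by linarith)]

theorem schwartzMap_rpow_decay (φ : SchwartzMap ℝ ℂ) (r : ℝ) :
    ∃ C : ℝ, 0 < C ∧ ∀ x, ‖φ x‖ ≤ C * (1 + |x|) ^ (-r) := by
  obtain ⟨n, hn⟩ := exists_nat_ge r
  set C := 2 ^ n * (Finset.Iic (n, 0)).sup
    (fun m => SchwartzMap.seminorm ℝ (E := ℝ) (F := ℂ) m.1 m.2) φ with hCdef
  have h : ∀ x, (1 + |x|) ^ n * ‖φ x‖ ≤ C := by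
    intro x
    have := SchwartzMap.one_add_le_sup_seminorm_apply (𝕜 := ℝ) (m := (n, 0)) (k := n) (n := 0)
      le_rfl le_rfl φ x
    simpa using this
  have hC : 0 ≤ C := le_trans (by positivity) (h 0)
  refine ⟨C + 1, by linarith, fun x => ?_⟩
  have hx : 1 ≤ 1 + |x| := by linarith [abs_nonneg x]
  rw [Real.rpow_neg (by positivity), ← div_eq_mul_inv, le_div_iff₀ (by positivity)]
  calc ‖φ x‖ * (1 + |x|) ^ r ≤ ‖φ x‖ * (1 + |x|) ^ (n : ℝ) := by gcongr
    _ = (1 + |x|) ^ n * ‖φ x‖ := by rw [Real.rpow_natCast]; ring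
    _ ≤ C + 1 := by linarith [h x]

/-- An extension of `x ↦ e^{izx}` from `x > 0` to the line, built from `ψ`. -/
noncomputable def extExp (ψ : SchwartzMap ℝ ℂ) (z : ℂ) (x : ℝ) : ℂ :=
  Complex.exp (Complex.I * (z.re * x : ℝ)) * ψ (z.im * x)

/-- The Fourier transform of `extExp ψ z`. -/
noncomputable def extExpHat (ψ : SchwartzMap ℝ ℂ) (z : ℂ) (ξ : ℝ) : ℂ :=
  ((z.im⁻¹ : ℝ) : ℂ) * 𝓕 ψ ((ξ - z.re / (2 * Real.pi)) / z.im)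

theorem extExp_eq {ψ : SchwartzMap ℝ ℂ} (hψ : ∀ y : ℝ, 0 < y → ψ y = Complex.exp (-y))
    {z : ℂ} (hz : 0 < z.im) {x : ℝ} (hx : 0 < x) :
    extExp ψ z x = Complex.exp (Complex.I * z * x) := by
  unfold extExp
  rw [hψ _ (by positivity), ← Complex.exp_add]
  congr 1
  apply Complex.ext <;> simp

theorem integrable_extExp (ψ : SchwartzMap ℝ ℂ) {z : ℂ} (hz : 0 < z.im) :
    Integrable (extExp ψ z) := by
  have h1 : Integrable (fun x : ℝ => ψ (z.im * x)) :=
    (ψ.integrable (μ := volume)).comp_mul_left' hz.ne'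
  refine h1.bdd_mul (c := 1) (by fun_prop) (ae_of_all _ fun x => ?_)
  rw [mul_comm, Complex.norm_exp_ofReal_mul_I]

theorem fourier_extExp (ψ : SchwartzMap ℝ ℂ) {z : ℂ} (hz : 0 < z.im) (ξ : ℝ) :
    𝓕 (extExp ψ z) ξ = extExpHat ψ z ξ := by
  unfold extExpHat
  rw [SchwartzMap.fourier_coe, Real.fourier_real_eq_integral_exp_smul,
    Real.fourier_real_eq_integral_exp_smul]
  have := Measure.integral_comp_mul_left (fun v : ℝ =>
    Complex.exp (↑(-2 * Real.pi * v * ((ξ - z.re / (2 * Real.pi)) / z.im)) * Complex.I) • ψ v) z.im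
  rw [abs_of_pos (by positivity), Complex.real_smul] at this
  rw [← this]
  refine integral_congr_ae (ae_of_all _ fun x => ?_)
  simp only [extExp, smul_eq_mul]
  rw [← mul_assoc, ← Complex.exp_add]
  congr 2
  have h1 : (Real.pi : ℂ) ≠ 0 := by exact_mod_cast Real.pi_ne_zero
  have h2 : (z.im : ℂ) ≠ 0 := by exact_mod_cast hz.ne'
  push_cast
  field_simp
  ring

/-- The transform is that of `ψ`, dilated by `Im z` and shifted by `Re z / 2π`. In the sector `|Re
z| ≤ K Im z` the shift is at most a multiple of the dilation, so `Im z + |2πξ|` is bounded by `Im z`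
times `1 +` the rescaled argument, and the rapid decay of `𝓕 ψ` gives any power `r`. -/
theorem exists_norm_extExpHat_le (ψ : SchwartzMap ℝ ℂ) (K : ℝ) (hK : 0 ≤ K) {r : ℝ} (hr : 0 ≤ r) :
    ∃ C : ℝ, 0 < C ∧ ∀ z : ℂ, 0 < z.im → |z.re| ≤ K * z.im → ∀ ξ : ℝ,
      ‖extExpHat ψ z ξ‖ ≤ C * (z.im ^ (r - 1) * (z.im + |2 * Real.pi * ξ|) ^ (-r)) := by
  obtain ⟨C, hC, h⟩ := schwartzMap_rpow_decay (𝓕 ψ) r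
  refine ⟨C * ((2 * Real.pi) * (1 + K)) ^ r, by positivity, fun z hz hzK ξ => ?_⟩
  have hpi := Real.pi_gt_three
  set y := (ξ - z.re / (2 * Real.pi)) / z.im with hy
  have h1 : z.im + |2 * Real.pi * ξ| ≤ z.im * (1 + |y|) * ((2 * Real.pi) * (1 + K)) := by
    have e : 2 * Real.pi * ξ = 2 * Real.pi * (z.im * y) + z.re := by
      rw [hy]; field_simp; ring
    rw [e]
    have h2 := abs_add_le (2 * Real.pi * (z.im * y)) z.re
    rw [abs_mul, abs_mul z.im, abs_of_pos hz, abs_of_pos (by positivity : 0 < 2 * Real.pi)] at h2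
    have h3 : z.im + |2 * Real.pi * (z.im * y) + z.re| ≤
        z.im + (2 * Real.pi * (z.im * |y|) + K * z.im) := by linarith
    refine h3.trans ?_
    have : 0 ≤ z.im * |y| := by positivity
    have : 0 ≤ z.im * K := by positivity
    have : 0 ≤ z.im * |y| * K * Real.pi := by positivity
    nlinarith [mul_pos hz (by linarith : 0 < 2 * Real.pi - 1)]
  have h4 : (1 + |y|) ^ (-r) ≤
      ((2 * Real.pi) * (1 + K)) ^ r * (z.im ^ r * (z.im + |2 * Real.pi * ξ|) ^ (-r)) := by
    have h5 : (z.im + |2 * Real.pi * ξ|) ^ r ≤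
        (z.im * (1 + |y|) * ((2 * Real.pi) * (1 + K))) ^ r := by gcongr
    rw [Real.mul_rpow (by positivity) (by positivity),
      Real.mul_rpow (by positivity) (by positivity)] at h5
    rw [Real.rpow_neg (by positivity), Real.rpow_neg (by positivity)]
    rw [inv_le_iff_one_le_mul₀ (by positivity)]
    have h6 : 0 < (z.im + |2 * Real.pi * ξ|) ^ r := by positivity
    field_simp
    linarith
  unfold extExpHat
  rw [norm_mul, Complex.norm_real, Real.norm_of_nonneg (by positivity)]
  calc z.im⁻¹ * ‖𝓕 ψ y‖ ≤ z.im⁻¹ * (C * (((2 * Real.pi) * (1 + K)) ^ r *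
        (z.im ^ r * (z.im + |2 * Real.pi * ξ|) ^ (-r)))) := by
        gcongr
        exact (h y).trans (by gcongr)
    _ = _ := by
        rw [Real.rpow_sub hz, Real.rpow_one]; field_simp

theorem measurable_extExpHat (ψ : SchwartzMap ℝ ℂ) {γ : ℝ → ℂ} (hγ : Measurable γ) :
    Measurable fun p : ℝ × ℝ => extExpHat ψ (γ p.2) p.1 := by
  unfold extExpHat
  have h1 : Measurable fun p : ℝ × ℝ => (γ p.2).im :=
    Complex.measurable_im.comp (hγ.comp measurable_snd)
  have h2 : Measurable fun p : ℝ × ℝ => (γ p.2).re :=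
    Complex.measurable_re.comp (hγ.comp measurable_snd)
  exact (Complex.measurable_ofReal.comp h1.inv).mul ((𝓕 ψ).continuous.measurable.comp
    ((measurable_fst.sub (h2.div_const _)).div h1))

/-- A superposition of decaying exponentials on the half-line extends to a function in `H^s(ℝ)` as
soon as the superposition of the extensions `extExp` has finite norm. -/
theorem sobolevNormOn_integral_exp_le {ψ : SchwartzMap ℝ ℂ}
    (hψ : ∀ y : ℝ, 0 < y → ψ y = Complex.exp (-y)) {s : ℝ} (hs : 0 ≤ s) (ν : Measure ℝ) [SFinite ν]
    {γ G : ℝ → ℂ} (hγ : Measurable γ) (hG : AEStronglyMeasurable G ν)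
    (hpos : ∀ᵐ m ∂ν, 0 < (γ m).im)
    (hint : ∀ x : ℝ, 0 < x → Integrable (fun m => Real.exp (-(γ m).im * x) * ‖G m‖) ν)
    (hcont : ContinuousOn (fun x : ℝ => ∫ m, Complex.exp (Complex.I * γ m * x) * G m ∂ν) (Ioi 0))
    {B : ℝ≥0∞} (hBtop : B ≠ ⊤)
    (hB : (∫⁻ ξ, ENNReal.ofReal (sobolevWeight s ξ) *
      (∫⁻ m, ‖extExpHat ψ (γ m) ξ‖ₑ * ‖G m‖ₑ ∂ν) ^ 2) ^ (1 / 2 : ℝ) ≤ B) :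
    sobolevNormOn s (Ioi 0) (fun x => ∫ m, Complex.exp (Complex.I * γ m * x) * G m ∂ν) ≤ B := by
  set A : ℝ → ℝ≥0∞ := fun ξ => ∫⁻ m, ‖extExpHat ψ (γ m) ξ‖ₑ * ‖G m‖ₑ ∂ν with hA
  set Φ : ℝ → ℂ := fun ξ => ∫ m, extExpHat ψ (γ m) ξ * G m ∂ν with hΦ
  have hKm := measurable_extExpHat ψ hγ
  have hprod : AEStronglyMeasurable (fun p : ℝ × ℝ => extExpHat ψ (γ p.2) p.1 * G p.2)
      ((volume : Measure ℝ).prod ν) := hKm.aestronglyMeasurable.mul hG.comp_snd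
  have hΦm : AEStronglyMeasurable Φ volume := hprod.integral_prod_right'
  have hAm : AEMeasurable A volume := by
    have := hprod.enorm.lintegral_prod_right'
    simpa only [enorm_mul] using this
  have hΦA : ∀ ξ, ‖Φ ξ‖ₑ ≤ A ξ := fun ξ => by
    refine (enorm_integral_le_lintegral_enorm _).trans (le_of_eq ?_)
    simp only [hA, enorm_mul]
  have hwA : ∫⁻ ξ, ENNReal.ofReal (sobolevWeight s ξ) * A ξ ^ 2 < ⊤ := by
    by_contra hcon
    rw [not_lt_top_iff] at hcon
    rw [hcon, ENNReal.top_rpow_of_pos (by norm_num)] at hB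
    exact hBtop (top_le_iff.mp hB)
  have hw1 : ∀ ξ, 1 ≤ ENNReal.ofReal (sobolevWeight s ξ) := fun ξ => by
    rw [← ENNReal.ofReal_one]; exact ENNReal.ofReal_le_ofReal (one_le_sobolevWeight hs ξ)
  have hA2 : ∫⁻ ξ, A ξ ^ 2 < ⊤ :=
    (lintegral_mono fun ξ => le_mul_of_one_le_left' (hw1 ξ)).trans_lt hwA
  have hΦ2 : MemLp Φ 2 := by
    refine ⟨hΦm, ?_⟩
    rw [eLpNorm_lt_top_iff_lintegral_rpow_enorm_lt_top (by norm_num) (by norm_num)]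
    refine (lintegral_mono fun ξ => ?_).trans_lt hA2
    rw [ENNReal.toReal_ofNat, ENNReal.rpow_ofNat]
    gcongr
    exact hΦA ξ
  -- The extension is defined by its transform `Φ`, so its norm is bounded at once. What has to be
  -- proved is that it agrees with the superposition on the half-line; this is done by duality with
  -- test functions supported there.
  set F : Lp ℂ 2 (volume : Measure ℝ) := 𝓕⁻ (hΦ2.toLp Φ) with hF
  have hFF : ((𝓕 F : Lp ℂ 2 (volume : Measure ℝ)) : ℝ → ℂ) =ᵐ[volume] Φ := by
    rw [hF, FourierTransform.fourier_fourierInv_eq]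
    exact hΦ2.coeFn_toLp
  have hnorm : sobolevNorm s F ≤ B := by
    rw [sobolevNorm_eq_of_ae hFF]
    refine le_trans ?_ hB
    gcongr with ξ
    exact hΦA ξ
  refine (sobolevNormOn_le F ?_).trans hnorm
  set q : ℝ → ℂ := fun x => ∫ m, Complex.exp (Complex.I * γ m * x) * G m ∂ν with hq
  have key : ∀ᵐ x, x ∈ Ioi (0 : ℝ) → (fun x => F x - q x) x = 0 := by
    have hFloc : LocallyIntegrable (F : ℝ → ℂ) volume := (Lp.memLp F).locallyIntegrable (by norm_num)
    refine isOpen_Ioi.ae_eq_zero_of_integral_contDiff_smul_eq_zero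
      ((hFloc.locallyIntegrableOn _).sub (hcont.locallyIntegrableOn measurableSet_Ioi)) ?_
    intro g g_smooth g_cpt g_supp
    have hg₁ : HasCompactSupport (Complex.ofRealCLM ∘ g) := g_cpt.comp_left rfl
    have hg₂ : ContDiff ℝ ((⊤ : ℕ∞) : WithTop ℕ∞) (Complex.ofRealCLM ∘ g) :=
      Complex.ofRealCLM.contDiff.comp g_smooth
    set φ : SchwartzMap ℝ ℂ := hg₁.toSchwartzMap hg₂ with hφ
    have hφg : ∀ x, φ x = (g x : ℂ) := fun x => rfl
    -- The test function lives on `x ≥ ε`, where `e^{-Im γ x} ≤ e^{-Im γ ε}`; integrability of the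
    -- superposition is known at positive `x` only.
    obtain ⟨ε, hε, hεg⟩ : ∃ ε : ℝ, 0 < ε ∧ ∀ x, g x ≠ 0 → ε ≤ x := by
      rcases (tsupport g).eq_empty_or_nonempty with h0 | h0
      · refine ⟨1, one_pos, fun x hx => ?_⟩
        have := subset_tsupport g hx
        rw [h0] at this
        exact this.elim
      · obtain ⟨ε, hε1, hε2⟩ := g_cpt.isCompact.exists_isLeast h0
        exact ⟨ε, g_supp hε1, fun x hx => hε2 (subset_tsupport g hx)⟩
    have hcomb : Integrable (fun p : ℝ × ℝ => φ p.1 *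
        (Complex.exp (Complex.I * γ p.2 * p.1) * G p.2)) ((volume : Measure ℝ).prod ν) := by
      have hb : Integrable (fun p : ℝ × ℝ => ‖φ p.1‖ * (Real.exp (-(γ p.2).im * ε) * ‖G p.2‖))
          ((volume : Measure ℝ).prod ν) := (φ.integrable.norm).mul_prod (hint ε hε)
      refine hb.mono' ?_ ?_
      · have h1 : Measurable fun p : ℝ × ℝ => Complex.exp (Complex.I * γ p.2 * p.1) := by
          have : Measurable fun p : ℝ × ℝ => γ p.2 := hγ.comp measurable_snd
          fun_prop
        exact (φ.continuous.measurable.comp measurable_fst).aestronglyMeasurable.mul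
          (h1.aestronglyMeasurable.mul hG.comp_snd)
      · have h1 : ∀ᵐ p ∂((volume : Measure ℝ).prod ν), 0 < (γ p.2).im :=
          Measure.quasiMeasurePreserving_snd.ae hpos
        filter_upwards [h1] with p hp
        rw [norm_mul, norm_mul, Complex.norm_exp]
        by_cases hgp : g p.1 = 0
        · simp [hφg, hgp]
        have : (Complex.I * γ p.2 * p.1).re = -(γ p.2).im * p.1 := by simp
        rw [this]
        have : -(γ p.2).im * p.1 ≤ -(γ p.2).im * ε := by nlinarith [hεg _ hgp]
        gcongr
    have h1 : ∫ x, φ x • F x = ∫ x, φ x • q x := by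
      rw [hF, integral_smul_fourierInv_Lp]
      have e1 : ∫ x, 𝓕⁻ φ x • (hΦ2.toLp Φ) x =
          ∫ ξ, ∫ m, 𝓕⁻ φ ξ * (extExpHat ψ (γ m) ξ * G m) ∂ν := by
        refine integral_congr_ae ?_
        filter_upwards [hΦ2.coeFn_toLp] with ξ hξ
        rw [hξ, smul_eq_mul, integral_const_mul]
      rw [e1, integral_integral_swap]
      · have e2 : ∀ᵐ m ∂ν, ∫ ξ, 𝓕⁻ φ ξ * (extExpHat ψ (γ m) ξ * G m) =
            ∫ x, φ x * (Complex.exp (Complex.I * γ m * x) * G m) := by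
          filter_upwards [hpos] with m hm
          have e3 : ∫ ξ, 𝓕⁻ φ ξ * (extExpHat ψ (γ m) ξ * G m) =
              (∫ ξ, 𝓕⁻ φ ξ • 𝓕 (extExp ψ (γ m)) ξ) * G m := by
            rw [← integral_mul_const]
            refine integral_congr_ae (ae_of_all _ fun ξ => ?_)
            simp only [smul_eq_mul]
            rw [fourier_extExp ψ hm, mul_assoc]
          -- The multiplication formula returns `φ` itself, and on the support of `φ` the function
          -- `extExp` is the true exponential.
          rw [e3, integral_smul_fourier_swap (integrable_extExp ψ hm) (𝓕⁻ φ).integrable,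
            ← SchwartzMap.fourier_coe, FourierTransform.fourier_fourierInv_eq,
            ← integral_mul_const]
          refine integral_congr_ae (ae_of_all _ fun x => ?_)
          simp only [smul_eq_mul]
          by_cases hgx : g x = 0
          · simp [hφg, hgx]
          rw [extExp_eq hψ hm (hε.trans_le (hεg x hgx)), mul_assoc]
        rw [integral_congr_ae e2, integral_integral_swap]
        · simp only [smul_eq_mul, integral_const_mul, hq]
        · exact hcomb.swap
      · refine ⟨(𝓕⁻ φ).continuous.measurable.comp measurable_fst |>.aestronglyMeasurable.mul hprod,
          ?_⟩
        rw [hasFiniteIntegral_iff_enorm, lintegral_prod]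
        · have e4 : ∀ ξ, ∫⁻ m, ‖𝓕⁻ φ ξ * (extExpHat ψ (γ m) ξ * G m)‖ₑ ∂ν = ‖𝓕⁻ φ ξ‖ₑ * A ξ := by
            intro ξ
            simp only [enorm_mul]
            rw [lintegral_const_mul' _ _ enorm_ne_top]
          simp only [Function.uncurry]
          simp only [e4]
          -- Fubini is justified by the Cauchy–Schwarz inequality: both `𝓕⁻ φ` and the majorant `A`
          -- are square integrable.
          refine (ENNReal.lintegral_mul_le_Lp_mul_Lq volume (p := 2) (q := 2)
            Real.HolderConjugate.two_two
            (𝓕⁻ φ).continuous.enorm.measurable.aemeasurable hAm).trans_lt ?_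
          refine ENNReal.mul_lt_top ?_ ?_
          · have := ((𝓕⁻ φ).memLp 2 volume).2
            rw [eLpNorm_lt_top_iff_lintegral_rpow_enorm_lt_top (by norm_num) (by norm_num)] at this
            exact ENNReal.rpow_lt_top_of_nonneg (by norm_num) (by simpa using this.ne)
          · exact ENNReal.rpow_lt_top_of_nonneg (by norm_num) (by simpa using hA2.ne)
        · exact (((𝓕⁻ φ).continuous.measurable.comp measurable_fst).aestronglyMeasurable.mul
            hprod).enorm
    have h2 : ∀ x, g x • (F x - q x) = φ x • F x - φ x • q x := fun x => by
      rw [hφg, Complex.real_smul]; simp [mul_sub]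
    simp only [h2]
    rw [integral_sub, h1, sub_self]
    · have := hFloc.integrable_smul_left_of_hasCompactSupport
        (g := fun x => (g x : ℝ)) g_smooth.continuous g_cpt
      refine this.congr (ae_of_all _ fun x => ?_)
      simp [hφg]
    · have := hcomb.integral_prod_left
      refine this.congr (ae_of_all _ fun x => ?_)
      simp only [smul_eq_mul, integral_const_mul, hq]
  rw [ae_restrict_iff' measurableSet_Ioi]
  filter_upwards [key] with x hx h0
  exact sub_eq_zero.mp (hx h0)

end FokasHalfLine

namespace FokasHalfLine
open scoped FourierTransform

/-! ### Schur test -/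

/-- Cauchy–Schwarz for `K f = (K q)^{1/2} (K q⁻¹ f²)^{1/2}` in `y`, the first hypothesis for the
first factor, then Tonelli and the second hypothesis. -/
theorem lintegral_sq_le_of_schur {α β : Type*} [MeasurableSpace α] [MeasurableSpace β]
    {μ : Measure α} {ν : Measure β} [SFinite μ] [SFinite ν] {K : α → β → ℝ≥0∞}
    (hK : Measurable (Function.uncurry K)) {f : β → ℝ≥0∞} (hf : AEMeasurable f ν)
    {p : α → ℝ≥0∞} {q : β → ℝ≥0∞} (hp : Measurable p) (hq : Measurable q)
    (hq0 : ∀ᵐ y ∂ν, q y ≠ 0 ∧ q y ≠ ⊤) {C₁ C₂ : ℝ≥0∞}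
    (h₁ : ∀ x, ∫⁻ y, K x y * q y ∂ν ≤ C₁ * p x)
    (h₂ : ∀ᵐ y ∂ν, ∫⁻ x, p x * K x y ∂μ ≤ C₂ * q y) :
    ∫⁻ x, (∫⁻ y, K x y * f y ∂ν) ^ 2 ∂μ ≤ C₁ * C₂ * ∫⁻ y, f y ^ 2 ∂ν := by
  have hKx : ∀ x, Measurable (K x) := fun x => hK.comp measurable_prodMk_left
  have cs : ∀ x, (∫⁻ y, K x y * f y ∂ν) ^ 2 ≤
      C₁ * p x * ∫⁻ y, K x y * ((q y)⁻¹ * f y ^ 2) ∂ν := by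
    intro x
    have h := ENNReal.lintegral_mul_le_Lp_mul_Lq ν (p := 2) (q := 2)
      Real.HolderConjugate.two_two
      (f := fun y => (K x y * q y) ^ (1 / 2 : ℝ))
      (g := fun y => (K x y * ((q y)⁻¹ * f y ^ 2)) ^ (1 / 2 : ℝ))
      (((hKx x).mul hq).pow_const _).aemeasurable
      (((hKx x).aemeasurable.mul (hq.inv.aemeasurable.mul (hf.pow_const 2))).pow_const (1 / 2 : ℝ))
    have e : ∫⁻ y, K x y * f y ∂ν = ∫⁻ y, ((fun y => (K x y * q y) ^ (1 / 2 : ℝ)) *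
        (fun y => (K x y * ((q y)⁻¹ * f y ^ 2)) ^ (1 / 2 : ℝ))) y ∂ν := by
      refine lintegral_congr_ae ?_
      filter_upwards [hq0] with y hy
      simp only [Pi.mul_apply]
      rw [← ENNReal.mul_rpow_of_nonneg _ _ (by norm_num),
        show K x y * q y * (K x y * ((q y)⁻¹ * f y ^ 2)) = (q y * (q y)⁻¹) * (K x y * f y) ^ 2 by
          ring, ENNReal.mul_inv_cancel hy.1 hy.2, one_mul, ← ENNReal.rpow_ofNat,
        ← ENNReal.rpow_mul]
      norm_num
    rw [← e] at h
    have hsq : ∀ z : ℝ≥0∞, (z ^ (1 / 2 : ℝ)) ^ (2 : ℝ) = z := fun z => by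
      rw [← ENNReal.rpow_mul]; norm_num
    simp only [hsq] at h
    calc (∫⁻ y, K x y * f y ∂ν) ^ 2 ≤ ((∫⁻ y, K x y * q y ∂ν) ^ (1 / 2 : ℝ) *
          (∫⁻ y, K x y * ((q y)⁻¹ * f y ^ 2) ∂ν) ^ (1 / 2 : ℝ)) ^ 2 := by gcongr
      _ = (∫⁻ y, K x y * q y ∂ν) * ∫⁻ y, K x y * ((q y)⁻¹ * f y ^ 2) ∂ν := by
          rw [mul_pow, ← ENNReal.rpow_ofNat, ← ENNReal.rpow_ofNat]
          simp only [hsq]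
      _ ≤ _ := by gcongr; exact h₁ x
  have hgm : AEMeasurable (fun y => (q y)⁻¹ * f y ^ 2) ν :=
    hq.inv.aemeasurable.mul (hf.pow_const _)
  have hjoint : AEMeasurable (Function.uncurry fun x y => p x * (K x y * ((q y)⁻¹ * f y ^ 2)))
      (μ.prod ν) :=
    (hp.comp measurable_fst).aemeasurable.mul (hK.aemeasurable.mul
      (hgm.comp_quasiMeasurePreserving Measure.quasiMeasurePreserving_snd))
  calc ∫⁻ x, (∫⁻ y, K x y * f y ∂ν) ^ 2 ∂μ
      ≤ ∫⁻ x, C₁ * (∫⁻ y, p x * (K x y * ((q y)⁻¹ * f y ^ 2)) ∂ν) ∂μ := by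
        refine lintegral_mono fun x => (cs x).trans (le_of_eq ?_)
        rw [mul_assoc]
        congr 1
        exact (lintegral_const_mul'' _ ((hKx x).aemeasurable.mul hgm)).symm
    _ = C₁ * ∫⁻ y, ∫⁻ x, p x * (K x y * ((q y)⁻¹ * f y ^ 2)) ∂μ ∂ν := by
        rw [← lintegral_lintegral_swap hjoint]
        exact lintegral_const_mul'' _ hjoint.lintegral_prod_right'
    _ = C₁ * ∫⁻ y, (∫⁻ x, p x * K x y ∂μ) * ((q y)⁻¹ * f y ^ 2) ∂ν := by
        congr 1
        refine lintegral_congr fun y => ?_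
        refine Eq.trans ?_ (lintegral_mul_const _ (hp.mul (hK.comp measurable_prodMk_right)))
        refine lintegral_congr fun x => ?_
        exact (mul_assoc _ _ _).symm
    _ ≤ C₁ * ∫⁻ y, C₂ * f y ^ 2 ∂ν := by
        gcongr C₁ * ?_
        refine lintegral_mono_ae ?_
        filter_upwards [h₂, hq0] with y hy hy0
        calc (∫⁻ x, p x * K x y ∂μ) * ((q y)⁻¹ * f y ^ 2)
            ≤ (C₂ * q y) * ((q y)⁻¹ * f y ^ 2) := by gcongr
          _ = (q y * (q y)⁻¹) * (C₂ * f y ^ 2) := by ring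
          _ = _ := by rw [ENNReal.mul_inv_cancel hy0.1 hy0.2, one_mul]
    _ = _ := by rw [lintegral_const_mul'' _ (hf.pow_const _), mul_assoc]

theorem lintegral_comp_abs_eq (f : ℝ → ℝ≥0∞) :
    ∫⁻ x, f |x| = 2 * ∫⁻ x in Ioi (0 : ℝ), f x := by
  have h1 : ∫⁻ x in Ioi (0 : ℝ), f |x| = ∫⁻ x in Ioi (0 : ℝ), f x :=
    setLIntegral_congr_fun measurableSet_Ioi fun x hx => by rw [abs_of_pos hx]
  have h2 : ∫⁻ x in Iic (0 : ℝ), f |x| = ∫⁻ x in Ioi (0 : ℝ), f |x| := by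
    have := (Measure.measurePreserving_neg (volume : Measure ℝ)).setLIntegral_comp_preimage_emb
      (MeasurableEquiv.neg ℝ).measurableEmbedding (fun x => f |x|) (Ici 0)
    rw [setLIntegral_congr Ioi_ae_eq_Ici, ← this]
    simp
  rw [← lintegral_add_compl _ (measurableSet_Ioi (a := (0 : ℝ))), compl_Ioi, h2, h1, two_mul]

theorem lintegral_Ioi_deriv_eq {g g' : ℝ → ℝ} {a l : ℝ} (hc : ContinuousWithinAt g (Ici a) a)
    (hd : ∀ x ∈ Ioi a, HasDerivAt g (g' x) x) (hn : ∀ x ∈ Ioi a, 0 ≤ g' x)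
    (hl : Tendsto g atTop (𝓝 l)) :
    ∫⁻ x in Ioi a, ENNReal.ofReal (g' x) = ENNReal.ofReal (l - g a) := by
  rw [← integral_Ioi_of_hasDerivAt_of_nonneg hc hd hn hl,
    ofReal_integral_eq_lintegral_ofReal (integrableOn_Ioi_deriv_of_nonneg hc hd hn hl)]
  exact (ae_restrict_iff' measurableSet_Ioi).mpr (ae_of_all _ hn)

theorem lintegral_Ioi_inv_mul_sqrt {a κ : ℝ} (ha : 0 < a) (hκ : 0 ≤ κ) :
    ∫⁻ m in Ioi a, ENNReal.ofReal (1 / ((m + κ) * √(m + κ))) = ENNReal.ofReal (2 / √(a + κ)) := by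
  have hd : ∀ x : ℝ, 0 < x + κ →
      HasDerivAt (fun m => -2 / √(m + κ)) (1 / ((x + κ) * √(x + κ))) x := by
    intro x hx
    have h1 := (((hasDerivAt_id x).add_const κ).sqrt hx.ne').inv (Real.sqrt_ne_zero'.mpr hx)
    have h2 := h1.const_mul (-2)
    refine h2.congr_deriv ?_
    simp only [id]
    rw [Real.sq_sqrt hx.le]
    have : √(x + κ) ≠ 0 := Real.sqrt_ne_zero'.mpr hx
    field_simp
  rw [lintegral_Ioi_deriv_eq (g := fun m => -2 / √(m + κ)) (l := 0)]
  · congr 1; ring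
  · exact (hd a (by positivity)).continuousAt.continuousWithinAt
  · intro x hx
    have : a < x := hx
    exact hd x (by linarith)
  · intro x hx
    have : a < x := hx
    have : 0 < x := by linarith
    positivity
  · refine Tendsto.const_div_atTop ?_ _
    exact Real.tendsto_sqrt_atTop.comp (tendsto_atTop_add_const_right _ _ tendsto_id)

/-- The second Schur condition for the kernel `√m (m + κ)^{-3/2}`, `κ = |2πξ|`, with weights `(1 +
κ)^{-1/2}` and `m^{-1/2}`. Replacing `1 + κ` by `κ` makes the integral explicit, because `(2/m)
√(κ/(m + κ))` is a primitive of `κ^{-1/2} (m + κ)^{-3/2}`. The resulting constant is `2/π ≤ 1`. -/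
theorem lintegral_schur_weight_le {m : ℝ} (hm : 0 < m) :
    ∫⁻ ξ : ℝ, ENNReal.ofReal (1 / √(1 + |2 * Real.pi * ξ|)) *
      ENNReal.ofReal (√m / ((m + |2 * Real.pi * ξ|) * √(m + |2 * Real.pi * ξ|))) ≤
    1 * ENNReal.ofReal (1 / √m) := by
  have hpi := Real.pi_gt_three
  have h2pi : 0 < 2 * Real.pi := by positivity
  have hd : ∀ x : ℝ, 0 < x → HasDerivAt
      (fun x => (√m / (Real.pi * m)) * (√(2 * Real.pi * x) / √(m + 2 * Real.pi * x)))
      (1 / √(2 * Real.pi * x) * (√m / ((m + 2 * Real.pi * x) * √(m + 2 * Real.pi * x)))) x := by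
    intro x hx
    have hk : 0 < 2 * Real.pi * x := by positivity
    have hmk : 0 < m + 2 * Real.pi * x := by positivity
    have l1 : HasDerivAt (fun x => 2 * Real.pi * x) (2 * Real.pi) x := by
      simpa using (hasDerivAt_id x).const_mul (2 * Real.pi)
    have h1 := (l1.sqrt hk.ne').div ((l1.const_add m).sqrt hmk.ne') (Real.sqrt_ne_zero'.mpr hmk)
    refine (h1.const_mul (√m / (Real.pi * m))).congr_deriv ?_
    have a1 := Real.sqrt_ne_zero'.mpr hk
    have a2 := Real.sqrt_ne_zero'.mpr hmk
    have b1 := Real.sq_sqrt hk.le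
    have b2 := Real.sq_sqrt hmk.le
    have b3 : (0 : ℝ) < √m := Real.sqrt_pos.mpr hm
    set A := √(2 * Real.pi * x)
    set B := √(m + 2 * Real.pi * x)
    rw [← b2]
    field_simp
    rw [b1, b2]
    ring
  have key : ∀ ξ : ℝ, ENNReal.ofReal (1 / √(1 + |2 * Real.pi * ξ|)) *
      ENNReal.ofReal (√m / ((m + |2 * Real.pi * ξ|) * √(m + |2 * Real.pi * ξ|))) =
      (fun y => ENNReal.ofReal (1 / √(1 + 2 * Real.pi * y)) *
      ENNReal.ofReal (√m / ((m + 2 * Real.pi * y) * √(m + 2 * Real.pi * y)))) |ξ| := by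
    intro ξ
    simp only [abs_mul, abs_of_pos Real.pi_pos, abs_two]
  rw [lintegral_congr key, lintegral_comp_abs_eq (fun y =>
    ENNReal.ofReal (1 / √(1 + 2 * Real.pi * y)) *
      ENNReal.ofReal (√m / ((m + 2 * Real.pi * y) * √(m + 2 * Real.pi * y))))]
  have h3 : ∫⁻ x in Ioi (0 : ℝ), ENNReal.ofReal (1 / √(1 + 2 * Real.pi * x)) *
      ENNReal.ofReal (√m / ((m + 2 * Real.pi * x) * √(m + 2 * Real.pi * x))) ≤
      ENNReal.ofReal (√m / (Real.pi * m)) := by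
    calc _ ≤ ∫⁻ x in Ioi (0 : ℝ), ENNReal.ofReal (1 / √(2 * Real.pi * x) *
          (√m / ((m + 2 * Real.pi * x) * √(m + 2 * Real.pi * x)))) := by
          refine setLIntegral_mono' measurableSet_Ioi fun x hx => ?_
          have hx' : (0 : ℝ) < x := hx
          rw [← ENNReal.ofReal_mul (by positivity)]
          gcongr
          linarith
      _ = ENNReal.ofReal (√m / (Real.pi * m) - (√m / (Real.pi * m)) *
          (√(2 * Real.pi * 0) / √(m + 2 * Real.pi * 0))) := by
          refine lintegral_Ioi_deriv_eq (g := fun x => (√m / (Real.pi * m)) *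
            (√(2 * Real.pi * x) / √(m + 2 * Real.pi * x))) ?_ (fun x hx => hd x hx) ?_ ?_
          · refine ContinuousAt.continuousWithinAt ?_
            refine ContinuousAt.mul continuousAt_const (ContinuousAt.div ?_ ?_ ?_)
            · fun_prop
            · fun_prop
            · simpa using (Real.sqrt_pos.mpr hm).ne'
          · intro x hx
            have hx' : (0 : ℝ) < x := hx
            positivity
          · have h5 : Tendsto (fun x : ℝ => 2 * Real.pi * x / (m + 2 * Real.pi * x)) atTop
                (𝓝 1) := by
              have h6 : Tendsto (fun x : ℝ => 1 - m / (m + 2 * Real.pi * x)) atTop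
                  (𝓝 (1 - 0)) := by
                refine tendsto_const_nhds.sub (Tendsto.const_div_atTop ?_ _)
                exact tendsto_atTop_add_const_left _ _ (tendsto_id.const_mul_atTop h2pi)
              rw [sub_zero] at h6
              refine h6.congr' ?_
              filter_upwards [eventually_gt_atTop 0] with x hx
              have : 0 < m + 2 * Real.pi * x := by positivity
              field_simp
              ring
            have h7 := ((Real.continuous_sqrt.tendsto 1).comp h5).const_mul (√m / (Real.pi * m))
            rw [Real.sqrt_one, mul_one] at h7
            refine h7.congr' ?_
            filter_upwards [eventually_gt_atTop 0] with x hx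
            have : 0 ≤ 2 * Real.pi * x := by positivity
            simp only [Function.comp]
            rw [Real.sqrt_div this]
      _ = _ := by simp
  calc _ ≤ 2 * ENNReal.ofReal (√m / (Real.pi * m)) := by gcongr
    _ = ENNReal.ofReal (2 * (√m / (Real.pi * m))) := by
        rw [ENNReal.ofReal_mul (by norm_num)]; simp
    _ ≤ _ := by
        rw [one_mul]
        refine ENNReal.ofReal_le_ofReal ?_
        have b3 : (0 : ℝ) < √m := Real.sqrt_pos.mpr hm
        have b4 : √m / (Real.pi * m) = 1 / (Real.pi * √m) := by
          have := Real.mul_self_sqrt hm.le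
          field_simp
          linarith
        rw [b4, mul_one_div, div_le_div_iff₀ (by positivity) b3]
        nlinarith

/-! ### Superpositions of exponentials on the half-line -/

theorem sobolevWeight_half_le {s : ℝ} (hs : 0 ≤ s) (ξ : ℝ) :
    sobolevWeight (s / 2) ξ ≤ (1 + |2 * Real.pi * ξ|) ^ s := by
  unfold sobolevWeight
  rw [← sq_abs (2 * Real.pi * ξ), show s / 2 = (1 / 2) * s by ring,
    Real.rpow_mul (by positivity), ← Real.sqrt_eq_rpow]
  refine Real.rpow_le_rpow (Real.sqrt_nonneg _) ?_ hs
  rw [Real.sqrt_le_left (by positivity)]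
  nlinarith [abs_nonneg (2 * Real.pi * ξ)]

/-- After the weight `(1 + κ)^s ≤ (m + κ)^s` is absorbed and `m^s` is moved to `G`, the kernel is
`√m (m + κ)^{-3/2}`, homogeneous of degree `-1`. It is bounded on `L²` by the Schur test with
constants `2` and `1`, whence the factor `2^{1/2}`. The assumption `1 ≤ a` serves both to absorb the
weight and to bound `2/√(a + κ)` by `2/√(1 + κ)`. -/
theorem exists_sobolevNormOn_branch_le {s : ℝ} (hs : 0 ≤ s) {K : ℝ} (hK : 0 ≤ K) :
    ∃ C : ℝ, 0 < C ∧ ∀ (a : ℝ) (γ G : ℝ → ℂ), 1 ≤ a → Measurable γ →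
      (∀ m ∈ Ioi a, (γ m).im = m ∧ |(γ m).re| ≤ K * m) →
      AEStronglyMeasurable G (volume.restrict (Ioi a)) →
      (∀ x : ℝ, 0 < x → IntegrableOn (fun m => Real.exp (-(γ m).im * x) * ‖G m‖) (Ioi a)) →
      ContinuousOn (fun x : ℝ => ∫ m in Ioi a, Complex.exp (Complex.I * γ m * x) * G m) (Ioi 0) →
      sobolevNormOn s (Ioi 0) (fun x => ∫ m in Ioi a, Complex.exp (Complex.I * γ m * x) * G m) ≤
        ENNReal.ofReal C * (∫⁻ m in Ioi a, (ENNReal.ofReal (m ^ s) * ‖G m‖ₑ) ^ 2) ^ (1 / 2 : ℝ) := by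
  obtain ⟨ψ, hψ⟩ := exists_schwartzMap_eq_exp_neg
  obtain ⟨C, hC, hdecay⟩ := exists_norm_extExpHat_le ψ K hK (r := s + 3 / 2) (by linarith)
  refine ⟨C * 2 ^ (1 / 2 : ℝ), by positivity, fun a γ G ha hγ hγa hG hint hcont => ?_⟩
  set N := ∫⁻ m in Ioi a, (ENNReal.ofReal (m ^ s) * ‖G m‖ₑ) ^ 2 with hN
  rcases eq_or_ne N ⊤ with htop | htop
  · rw [htop, ENNReal.top_rpow_of_pos (by norm_num), ENNReal.mul_top]
    · exact le_top
    · simp only [ne_eq, ENNReal.ofReal_eq_zero, not_le]; positivity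
  have hpos : ∀ᵐ m ∂(volume.restrict (Ioi a)), 0 < (γ m).im := by
    refine (ae_restrict_iff' measurableSet_Ioi).mpr (ae_of_all _ fun m hm => ?_)
    rw [(hγa m hm).1]; exact (by linarith : (0 : ℝ) < a).trans hm
  refine sobolevNormOn_integral_exp_le hψ hs _ hγ hG hpos hint hcont
    (ENNReal.mul_ne_top ENNReal.ofReal_ne_top
      (ENNReal.rpow_ne_top_of_nonneg (by norm_num) htop)) ?_
  have hschur := lintegral_sq_le_of_schur (μ := (volume : Measure ℝ))
    (ν := volume.restrict (Ioi a))
    (K := fun ξ m => ENNReal.ofReal (√m / ((m + |2 * Real.pi * ξ|) * √(m + |2 * Real.pi * ξ|))))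
    (f := fun m => ENNReal.ofReal (m ^ s) * ‖G m‖ₑ)
    (p := fun ξ => ENNReal.ofReal (1 / √(1 + |2 * Real.pi * ξ|)))
    (q := fun m => ENNReal.ofReal (1 / √m)) (C₁ := 2) (C₂ := 1)
    (by unfold Function.uncurry; simp only; fun_prop)
    ((by fun_prop : Measurable fun m : ℝ => ENNReal.ofReal (m ^ s)).aemeasurable.mul hG.enorm)
    (by fun_prop) (by fun_prop)
    (by
      refine (ae_restrict_iff' measurableSet_Ioi).mpr (ae_of_all _ fun m hm => ?_)
      have hm0 : 0 < m := (by linarith : (0 : ℝ) < a).trans hm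
      refine ⟨?_, ENNReal.ofReal_ne_top⟩
      simp only [ne_eq, ENNReal.ofReal_eq_zero, not_le]; positivity)
    (by
      intro ξ
      calc _ = ∫⁻ m in Ioi a, ENNReal.ofReal (1 / ((m + |2 * Real.pi * ξ|) *
            √(m + |2 * Real.pi * ξ|))) := by
            refine setLIntegral_congr_fun measurableSet_Ioi fun m hm => ?_
            have hm0 : 0 < m := (by linarith : (0 : ℝ) < a).trans hm
            rw [← ENNReal.ofReal_mul (by positivity)]
            congr 1
            field_simp
        _ = _ := lintegral_Ioi_inv_mul_sqrt (by linarith) (abs_nonneg _)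
        _ ≤ _ := by
            rw [show (2 : ℝ≥0∞) = ENNReal.ofReal 2 by simp, ← ENNReal.ofReal_mul (by norm_num)]
            refine ENNReal.ofReal_le_ofReal ?_
            rw [mul_one_div]
            gcongr)
    (by
      refine (ae_restrict_iff' measurableSet_Ioi).mpr (ae_of_all _ fun m hm => ?_)
      exact lintegral_schur_weight_le ((by linarith : (0 : ℝ) < a).trans hm))
  have hpt : ∀ ξ, ENNReal.ofReal (sobolevWeight s ξ) *
      (∫⁻ m in Ioi a, ‖extExpHat ψ (γ m) ξ‖ₑ * ‖G m‖ₑ) ^ 2 ≤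
      ENNReal.ofReal C ^ 2 * (∫⁻ m in Ioi a,
        ENNReal.ofReal (√m / ((m + |2 * Real.pi * ξ|) * √(m + |2 * Real.pi * ξ|))) *
        (ENNReal.ofReal (m ^ s) * ‖G m‖ₑ)) ^ 2 := by
    intro ξ
    rw [sobolevWeight_eq_mul_self, ENNReal.ofReal_mul (sobolevWeight_pos _ _).le, ← pow_two,
      ← mul_pow, ← mul_pow]
    gcongr ?_ ^ 2
    rw [← lintegral_const_mul' _ _ ENNReal.ofReal_ne_top,
      ← lintegral_const_mul' _ _ ENNReal.ofReal_ne_top]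
    refine setLIntegral_mono' measurableSet_Ioi fun m hm => ?_
    have hm1 : 1 < m := lt_of_le_of_lt ha hm
    have hm0 : 0 < m := by linarith
    rw [← mul_assoc, ← mul_assoc, ← mul_assoc]
    gcongr ?_ * _
    rw [← ofReal_norm, ← ENNReal.ofReal_mul (sobolevWeight_pos _ _).le, ← ENNReal.ofReal_mul hC.le,
      ← ENNReal.ofReal_mul (by positivity)]
    refine ENNReal.ofReal_le_ofReal ?_
    have hz := hdecay (γ m) (by rw [(hγa m hm).1]; exact hm0)
      (by rw [(hγa m hm).1]; exact (hγa m hm).2) ξ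
    rw [(hγa m hm).1] at hz
    set κ := |2 * Real.pi * ξ| with hκ
    have hκ0 : 0 ≤ κ := abs_nonneg _
    have hmk : 0 < m + κ := by positivity
    calc sobolevWeight (s / 2) ξ * ‖extExpHat ψ (γ m) ξ‖
        ≤ (m + κ) ^ s * (C * (m ^ (s + 3 / 2 - 1) * (m + κ) ^ (-(s + 3 / 2)))) := by
          gcongr
          refine (sobolevWeight_half_le hs ξ).trans ?_
          gcongr
      _ = C * (m ^ (s + 1 / 2) * ((m + κ) ^ s * (m + κ) ^ (-(s + 3 / 2)))) := by ring_nf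
      _ = C * (m ^ s * √m * ((m + κ) * √(m + κ))⁻¹) := by
          rw [← Real.rpow_add hmk, Real.rpow_add hm0, ← Real.sqrt_eq_rpow,
            show s + -(s + 3 / 2) = -(1 + 1 / 2 : ℝ) by ring, Real.rpow_neg hmk.le,
            Real.rpow_add hmk, Real.rpow_one, ← Real.sqrt_eq_rpow]
      _ = _ := by ring
  calc _ ≤ (ENNReal.ofReal C ^ 2 * (2 * 1 * N)) ^ (1 / 2 : ℝ) := by
        gcongr
        refine (lintegral_mono hpt).trans ?_
        rw [lintegral_const_mul' _ _ (by finiteness)]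
        gcongr
    _ = _ := by
        rw [ENNReal.mul_rpow_of_nonneg _ _ (by norm_num), mul_one,
          ENNReal.mul_rpow_of_nonneg _ _ (by norm_num), ENNReal.ofReal_mul hC.le,
          ← ENNReal.rpow_ofNat, ← ENNReal.rpow_mul, mul_assoc,
          ← ENNReal.ofReal_rpow_of_nonneg (by norm_num) (by norm_num)]
        norm_num

/-- When `Im γ` stays in `[1, H]`, all continuations share the envelope `(1 + κ)^{-(s+3/2)}` in
frequency. The weight leaves `(1 + κ)^{-3/2}`, which is square integrable, so the triangle
inequality in `m` suffices and only the `L¹` norm of `G` enters. -/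
theorem exists_sobolevNormOn_bounded_le {s : ℝ} (hs : 0 ≤ s) {K H : ℝ} (hK : 0 ≤ K) (hH : 0 < H) :
    ∃ C : ℝ, 0 < C ∧ ∀ (ν : Measure ℝ) (γ G : ℝ → ℂ), SFinite ν → Measurable γ →
      (∀ᵐ m ∂ν, 1 ≤ (γ m).im ∧ (γ m).im ≤ H ∧ |(γ m).re| ≤ K * (γ m).im) →
      Integrable G ν →
      ContinuousOn (fun x : ℝ => ∫ m, Complex.exp (Complex.I * γ m * x) * G m ∂ν) (Ioi 0) →
      sobolevNormOn s (Ioi 0) (fun x => ∫ m, Complex.exp (Complex.I * γ m * x) * G m ∂ν) ≤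
        ENNReal.ofReal C * ∫⁻ m, ‖G m‖ₑ ∂ν := by
  obtain ⟨ψ, hψ⟩ := exists_schwartzMap_eq_exp_neg
  obtain ⟨C, hC, hdecay⟩ := exists_norm_extExpHat_le ψ K hK (r := s + 3 / 2) (by linarith)
  set M := ∫⁻ ξ : ℝ, ENNReal.ofReal ((1 + ‖ξ‖) ^ (-3 : ℝ)) with hM
  have hMtop : M ≠ ⊤ := by
    have := integrable_one_add_norm (E := ℝ) (μ := volume) (r := 3) (by simp)
    have h2 := this.lintegral_lt_top
    exact h2.ne
  set L := C * H ^ (s + 3 / 2 - 1) with hL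
  have hL0 : 0 < L := by positivity
  -- The summand `1` only makes the constant visibly positive.
  refine ⟨L * M.toReal ^ (1 / 2 : ℝ) + 1, by positivity,
    fun ν γ G hν hγ hγa hG hcont => ?_⟩
  have hpos : ∀ᵐ m ∂ν, 0 < (γ m).im := by filter_upwards [hγa] with m hm; linarith [hm.1]
  set J := ∫⁻ m, ‖G m‖ₑ ∂ν with hJ
  have hJtop : J ≠ ⊤ := hG.2.ne
  refine sobolevNormOn_integral_exp_le hψ hs ν hγ hG.1 hpos ?_ hcont
    (ENNReal.mul_ne_top ENNReal.ofReal_ne_top hJtop) ?_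
  · intro x hx
    refine hG.norm.bdd_mul (c := 1) ?_ ?_
    · have := (Complex.measurable_im.comp hγ)
      exact (Real.measurable_exp.comp (this.neg.mul_const x)).aestronglyMeasurable
    · filter_upwards [hpos] with m hm
      rw [Real.norm_of_nonneg (Real.exp_pos _).le, Real.exp_le_one_iff]
      nlinarith
  have hpt : ∀ ξ, ENNReal.ofReal (sobolevWeight s ξ) *
      (∫⁻ m, ‖extExpHat ψ (γ m) ξ‖ₑ * ‖G m‖ₑ ∂ν) ^ 2 ≤
      (ENNReal.ofReal L * J) ^ 2 * ENNReal.ofReal ((1 + ‖ξ‖) ^ (-3 : ℝ)) := by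
    intro ξ
    set κ := |2 * Real.pi * ξ| with hκ
    have hκ0 : 0 ≤ κ := abs_nonneg _
    have hκξ : ‖ξ‖ ≤ κ := by
      rw [hκ, abs_mul, Real.norm_eq_abs]
      refine le_mul_of_one_le_left (abs_nonneg _) ?_
      rw [abs_of_pos (by positivity)]
      linarith [Real.pi_gt_three]
    have h1 : ∫⁻ m, ‖extExpHat ψ (γ m) ξ‖ₑ * ‖G m‖ₑ ∂ν ≤
        ENNReal.ofReal (L * (1 + κ) ^ (-(s + 3 / 2))) * J := by
      rw [hJ, ← lintegral_const_mul' _ _ ENNReal.ofReal_ne_top]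
      refine lintegral_mono_ae ?_
      filter_upwards [hγa] with m hm
      gcongr
      rw [← ofReal_norm]
      refine ENNReal.ofReal_le_ofReal ((hdecay (γ m) (by linarith [hm.1]) hm.2.2 ξ).trans ?_)
      have hm1 := hm.1
      have hm0 : 0 < (γ m).im := by linarith
      have e1 : (γ m).im ^ (s + 3 / 2 - 1) ≤ H ^ (s + 3 / 2 - 1) :=
        Real.rpow_le_rpow hm0.le hm.2.1 (by linarith)
      have e2 : ((γ m).im + κ) ^ (-(s + 3 / 2)) ≤ (1 + κ) ^ (-(s + 3 / 2)) := by
        rw [Real.rpow_neg (by positivity), Real.rpow_neg (by positivity)]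
        gcongr
      calc _ ≤ C * (H ^ (s + 3 / 2 - 1) * (1 + κ) ^ (-(s + 3 / 2))) := by gcongr
        _ = _ := by rw [hL]; ring
    rw [sobolevWeight_eq_mul_self, ENNReal.ofReal_mul (sobolevWeight_pos _ _).le, ← pow_two,
      ← mul_pow]
    have h2 : (1 + ‖ξ‖) ^ (-3 : ℝ) = ((1 + ‖ξ‖) ^ (-(3 / 2) : ℝ)) ^ 2 := by
      rw [← Real.rpow_natCast, ← Real.rpow_mul (by positivity)]; norm_num
    rw [h2, ENNReal.ofReal_pow (by positivity), ← mul_pow]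
    gcongr ?_ ^ 2
    calc _ ≤ ENNReal.ofReal ((1 + κ) ^ s) *
          (ENNReal.ofReal (L * (1 + κ) ^ (-(s + 3 / 2))) * J) := by
          gcongr
          exact sobolevWeight_half_le hs ξ
      _ = ENNReal.ofReal (L * (1 + κ) ^ (-(3 / 2) : ℝ)) * J := by
          rw [← mul_assoc, ← ENNReal.ofReal_mul (by positivity)]
          congr 2
          rw [show (-(3 / 2) : ℝ) = s + -(s + 3 / 2) by ring, Real.rpow_add (by positivity)]
          ring
      _ ≤ ENNReal.ofReal (L * (1 + ‖ξ‖) ^ (-(3 / 2) : ℝ)) * J := by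
          gcongr ENNReal.ofReal (L * ?_) * J
          rw [Real.rpow_neg (by positivity), Real.rpow_neg (by positivity)]
          gcongr
      _ = _ := by rw [ENNReal.ofReal_mul hL0.le]; ring
  calc _ ≤ ((ENNReal.ofReal L * J) ^ 2 * M) ^ (1 / 2 : ℝ) := by
        gcongr
        refine (lintegral_mono hpt).trans ?_
        rw [lintegral_const_mul' _ _ (by finiteness)]
    _ = ENNReal.ofReal L * J * M ^ (1 / 2 : ℝ) := by
        rw [ENNReal.mul_rpow_of_nonneg _ _ (by norm_num), ← ENNReal.rpow_ofNat, ← ENNReal.rpow_mul]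
        norm_num
    _ = ENNReal.ofReal (L * M.toReal ^ (1 / 2 : ℝ)) * J := by
        rw [ENNReal.ofReal_mul hL0.le, ← ENNReal.ofReal_rpow_of_nonneg (by positivity) (by norm_num),
          ENNReal.ofReal_toReal hMtop]
        ring
    _ ≤ _ := by gcongr; linarith

end FokasHalfLine

namespace FokasHalfLine
open scoped FourierTransform ComplexConjugate

/-! ### Holomorphic functions on the upper half-plane -/

/-- Cauchy's theorem on the rectangle `[-R, R] × [0, R]`: the upper side contributes at most `2C/R`
and each lateral side at most `C/R`. -/
theorem integral_eq_zero_of_upperHalfPlane {H : ℂ → ℂ} (hc : ContinuousOn H {z | 0 ≤ z.im})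
    (hd : DifferentiableOn ℂ H {z | 0 < z.im}) {C : ℝ}
    (hC : ∀ z : ℂ, 0 ≤ z.im → 1 ≤ ‖z‖ → ‖H z‖ ≤ C / ‖z‖ ^ 2)
    (hi : Integrable fun x : ℝ => H x) : ∫ x : ℝ, H x = 0 := by
  have hC0 : 0 ≤ C := by
    have := (norm_nonneg _).trans (hC Complex.I (by simp) (by simp))
    simpa using this
  have h1 : Tendsto (fun R : ℝ => ∫ x in (-R)..R, H x) atTop (𝓝 (∫ x : ℝ, H x)) :=
    intervalIntegral_tendsto_integral hi tendsto_neg_atTop_atBot tendsto_id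
  have h2 : Tendsto (fun R : ℝ => ∫ x in (-R)..R, H x) atTop (𝓝 0) := by
    rw [tendsto_zero_iff_norm_tendsto_zero]
    refine squeeze_zero' (g := fun R : ℝ => (4 * C) / R) (Eventually.of_forall fun _ =>
      norm_nonneg _) ?_ (tendsto_const_nhds.div_atTop tendsto_id)
    filter_upwards [eventually_ge_atTop 1] with R hR
    have hR0 : 0 < R := by linarith
    have hrect := Complex.integral_boundary_rect_eq_zero_of_continuousOn_of_differentiableOn H
      (-R : ℂ) (R + R * Complex.I)
      (hc.mono (by
        intro z hz
        have := hz.2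
        simp [uIcc_of_le hR0.le] at this
        exact this.1))
      (hd.mono (by
        intro z hz
        have := hz.2
        simp [hR0.le] at this
        exact this.1))
    simp only [Complex.neg_re, Complex.ofReal_re, Complex.neg_im, Complex.ofReal_im, neg_zero,
      Complex.ofReal_zero, zero_mul, add_zero, Complex.add_re, Complex.mul_re, Complex.I_re,
      mul_zero, Complex.I_im, mul_one, sub_self, Complex.add_im, Complex.mul_im, zero_add,
      smul_eq_mul] at hrect
    have hre : ∀ z : ℂ, R ≤ |z.re| → ‖z‖ ≥ R := fun z hz => hz.trans (Complex.abs_re_le_norm z)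
    have him : ∀ z : ℂ, R ≤ |z.im| → ‖z‖ ≥ R := fun z hz => hz.trans (Complex.abs_im_le_norm z)
    have hb : ∀ z : ℂ, 0 ≤ z.im → R ≤ ‖z‖ → ‖H z‖ ≤ C / R ^ 2 := fun z h0 hz =>
      (hC z h0 (hR.trans hz)).trans (by gcongr)
    have b1 : ‖∫ x in (-R)..R, H (x + R * Complex.I)‖ ≤ C / R ^ 2 * |R - -R| :=
      intervalIntegral.norm_integral_le_of_norm_le_const fun x _ =>
        hb _ (by simp [hR0.le]) (him _ (by simp [abs_of_pos hR0]))
    have b2 : ‖∫ y in (0 : ℝ)..R, H (R + y * Complex.I)‖ ≤ C / R ^ 2 * |R - 0| :=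
      intervalIntegral.norm_integral_le_of_norm_le_const fun y hy => by
        rw [uIoc_of_le hR0.le] at hy
        exact hb _ (by simp [hy.1.le]) (hre _ (by simp [abs_of_pos hR0]))
    have b3 : ‖∫ y in (0 : ℝ)..R, H (-R + y * Complex.I)‖ ≤ C / R ^ 2 * |R - 0| :=
      intervalIntegral.norm_integral_le_of_norm_le_const fun y hy => by
        rw [uIoc_of_le hR0.le] at hy
        exact hb _ (by simp [hy.1.le]) (hre _ (by simp [abs_of_pos hR0]))
    have e : ∫ x in (-R)..R, H x = (∫ x in (-R)..R, H (x + R * Complex.I)) -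
        Complex.I * (∫ y in (0 : ℝ)..R, H (R + y * Complex.I)) +
        Complex.I * (∫ y in (0 : ℝ)..R, H (-R + y * Complex.I)) := by
      simp only [Complex.ofReal_neg] at hrect
      linear_combination hrect
    rw [e]
    refine (norm_add_le _ _).trans ((add_le_add (norm_sub_le _ _) le_rfl).trans ?_)
    rw [norm_mul, norm_mul, Complex.norm_I, one_mul, one_mul]
    rw [show R - -R = 2 * R by ring, abs_of_pos (by positivity)] at b1
    rw [sub_zero, abs_of_pos hR0] at b2 b3
    calc _ ≤ C / R ^ 2 * (2 * R) + C / R ^ 2 * R + C / R ^ 2 * R := by gcongr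
      _ = 4 * C / R := by field_simp; ring
  exact tendsto_nhds_unique h1 h2

/-- The Fourier–Laplace transform `∫ e^{2πizx} f(x) dx` of a function on the half-line `x > 0`. -/
noncomputable def halfLineTransform (f : ℝ → ℂ) (z : ℂ) : ℂ :=
  ∫ x : ℝ, Complex.exp (2 * Real.pi * Complex.I * z * x) * f x

theorem norm_exp_two_pi_I (z : ℂ) (x : ℝ) :
    ‖Complex.exp (2 * Real.pi * Complex.I * z * x)‖ = Real.exp (-(2 * Real.pi * z.im * x)) := by
  rw [Complex.norm_exp]
  congr 1
  simp

theorem norm_halfLineTransform_integrand_le {f : ℝ → ℂ} (hf0 : ∀ᵐ x, x < 0 → f x = 0) :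
    ∀ᵐ x : ℝ, ∀ z : ℂ, 0 ≤ z.im →
      ‖Complex.exp (2 * Real.pi * Complex.I * z * x) * f x‖ ≤ ‖f x‖ := by
  filter_upwards [hf0] with x hx z hz
  rcases lt_or_ge x 0 with h | h
  · simp [hx h]
  · rw [norm_mul, norm_exp_two_pi_I]
    refine mul_le_of_le_one_left (norm_nonneg _) ?_
    rw [Real.exp_le_one_iff]
    have := Real.pi_pos
    have : 0 ≤ 2 * Real.pi * z.im * x := by positivity
    linarith

theorem aestronglyMeasurable_halfLineTransform_integrand {f : ℝ → ℂ}
    (hf : AEStronglyMeasurable f volume) (z : ℂ) :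
    AEStronglyMeasurable (fun x : ℝ => Complex.exp (2 * Real.pi * Complex.I * z * x) * f x)
      volume :=
  (by fun_prop : Continuous fun x : ℝ =>
    Complex.exp (2 * Real.pi * Complex.I * z * x)).aestronglyMeasurable.mul hf

theorem norm_halfLineTransform_le {f : ℝ → ℂ} (hf : Integrable f)
    (hf0 : ∀ᵐ x, x < 0 → f x = 0) {z : ℂ} (hz : 0 ≤ z.im) :
    ‖halfLineTransform f z‖ ≤ ∫ x, ‖f x‖ :=
  norm_integral_le_of_norm_le hf.norm (by
    filter_upwards [norm_halfLineTransform_integrand_le hf0] with x hx using hx z hz)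

theorem continuousOn_halfLineTransform {f : ℝ → ℂ} (hf : Integrable f)
    (hf0 : ∀ᵐ x, x < 0 → f x = 0) : ContinuousOn (halfLineTransform f) {z | 0 ≤ z.im} := by
  refine continuousOn_of_dominated (bound := fun x => ‖f x‖)
    (fun z _ => aestronglyMeasurable_halfLineTransform_integrand hf.1 z) ?_ hf.norm ?_
  · intro z hz
    filter_upwards [norm_halfLineTransform_integrand_le hf0] with x hx using hx z hz
  · exact ae_of_all _ fun x => by fun_prop

theorem differentiableOn_halfLineTransform {f : ℝ → ℂ} (hf : Integrable f)
    (hf0 : ∀ᵐ x, x < 0 → f x = 0) : DifferentiableOn ℂ (halfLineTransform f) {z | 0 < z.im} := by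
  intro z₀ hz₀
  have hz₀' : 0 < z₀.im := hz₀
  set y := z₀.im / 2 with hy
  have hy0 : 0 < y := by positivity
  have hpi := Real.pi_pos
  have hball : ∀ z ∈ Metric.ball z₀ y, y < z.im := by
    intro z hz
    have h1 := Complex.abs_im_le_norm (z - z₀)
    rw [Metric.mem_ball, dist_eq_norm] at hz
    rw [Complex.sub_im] at h1
    have := (abs_lt.mp (h1.trans_lt hz)).1
    linarith
  refine DifferentiableAt.differentiableWithinAt (HasDerivAt.differentiableAt
    (hasDerivAt_integral_of_dominated_loc_of_deriv_le
      (F := fun z x => Complex.exp (2 * Real.pi * Complex.I * z * x) * f x)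
      (F' := fun z x => (Complex.exp (2 * Real.pi * Complex.I * z * x) *
        (2 * Real.pi * Complex.I * x)) * f x)
      (bound := fun x => (1 / y) * ‖f x‖) (s := Metric.ball z₀ y)
      (Metric.ball_mem_nhds z₀ hy0) ?_ ?_ ?_ ?_ ?_ ?_).2)
  · exact Eventually.of_forall fun z => aestronglyMeasurable_halfLineTransform_integrand hf.1 z
  · refine hf.norm.mono' (aestronglyMeasurable_halfLineTransform_integrand hf.1 z₀) ?_
    filter_upwards [norm_halfLineTransform_integrand_le hf0] with x hx using hx z₀ hz₀'.le
  · exact (by fun_prop : Continuous fun x : ℝ => Complex.exp (2 * Real.pi * Complex.I * z₀ * x) *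
        (2 * Real.pi * Complex.I * x)).aestronglyMeasurable.mul hf.1
  · filter_upwards [hf0] with x hx z hz
    rcases lt_or_ge x 0 with h | h
    · simp [hx h]
    · rw [norm_mul]
      gcongr
      rw [norm_mul, norm_exp_two_pi_I]
      have e1 : ‖(2 * Real.pi * Complex.I * x : ℂ)‖ = 2 * Real.pi * x := by
        simp [abs_of_pos hpi, abs_of_nonneg h]
      rw [e1, Real.exp_neg, inv_mul_eq_div, div_le_div_iff₀ (Real.exp_pos _) hy0, one_mul]
      have h3 := Real.add_one_le_exp (2 * Real.pi * z.im * x)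
      have h4 : 2 * Real.pi * x * y ≤ 2 * Real.pi * x * z.im := by
        gcongr
        exact (hball z hz).le
      linarith
  · exact hf.norm.const_mul _
  · refine ae_of_all _ fun x z _ => ?_
    refine HasDerivAt.mul_const ?_ _
    have : HasDerivAt (fun z : ℂ => 2 * Real.pi * Complex.I * z * x)
        (2 * Real.pi * Complex.I * x) z := by
      have := ((hasDerivAt_id z).const_mul (2 * Real.pi * Complex.I)).mul_const (x : ℂ)
      simpa using this
    exact this.cexp

/-! ### The multiplier `(1 + k²)^n (1 - ik)^{2θ}` -/

/-- The symbol `(1 + k²)^n (1 - ik)^{2θ}`, `k = 2πz`. -/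
noncomputable def angleSymbol (n : ℕ) (θ : ℝ) (z : ℂ) : ℂ :=
  (1 + (2 * Real.pi * z) ^ 2) ^ n * (1 - 2 * Real.pi * Complex.I * z) ^ ((2 * θ : ℝ) : ℂ)

theorem re_one_sub_two_pi_I (ε : ℝ) (z : ℂ) :
    (1 - 2 * Real.pi * Complex.I * (ε * z)).re = 1 + 2 * Real.pi * ε * z.im := by
  simp; ring

theorem one_le_norm_one_sub {ε : ℝ} (hε : 0 ≤ ε) {z : ℂ} (hz : 0 ≤ z.im) :
    1 ≤ ‖1 - 2 * Real.pi * Complex.I * (ε * z)‖ := by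
  refine le_trans ?_ ((le_abs_self _).trans (Complex.abs_re_le_norm _))
  rw [re_one_sub_two_pi_I]
  have := Real.pi_pos
  have : 0 ≤ 2 * Real.pi * ε * z.im := by positivity
  linarith

theorem le_norm_one_sub {ε : ℝ} (hε : 0 ≤ ε) {z : ℂ} (hz : 0 ≤ z.im) :
    ε * ‖z‖ ≤ ‖1 - 2 * Real.pi * Complex.I * (ε * z)‖ := by
  have hpi := Real.pi_gt_three
  refine le_of_sq_le_sq ?_ (norm_nonneg _)
  rw [mul_pow, Complex.sq_norm, Complex.sq_norm, Complex.normSq_apply, Complex.normSq_apply,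
    re_one_sub_two_pi_I]
  have e : (1 - 2 * Real.pi * Complex.I * (ε * z)).im = -(2 * Real.pi * ε * z.re) := by
    simp; ring
  rw [e]
  have h1 : 0 ≤ ε * z.im := by positivity
  have h2 : (ε * z.im) ^ 2 ≤ (1 + 2 * Real.pi * ε * z.im) ^ 2 := by
    gcongr
    nlinarith
  have h3 : (ε * z.re) ^ 2 ≤ (2 * Real.pi * ε * z.re) ^ 2 := by
    rw [show 2 * Real.pi * ε * z.re = (2 * Real.pi) * (ε * z.re) by ring, mul_pow (2 * Real.pi)]
    refine le_mul_of_one_le_left (sq_nonneg _) ?_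
    nlinarith
  nlinarith

theorem norm_angleSymbol_ofReal (n : ℕ) (θ ξ : ℝ) :
    ‖angleSymbol n θ ξ‖ = sobolevWeight (n + θ) ξ := by
  have h1 : ‖(1 - 2 * Real.pi * Complex.I * ξ : ℂ)‖ = (1 + (2 * Real.pi * ξ) ^ 2) ^ (1 / 2 : ℝ) := by
    rw [← Real.sqrt_eq_rpow, Complex.norm_def, Complex.normSq_apply]
    congr 1
    simp
    ring
  have h0 : (1 - 2 * Real.pi * Complex.I * ξ : ℂ) ≠ 0 := by
    rw [← norm_pos_iff, h1]; positivity
  have h2 : ‖(1 + (2 * Real.pi * ξ) ^ 2 : ℂ)‖ = 1 + (2 * Real.pi * ξ) ^ 2 := by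
    have : (1 + (2 * Real.pi * ξ) ^ 2 : ℂ) = ((1 + (2 * Real.pi * ξ) ^ 2 : ℝ) : ℂ) := by
      push_cast; rfl
    rw [this, Complex.norm_real, Real.norm_of_nonneg (by positivity)]
  unfold angleSymbol sobolevWeight
  rw [norm_mul, norm_pow, h2, Complex.norm_cpow_of_ne_zero h0, h1]
  simp only [Complex.ofReal_re, Complex.ofReal_im, mul_zero, Real.exp_zero, div_one]
  rw [← Real.rpow_mul (by positivity), Real.rpow_add (by positivity), Real.rpow_natCast]
  congr 2
  ring

/-- The factor `(1 + k²)^n` is positive on the line, and `1 - ik` has argument in `(-π/2, π/2)`. Its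
power `2θ` therefore has argument at most `π|θ| < π/2` in absolute value. Only the fractional part
`θ` turns the symbol, so the integer part of the order is unrestricted. -/
theorem re_angleSymbol_ge {n : ℕ} {θ : ℝ} (hθ : |θ| < 1 / 2) (ξ : ℝ) :
    Real.cos (Real.pi * θ) * sobolevWeight (n + θ) ξ ≤ (angleSymbol n θ ξ).re := by
  have hpi := Real.pi_pos
  set a : ℂ := 1 - 2 * Real.pi * Complex.I * ξ with ha
  have hre : 0 < a.re := by rw [ha]; simp
  have h0 : a ≠ 0 := fun h => by rw [h] at hre; simp at hre
  have harg : |a.arg| < Real.pi / 2 := Complex.abs_arg_lt_pi_div_two_iff.mpr (Or.inl hre)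
  have h2 : (1 + (2 * Real.pi * ξ) ^ 2 : ℂ) = ((1 + (2 * Real.pi * ξ) ^ 2 : ℝ) : ℂ) := by
    push_cast; rfl
  have h3 : a ^ ((2 * θ : ℝ) : ℂ) =
      ((‖a‖ ^ (2 * θ) : ℝ) : ℂ) * Complex.exp ((a.arg * (2 * θ) : ℝ) * Complex.I) := by
    rw [Complex.cpow_def_of_ne_zero h0, Complex.log,
      Real.rpow_def_of_pos (norm_pos_iff.mpr h0), Complex.ofReal_exp, ← Complex.exp_add]
    congr 1
    push_cast
    ring
  have h4 : angleSymbol n θ ξ = (((1 + (2 * Real.pi * ξ) ^ 2) ^ n * ‖a‖ ^ (2 * θ) : ℝ) : ℂ) *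
      Complex.exp ((a.arg * (2 * θ) : ℝ) * Complex.I) := by
    unfold angleSymbol
    rw [← ha, h3, h2]
    push_cast
    ring
  have h5 : (1 + (2 * Real.pi * ξ) ^ 2) ^ n * ‖a‖ ^ (2 * θ) = sobolevWeight (n + θ) ξ := by
    rw [← norm_angleSymbol_ofReal, h4, norm_mul, Complex.norm_exp_ofReal_mul_I, mul_one,
      Complex.norm_real, Real.norm_of_nonneg (by positivity)]
  rw [h4, h5, Complex.re_ofReal_mul, Complex.exp_ofReal_mul_I_re, mul_comm]
  refine mul_le_mul_of_nonneg_left ?_ (sobolevWeight_pos _ _).le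
  rw [← Real.cos_abs (Real.pi * θ), ← Real.cos_abs (a.arg * (2 * θ))]
  refine Real.cos_le_cos_of_nonneg_of_le_pi (abs_nonneg _) ?_ ?_
  · rw [abs_mul, abs_of_pos hpi]; nlinarith
  · rw [abs_mul, abs_mul, abs_mul, abs_two, abs_of_pos hpi]
    nlinarith [abs_nonneg θ]

theorem norm_angleSymbol_le {n : ℕ} {θ : ℝ} (hθ : |θ| < 1 / 2) {z : ℂ} (hz : 0 ≤ z.im)
    (hz1 : 1 ≤ ‖z‖) : ‖angleSymbol n θ z‖ ≤ (8 * ‖z‖) ^ (2 * n + 1) := by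
  have hpi := Real.pi_lt_d2
  have hpi' := Real.pi_pos
  have h1 : ‖(1 + (2 * Real.pi * z) ^ 2 : ℂ)‖ ≤ (8 * ‖z‖) ^ 2 := by
    refine (norm_add_le _ _).trans ?_
    rw [norm_one, norm_pow, norm_mul, norm_mul, Complex.norm_ofNat, Complex.norm_real,
      Real.norm_of_nonneg hpi'.le]
    have : 2 * Real.pi * ‖z‖ ≤ 7 * ‖z‖ := by gcongr; linarith
    have : (2 * Real.pi * ‖z‖) ^ 2 ≤ (7 * ‖z‖) ^ 2 := by gcongr
    nlinarith
  have h2 : ‖(1 - 2 * Real.pi * Complex.I * z : ℂ)‖ ≤ 8 * ‖z‖ := by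
    refine (norm_sub_le _ _).trans ?_
    rw [norm_one, norm_mul, norm_mul, norm_mul, Complex.norm_ofNat, Complex.norm_real,
      Real.norm_of_nonneg hpi'.le, Complex.norm_I, mul_one]
    nlinarith
  have h3 : 1 ≤ ‖(1 - 2 * Real.pi * Complex.I * z : ℂ)‖ := by
    have := one_le_norm_one_sub zero_le_one hz
    simpa using this
  have h0 : (1 - 2 * Real.pi * Complex.I * z : ℂ) ≠ 0 := by
    rw [← norm_pos_iff]; linarith
  unfold angleSymbol
  rw [norm_mul, norm_pow, Complex.norm_cpow_of_ne_zero h0, pow_succ (8 * ‖z‖), pow_mul (8 * ‖z‖)]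
  simp only [Complex.ofReal_re, Complex.ofReal_im, mul_zero, Real.exp_zero, div_one]
  gcongr
  refine (Real.rpow_le_rpow_of_exponent_le h3 (y := 2 * θ) (z := 1) ?_).trans ?_
  · linarith [le_abs_self θ]
  · rwa [Real.rpow_one]

theorem differentiableAt_angleSymbol {n : ℕ} {θ : ℝ} {z : ℂ} (hz : 0 ≤ z.im) :
    DifferentiableAt ℂ (angleSymbol n θ) z := by
  unfold angleSymbol
  refine DifferentiableAt.mul (by fun_prop) ?_
  refine DifferentiableAt.cpow (by fun_prop) (by fun_prop) (Or.inl ?_)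
  have := re_one_sub_two_pi_I 1 z
  simp only [Complex.ofReal_one, one_mul] at this
  rw [this]
  have := Real.pi_pos
  positivity

/-- Both transforms are bounded and holomorphic in the upper half-plane, and so is the symbol up to
polynomial growth, hence Cauchy's theorem applies after a regularization that is removed by
dominated convergence. -/
theorem integral_mul_angleSymbol_eq_zero {n : ℕ} {θ : ℝ} (hθ : |θ| < 1 / 2) {f g : ℝ → ℂ}
    (hf : Integrable f) (hf0 : ∀ᵐ x, x < 0 → f x = 0)
    (hg : Integrable g) (hg0 : ∀ᵐ x, x < 0 → g x = 0)
    (hi : Integrable fun ξ : ℝ =>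
      halfLineTransform f ξ * halfLineTransform g ξ * angleSymbol n θ ξ) :
    ∫ ξ : ℝ, halfLineTransform f ξ * halfLineTransform g ξ * angleSymbol n θ ξ = 0 := by
  have hpi := Real.pi_pos
  set P : ℂ → ℂ := fun z => halfLineTransform f z * halfLineTransform g z with hP
  -- The symbol grows at most like `|z|^{2n+1}`, so the power `2n + 3` leaves the decay `|z|^{-2}`
  -- for each `ε > 0`. The denominator has modulus at least `1`, uniformly in `ε`, which provides
  -- the dominating function.
  set Q : ℝ → ℂ → ℂ := fun ε z => P z * angleSymbol n θ z /
    (1 - 2 * Real.pi * Complex.I * (ε * z)) ^ (2 * n + 3) with hQ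
  have hden : ∀ ε : ℝ, 0 ≤ ε → ∀ z : ℂ, 0 ≤ z.im →
      (1 - 2 * Real.pi * Complex.I * (ε * z)) ^ (2 * n + 3) ≠ 0 := by
    intro ε hε z hz
    refine pow_ne_zero _ ?_
    rw [← norm_pos_iff]
    linarith [one_le_norm_one_sub hε hz]
  have hQle : ∀ ε : ℝ, 0 ≤ ε → ∀ ξ : ℝ, ‖Q ε ξ‖ ≤ ‖P ξ * angleSymbol n θ ξ‖ := by
    intro ε hε ξ
    rw [hQ]
    simp only
    rw [norm_div, norm_pow]
    refine div_le_self (norm_nonneg _) (one_le_pow₀ (one_le_norm_one_sub hε (by simp)))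
  have hQc : ∀ ε : ℝ, 0 ≤ ε → ContinuousOn (Q ε) {z | 0 ≤ z.im} := by
    intro ε hε
    refine ContinuousOn.div ?_ (by fun_prop) (fun z hz => hden ε hε z hz)
    refine ((continuousOn_halfLineTransform hf hf0).mul
      (continuousOn_halfLineTransform hg hg0)).mul ?_
    exact fun z hz => (differentiableAt_angleSymbol hz).continuousAt.continuousWithinAt
  have hreal : ∀ ε : ℝ, 0 ≤ ε → Continuous fun ξ : ℝ => Q ε ξ := by
    intro ε hε
    exact (hQc ε hε).comp_continuous Complex.continuous_ofReal (fun x => by simp)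
  have hzero : ∀ ε : ℝ, 0 < ε → ∫ ξ : ℝ, Q ε ξ = 0 := by
    intro ε hε
    refine integral_eq_zero_of_upperHalfPlane
      (C := (∫ x, ‖f x‖) * (∫ x, ‖g x‖) * 8 ^ (2 * n + 1) / ε ^ (2 * n + 3)) (hQc ε hε.le) ?_ ?_ ?_
    · refine DifferentiableOn.div ?_ (by fun_prop) (fun z hz => hden ε hε.le z (le_of_lt hz))
      refine ((differentiableOn_halfLineTransform hf hf0).mul
        (differentiableOn_halfLineTransform hg hg0)).mul ?_
      exact fun z hz => (differentiableAt_angleSymbol (le_of_lt hz)).differentiableWithinAt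
    · intro z hz hz1
      have hz0 : 0 < ‖z‖ := by linarith
      rw [hQ]
      simp only [hP]
      rw [norm_div, norm_mul, norm_mul, norm_pow]
      calc _ ≤ (∫ x, ‖f x‖) * (∫ x, ‖g x‖) * (8 * ‖z‖) ^ (2 * n + 1) /
            (ε * ‖z‖) ^ (2 * n + 3) := by
            gcongr
            · exact norm_halfLineTransform_le hf hf0 hz
            · exact norm_halfLineTransform_le hg hg0 hz
            · exact norm_angleSymbol_le hθ hz hz1
            · exact le_norm_one_sub hε.le hz
        _ = _ := by
            rw [mul_pow, mul_pow, show 2 * n + 3 = (2 * n + 1) + 2 by ring, pow_add ‖z‖ (2 * n + 1) 2]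
            field_simp
    · exact hi.mono (hreal ε hε.le).aestronglyMeasurable (ae_of_all _ (hQle ε hε.le))
  have hlim : Tendsto (fun j : ℕ => ∫ ξ : ℝ, Q (1 / (j + 1)) ξ) atTop
      (𝓝 (∫ ξ : ℝ, P ξ * angleSymbol n θ ξ)) := by
    refine tendsto_integral_of_dominated_convergence (fun ξ : ℝ => ‖P ξ * angleSymbol n θ ξ‖)
      (fun j => (hreal _ (by positivity)).aestronglyMeasurable) hi.norm
      (fun j => ae_of_all _ (hQle _ (by positivity))) (ae_of_all _ fun ξ => ?_)
    have h1 : ContinuousAt (fun ε : ℝ => Q ε ξ) 0 := by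
      refine ContinuousAt.div (by fun_prop) (by fun_prop) (hden 0 le_rfl _ (by simp))
    have h2 := h1.tendsto.comp (tendsto_one_div_add_atTop_nhds_zero_nat (𝕜 := ℝ))
    simpa [hQ, Function.comp_def] using h2
  have : (fun j : ℕ => ∫ ξ : ℝ, Q (1 / (j + 1)) ξ) = fun _ => (0 : ℂ) := by
    funext j
    exact hzero _ (by positivity)
  rw [this] at hlim
  exact (tendsto_nhds_unique hlim tendsto_const_nhds)

/-! ### Splitting at a point -/

theorem fourier_comp_add (f : ℝ → ℂ) (a ξ : ℝ) :
    𝓕 (fun x => f (x + a)) ξ =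
      Complex.exp ((2 * Real.pi * (ξ * a) : ℝ) * Complex.I) * 𝓕 f ξ := by
  rw [Real.fourier_real_eq_integral_exp_smul, Real.fourier_real_eq_integral_exp_smul,
    ← integral_const_mul]
  refine Eq.trans ?_ (integral_add_right_eq_self _ a)
  refine integral_congr_ae (ae_of_all _ fun x => ?_)
  simp only [smul_eq_mul]
  rw [← mul_assoc, ← Complex.exp_add]
  congr 2
  push_cast
  ring

theorem conj_fourier_eq_halfLineTransform (f : ℝ → ℂ) (ξ : ℝ) :
    conj (𝓕 f ξ) = halfLineTransform (fun x => conj (f x)) ξ := by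
  rw [Real.fourier_real_eq_integral_exp_smul, ← integral_conj]
  refine integral_congr_ae (ae_of_all _ fun x => ?_)
  simp only [smul_eq_mul, map_mul, ← Complex.exp_conj, Complex.conj_ofReal, Complex.conj_I]
  congr 2
  push_cast
  ring

theorem fourier_eq_halfLineTransform (f : ℝ → ℂ) (ξ : ℝ) :
    𝓕 f ξ = halfLineTransform (fun x => f (-x)) ξ := by
  rw [Real.fourier_real_eq_integral_exp_smul, halfLineTransform, ← integral_neg_eq_self]
  refine integral_congr_ae (ae_of_all _ fun x => ?_)
  simp only [smul_eq_mul]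
  congr 2
  push_cast
  ring

/-- For `u` supported to the right of `a`, the conjugate of its transform continues to the upper
half-plane; for `v` supported to the left of `a`, its transform itself does. Translating `a` to `0`
produces opposite phases, which cancel in the product. -/
theorem integral_conj_fourier_mul_eq_zero {n : ℕ} {θ : ℝ} (hθ : |θ| < 1 / 2) {u v : ℝ → ℂ} {a : ℝ}
    (hu : Integrable u) (hu0 : ∀ᵐ x, x < a → u x = 0)
    (hv : Integrable v) (hv0 : ∀ᵐ x, a < x → v x = 0)
    (hi : Integrable fun ξ : ℝ => conj (𝓕 u ξ) * 𝓕 v ξ * angleSymbol n θ ξ) :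
    ∫ ξ : ℝ, conj (𝓕 u ξ) * 𝓕 v ξ * angleSymbol n θ ξ = 0 := by
  set f : ℝ → ℂ := fun x => conj (u (x + a)) with hf
  set g : ℝ → ℂ := fun x => v (-x + a) with hg
  have e : ∀ ξ : ℝ, conj (𝓕 u ξ) * 𝓕 v ξ * angleSymbol n θ ξ =
      halfLineTransform f ξ * halfLineTransform g ξ * angleSymbol n θ ξ := by
    intro ξ
    have h1 := conj_fourier_eq_halfLineTransform (fun x => u (x + a)) ξ
    have h2 := fourier_eq_halfLineTransform (fun x => v (x + a)) ξ
    rw [← h1, ← h2, fourier_comp_add, fourier_comp_add, map_mul, ← Complex.exp_conj]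
    have h3 : Complex.exp (conj (((2 * Real.pi * (ξ * a) : ℝ) : ℂ) * Complex.I)) *
        Complex.exp (((2 * Real.pi * (ξ * a) : ℝ) : ℂ) * Complex.I) = 1 := by
      rw [← Complex.exp_add, map_mul, Complex.conj_ofReal, Complex.conj_I]
      simp
    linear_combination (-(conj (𝓕 u ξ) * 𝓕 v ξ * angleSymbol n θ ξ)) * h3
  simp only [e] at hi ⊢
  have hu' := hu.comp_add_right a
  have hv' := (hv.comp_add_right a).comp_neg
  refine integral_mul_angleSymbol_eq_zero hθ (f := f) (g := g) ?_ ?_ ?_ ?_ hi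
  · exact Complex.conjCLE.toContinuousLinearMap.integrable_comp hu'
  · have := (measurePreserving_add_right volume a).quasiMeasurePreserving.ae hu0
    filter_upwards [this] with x hx h0
    rw [hf]
    simp only
    rw [hx (by linarith), map_zero]
  · exact hv'
  · have h1 := (measurePreserving_add_right volume a).quasiMeasurePreserving.ae hv0
    have h2 := (Measure.measurePreserving_neg (volume : Measure ℝ)).quasiMeasurePreserving.ae h1
    filter_upwards [h2] with x hx h0
    exact hx (by linarith)

/-! ### The angle between functions supported on complementary half-lines -/

theorem integrable_of_sobolevNorm_lt_top {s : ℝ} {F : Lp ℂ 2 (volume : Measure ℝ)}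
    (hF : sobolevNorm s F < ⊤) :
    Integrable fun ξ => sobolevWeight s ξ * ‖(𝓕 F : Lp ℂ 2 (volume : Measure ℝ)) ξ‖ ^ 2 := by
  have hm : AEStronglyMeasurable (fun ξ => sobolevWeight s ξ *
      ‖(𝓕 F : Lp ℂ 2 (volume : Measure ℝ)) ξ‖ ^ 2) volume :=
    (continuous_sobolevWeight s).aestronglyMeasurable.mul
      ((Lp.aestronglyMeasurable _).norm.pow 2)
  refine ⟨hm, ?_⟩
  rw [hasFiniteIntegral_iff_enorm]
  rw [sobolevNorm_eq_of_ae (ae_eq_refl _)] at hF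
  have h1 : ∫⁻ ξ, ENNReal.ofReal (sobolevWeight s ξ) *
      ‖(𝓕 F : Lp ℂ 2 (volume : Measure ℝ)) ξ‖ₑ ^ 2 < ⊤ := by
    by_contra hcon
    rw [not_lt_top_iff] at hcon
    rw [hcon, ENNReal.top_rpow_of_pos (by norm_num)] at hF
    exact lt_irrefl _ hF
  convert h1 using 2
  funext ξ
  rw [enorm_mul, enorm_pow, enorm_norm, Real.enorm_of_nonneg (sobolevWeight_pos _ _).le]

theorem sobolevNorm_eq_ofReal_integral {s : ℝ} {F : Lp ℂ 2 (volume : Measure ℝ)}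
    (hF : sobolevNorm s F < ⊤) :
    sobolevNorm s F = ENNReal.ofReal
      (∫ ξ, sobolevWeight s ξ * ‖(𝓕 F : Lp ℂ 2 (volume : Measure ℝ)) ξ‖ ^ 2) ^ (1 / 2 : ℝ) := by
  rw [ofReal_integral_eq_lintegral_ofReal (integrable_of_sobolevNorm_lt_top hF)
    (ae_of_all _ fun ξ => mul_nonneg (sobolevWeight_pos _ _).le (by positivity)),
    sobolevNorm_eq_of_ae (ae_eq_refl _)]
  congr 1
  refine lintegral_congr fun ξ => ?_
  rw [ENNReal.ofReal_mul (sobolevWeight_pos _ _).le, ENNReal.ofReal_pow (norm_nonneg _), ofReal_norm]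

/-- If `s - 1/2` is not an integer, the subspaces of `H^s(ℝ)` of functions supported on two
complementary half-lines form a positive angle. -/
theorem sobolevNorm_le_of_disjoint_half_lines {n : ℕ} {θ : ℝ} (hθ : |θ| < 1 / 2) {u v : ℝ → ℂ}
    {a : ℝ} (hu : Integrable u) (hu2 : MemLp u 2 volume) (hu0 : ∀ᵐ x, x < a → u x = 0)
    (hv : Integrable v) (hv2 : MemLp v 2 volume) (hv0 : ∀ᵐ x, a < x → v x = 0)
    (hus : sobolevNorm (n + θ) (hu2.toLp u) < ⊤) (hvs : sobolevNorm (n + θ) (hv2.toLp v) < ⊤) :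
    sobolevNorm (n + θ) (hv2.toLp v) ≤ ENNReal.ofReal (1 / Real.cos (Real.pi * θ)) *
      sobolevNorm (n + θ) (hu2.toLp u + hv2.toLp v) := by
  set c := Real.cos (Real.pi * θ) with hc
  have hc0 : 0 < c := by
    refine Real.cos_pos_of_mem_Ioo ⟨?_, ?_⟩ <;>
      nlinarith [Real.pi_pos, (abs_lt.mp hθ).1, (abs_lt.mp hθ).2]
  set s : ℝ := n + θ with hs
  set U : Lp ℂ 2 (volume : Measure ℝ) := hu2.toLp u
  set V : Lp ℂ 2 (volume : Measure ℝ) := hv2.toLp v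
  have hUV : sobolevNorm s (U + V) < ⊤ :=
    (sobolevNorm_add_le s U V).trans_lt (ENNReal.add_lt_top.mpr ⟨hus, hvs⟩)
  have eU : ((𝓕 U : Lp ℂ 2 (volume : Measure ℝ)) : ℝ → ℂ) =ᵐ[volume] 𝓕 u := fourier_toLp_ae_eq hu hu2
  have eV : ((𝓕 V : Lp ℂ 2 (volume : Measure ℝ)) : ℝ → ℂ) =ᵐ[volume] 𝓕 v := fourier_toLp_ae_eq hv hv2
  have eUV : ((𝓕 (U + V) : Lp ℂ 2 (volume : Measure ℝ)) : ℝ → ℂ) =ᵐ[volume]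
      fun ξ => 𝓕 u ξ + 𝓕 v ξ := by
    rw [FourierTransform.fourier_add]
    filter_upwards [Lp.coeFn_add (𝓕 U : Lp ℂ 2 (volume : Measure ℝ)) (𝓕 V), eU, eV] with ξ h1 h2 h3
    rw [h1, Pi.add_apply, h2, h3]
  have iV : Integrable fun ξ => sobolevWeight s ξ * ‖𝓕 v ξ‖ ^ 2 :=
    (integrable_of_sobolevNorm_lt_top hvs).congr (by filter_upwards [eV] with ξ h; rw [h])
  have iU : Integrable fun ξ => sobolevWeight s ξ * ‖𝓕 u ξ‖ ^ 2 :=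
    (integrable_of_sobolevNorm_lt_top hus).congr (by filter_upwards [eU] with ξ h; rw [h])
  have iUV : Integrable fun ξ => sobolevWeight s ξ * ‖𝓕 u ξ + 𝓕 v ξ‖ ^ 2 :=
    (integrable_of_sobolevNorm_lt_top hUV).congr (by filter_upwards [eUV] with ξ h; rw [h])
  have hcontu : Continuous (𝓕 u) := VectorFourier.fourierIntegral_continuous
    Real.continuous_fourierChar (by exact continuous_inner) hu
  have hcontv : Continuous (𝓕 v) := VectorFourier.fourierIntegral_continuous
    Real.continuous_fourierChar (by exact continuous_inner) hv
  have hconta : Continuous fun ξ : ℝ => angleSymbol n θ ξ :=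
    continuous_iff_continuousAt.mpr fun ξ =>
      ContinuousAt.comp (f := fun ξ : ℝ => (ξ : ℂ)) (g := angleSymbol n θ)
        (differentiableAt_angleSymbol (by simp)).continuousAt Complex.continuous_ofReal.continuousAt
  have iuv : Integrable fun ξ : ℝ => conj (𝓕 u ξ) * 𝓕 v ξ * angleSymbol n θ ξ := by
    refine (iU.add iV).mono' (((Complex.continuous_conj.comp hcontu).mul hcontv).mul
      hconta).aestronglyMeasurable (ae_of_all _ fun ξ => ?_)
    rw [norm_mul, norm_mul, norm_angleSymbol_ofReal, RCLike.norm_conj, Pi.add_apply, ← hs]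
    nlinarith [sq_nonneg (‖𝓕 u ξ‖ - ‖𝓕 v ξ‖), sobolevWeight_pos s ξ, sq_nonneg (‖𝓕 u ξ‖),
      sq_nonneg (‖𝓕 v ξ‖), mul_nonneg (sobolevWeight_pos s ξ).le (sq_nonneg (‖𝓕 u ξ‖ - ‖𝓕 v ξ‖)),
      mul_nonneg (sobolevWeight_pos s ξ).le (sq_nonneg (‖𝓕 u ξ‖)),
      mul_nonneg (sobolevWeight_pos s ξ).le (sq_nonneg (‖𝓕 v ξ‖))]
  have ivv : Integrable fun ξ : ℝ => conj (𝓕 v ξ) * 𝓕 v ξ * angleSymbol n θ ξ := by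
    refine iV.mono' (((Complex.continuous_conj.comp hcontv).mul hcontv).mul
      hconta).aestronglyMeasurable (ae_of_all _ fun ξ => ?_)
    rw [norm_mul, norm_mul, norm_angleSymbol_ofReal, RCLike.norm_conj, ← hs]
    exact le_of_eq (by ring)
  have h0 := integral_conj_fourier_mul_eq_zero hθ hu hu0 hv hv0 iuv
  set A := ∫ ξ, sobolevWeight s ξ * ‖𝓕 v ξ‖ ^ 2 with hA
  set B := ∫ ξ, sobolevWeight s ξ * ‖𝓕 u ξ + 𝓕 v ξ‖ ^ 2 with hB
  -- The lower bound on the real part of the symbol gives `c A ≤ Re ∫ conj(v̂) v̂ a`, where `a` is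
  -- the symbol. The vanishing cross term may be added, so the integrand becomes `conj(û + v̂) v̂
  -- a`. Young's inequality with parameter `c` leaves a multiple of `A` that the left side absorbs.
  have key : c * A ≤ 1 / (2 * c) * B + c / 2 * A := by
    have isum : Integrable fun ξ : ℝ => conj (𝓕 u ξ) * 𝓕 v ξ * angleSymbol n θ ξ +
        conj (𝓕 v ξ) * 𝓕 v ξ * angleSymbol n θ ξ := iuv.add ivv
    have step1 : c * A ≤ ∫ ξ : ℝ, (conj (𝓕 v ξ) * 𝓕 v ξ * angleSymbol n θ ξ).re := by
      rw [hA, ← integral_const_mul]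
      refine integral_mono (iV.const_mul c) ivv.re fun ξ => ?_
      have e1 : conj (𝓕 v ξ) * 𝓕 v ξ = ((‖𝓕 v ξ‖ ^ 2 : ℝ) : ℂ) := by
        rw [Complex.conj_mul']; push_cast; rfl
      simp only [e1]
      rw [Complex.re_ofReal_mul]
      have := re_angleSymbol_ge (n := n) hθ ξ
      rw [← hs, ← hc] at this
      nlinarith [sq_nonneg ‖𝓕 v ξ‖]
    have step2 : ∫ ξ : ℝ, (conj (𝓕 v ξ) * 𝓕 v ξ * angleSymbol n θ ξ).re =
        (∫ ξ : ℝ, (conj (𝓕 u ξ) * 𝓕 v ξ * angleSymbol n θ ξ +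
          conj (𝓕 v ξ) * 𝓕 v ξ * angleSymbol n θ ξ)).re := by
      rw [integral_add iuv ivv, h0, zero_add]
      exact integral_re ivv
    have step3 : (∫ ξ : ℝ, (conj (𝓕 u ξ) * 𝓕 v ξ * angleSymbol n θ ξ +
          conj (𝓕 v ξ) * 𝓕 v ξ * angleSymbol n θ ξ)).re ≤
        ∫ ξ : ℝ, (1 / (2 * c) * (sobolevWeight s ξ * ‖𝓕 u ξ + 𝓕 v ξ‖ ^ 2) +
          c / 2 * (sobolevWeight s ξ * ‖𝓕 v ξ‖ ^ 2)) := by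
      refine (Complex.re_le_norm _).trans (norm_integral_le_of_norm_le
        ((iUV.const_mul _).add (iV.const_mul _)) (ae_of_all _ fun ξ => ?_))
      rw [← add_mul, ← add_mul, ← map_add, norm_mul, norm_mul, norm_angleSymbol_ofReal,
        RCLike.norm_conj, ← hs]
      have hw := sobolevWeight_pos s ξ
      set x := ‖𝓕 u ξ + 𝓕 v ξ‖
      set y := ‖𝓕 v ξ‖
      have hxy : x * y ≤ 1 / (2 * c) * x ^ 2 + c / 2 * y ^ 2 := by
        have : 1 / (2 * c) * x ^ 2 + c / 2 * y ^ 2 - x * y = (x - c * y) ^ 2 / (2 * c) := by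
          field_simp; ring
        have h : 0 ≤ (x - c * y) ^ 2 / (2 * c) := by positivity
        linarith
      nlinarith
    rw [integral_add (iUV.const_mul _) (iV.const_mul _), integral_const_mul,
      integral_const_mul] at step3
    linarith
  have hAB : A ≤ (1 / c) ^ 2 * B := by
    have h1 : c / 2 * A ≤ 1 / (2 * c) * B := by linarith
    have h2 : A = 2 / c * (c / 2 * A) := by field_simp
    rw [h2]
    calc 2 / c * (c / 2 * A) ≤ 2 / c * (1 / (2 * c) * B) := by gcongr
      _ = _ := by field_simp
  rw [sobolevNorm_eq_ofReal_integral hvs, sobolevNorm_eq_ofReal_integral hUV]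
  have eA : ∫ ξ, sobolevWeight s ξ * ‖(𝓕 V : Lp ℂ 2 (volume : Measure ℝ)) ξ‖ ^ 2 = A :=
    integral_congr_ae (by filter_upwards [eV] with ξ h; rw [h])
  have eB : ∫ ξ, sobolevWeight s ξ * ‖(𝓕 (U + V) : Lp ℂ 2 (volume : Measure ℝ)) ξ‖ ^ 2 = B :=
    integral_congr_ae (by filter_upwards [eUV] with ξ h; rw [h])
  rw [eA, eB]
  calc ENNReal.ofReal A ^ (1 / 2 : ℝ) ≤ ENNReal.ofReal ((1 / c) ^ 2 * B) ^ (1 / 2 : ℝ) := by gcongr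
    _ = _ := by
      rw [ENNReal.ofReal_mul (by positivity), ENNReal.mul_rpow_of_nonneg _ _ (by norm_num),
        ENNReal.ofReal_pow (by positivity), ← ENNReal.rpow_ofNat, ← ENNReal.rpow_mul]
      norm_num

end FokasHalfLine

namespace FokasHalfLine
open scoped FourierTransform ComplexConjugate

/-! ### Multiplication by Schwartz functions -/

theorem memLp_schwartz_mul (χ : SchwartzMap ℝ ℂ) (F : Lp ℂ 2 (volume : Measure ℝ)) :
    MemLp (fun x => χ x * F x) 2 volume :=
  (Lp.memLp F).mul' (p := ⊤) (q := 2) (χ.memLp ⊤ volume)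

theorem integrable_schwartz_mul (χ : SchwartzMap ℝ ℂ) (F : Lp ℂ 2 (volume : Measure ℝ)) :
    Integrable (fun x => χ x * F x) volume :=
  (χ.memLp 2 volume).integrable_mul (Lp.memLp F)

/-- The product of a Schwartz function and a square integrable function. -/
noncomputable def schwartzMul (χ : SchwartzMap ℝ ℂ) (F : Lp ℂ 2 (volume : Measure ℝ)) :
    Lp ℂ 2 (volume : Measure ℝ) :=
  (memLp_schwartz_mul χ F).toLp

theorem coeFn_schwartzMul (χ : SchwartzMap ℝ ℂ) (F : Lp ℂ 2 (volume : Measure ℝ)) :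
    schwartzMul χ F =ᵐ[volume] fun x => χ x * F x :=
  (memLp_schwartz_mul χ F).coeFn_toLp

theorem integrable_coeFn_schwartzMul (χ : SchwartzMap ℝ ℂ) (F : Lp ℂ 2 (volume : Measure ℝ)) :
    Integrable (schwartzMul χ F) volume :=
  (integrable_schwartz_mul χ F).congr (coeFn_schwartzMul χ F).symm

theorem fourier_schwartz_mul (χ : SchwartzMap ℝ ℂ) (F : Lp ℂ 2 (volume : Measure ℝ)) (ξ : ℝ) :
    𝓕 (fun x => χ x * F x) ξ =
      ∫ η, 𝓕⁻ χ (η - ξ) * (𝓕 F : Lp ℂ 2 (volume : Measure ℝ)) η := by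
  -- The translate of `𝓕⁻ χ` by `ξ` is the test function whose transform is `χ` times the character
  -- of frequency `ξ`.
  have h := integral_smul_fourier_Lp F (SchwartzMap.compSubConstCLM ℝ ξ (𝓕⁻ χ))
  simp only [SchwartzMap.compSubConstCLM_apply, smul_eq_mul] at h
  rw [h, Real.fourier_real_eq_integral_exp_smul]
  refine integral_congr_ae (ae_of_all _ fun x => ?_)
  simp only [smul_eq_mul]
  rw [← mul_assoc]
  congr 1
  have h2 := fourier_comp_add (𝓕⁻ χ : SchwartzMap ℝ ℂ) (-ξ) x
  rw [← SchwartzMap.fourier_coe, FourierTransform.fourier_fourierInv_eq] at h2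
  rw [SchwartzMap.fourier_coe]
  have h3 : (⇑(SchwartzMap.compSubConstCLM ℝ ξ (𝓕⁻ χ)) : ℝ → ℂ) =
      fun x => (𝓕⁻ χ : SchwartzMap ℝ ℂ) (x + -ξ) := by
    funext y
    rw [SchwartzMap.compSubConstCLM_apply, sub_eq_add_neg]
  rw [h3, h2]
  congr 2
  push_cast
  ring

/-- Peetre's inequality; it reduces to `1 + a² ≤ 2 (1 + (b - a)²)(1 + b²)`. -/
theorem sobolevWeight_le_mul {s : ℝ} (hs : 0 ≤ s) (ξ η : ℝ) :
    sobolevWeight s ξ ≤ 2 ^ s * sobolevWeight s (η - ξ) * sobolevWeight s η := by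
  unfold sobolevWeight
  rw [← Real.mul_rpow (by norm_num) (by positivity), ← Real.mul_rpow (by positivity) (by positivity)]
  refine Real.rpow_le_rpow (by positivity) ?_ hs
  set a := 2 * Real.pi * ξ
  set b := 2 * Real.pi * η
  rw [show 2 * Real.pi * (η - ξ) = b - a by ring]
  nlinarith [sq_nonneg (a - 2 * b), mul_nonneg (sq_nonneg (b - a)) (sq_nonneg b), sq_nonneg (a - b)]

/-- A bound for the norm of the multiplication by `χ` on `H^s(ℝ)`. -/
noncomputable def multiplierConst (s : ℝ) (χ : SchwartzMap ℝ ℂ) : ℝ≥0∞ :=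
  ENNReal.ofReal (2 ^ (s / 2)) *
    ∫⁻ a, ENNReal.ofReal (sobolevWeight (s / 2) a) * ‖𝓕⁻ χ a‖ₑ

theorem multiplierConst_lt_top {s : ℝ} (hs : 0 ≤ s) (χ : SchwartzMap ℝ ℂ) :
    multiplierConst s χ < ⊤ := by
  refine ENNReal.mul_lt_top ENNReal.ofReal_lt_top ?_
  obtain ⟨C, hC, h⟩ := schwartzMap_rpow_decay (𝓕⁻ χ) (s + 2)
  have hint := (integrable_one_add_norm (E := ℝ) (μ := volume) (r := 2) (by simp)).const_mul
    ((2 * Real.pi) ^ s * C)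
  refine lt_of_le_of_lt (lintegral_mono fun a => ?_) hint.lintegral_lt_top
  rw [← ofReal_norm, ← ENNReal.ofReal_mul (sobolevWeight_pos _ _).le]
  refine ENNReal.ofReal_le_ofReal ?_
  have h1 : 1 + |2 * Real.pi * a| ≤ 2 * Real.pi * (1 + |a|) := by
    rw [abs_mul, abs_of_pos (by positivity)]
    nlinarith [Real.pi_gt_three, abs_nonneg a]
  have ha : 0 < 1 + |a| := by positivity
  calc sobolevWeight (s / 2) a * ‖𝓕⁻ χ a‖
      ≤ (2 * Real.pi * (1 + |a|)) ^ s * (C * (1 + |a|) ^ (-(s + 2))) := by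
        gcongr
        · exact (sobolevWeight_half_le hs a).trans (by gcongr)
        · exact h a
    _ = _ := by
        rw [Real.mul_rpow (by positivity) ha.le, Real.norm_eq_abs,
          show (-2 : ℝ) = s + -(s + 2) by ring, Real.rpow_add ha]
        ring

/-- In frequency the product is a convolution. Peetre's inequality distributes the weight over the
two factors, and the Schur test with constant weights is Young's inequality for an `L¹` kernel and
an `L²` function. -/
theorem sobolevNorm_schwartzMul_le {s : ℝ} (hs : 0 ≤ s) (χ : SchwartzMap ℝ ℂ)
    (F : Lp ℂ 2 (volume : Measure ℝ)) :
    sobolevNorm s (schwartzMul χ F) ≤ multiplierConst s χ * sobolevNorm s F := by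
  set M := multiplierConst s χ with hM
  have hcχ : Continuous fun a => 𝓕⁻ χ a := (𝓕⁻ χ).continuous
  have hw := continuous_sobolevWeight (s / 2)
  rw [sobolevNorm_eq_of_ae (s := s) (F := schwartzMul χ F)
    (fourier_toLp_ae_eq (integrable_schwartz_mul χ F) (memLp_schwartz_mul χ F)),
    sobolevNorm_eq_of_ae (s := s) (F := F) (ae_eq_refl _)]
  set k : ℝ → ℝ≥0∞ := fun a => ENNReal.ofReal (2 ^ (s / 2)) *
    (ENNReal.ofReal (sobolevWeight (s / 2) a) * ‖𝓕⁻ χ a‖ₑ) with hk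
  have hkm : Measurable k := by
    refine measurable_const.mul ((hw.measurable.ennreal_ofReal).mul hcχ.enorm.measurable)
  have hkM : ∫⁻ a, k a = M := by
    rw [hk, lintegral_const_mul' _ _ ENNReal.ofReal_ne_top]; rfl
  have hschur := lintegral_sq_le_of_schur (μ := (volume : Measure ℝ)) (ν := (volume : Measure ℝ))
    (K := fun ξ η => k (η - ξ))
    (f := fun η => ENNReal.ofReal (sobolevWeight (s / 2) η) *
      ‖(𝓕 F : Lp ℂ 2 (volume : Measure ℝ)) η‖ₑ) (p := fun _ => 1) (q := fun _ => 1) (C₁ := M)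
    (C₂ := M) (hkm.comp (measurable_snd.sub measurable_fst))
    (hw.measurable.ennreal_ofReal.aemeasurable.mul (Lp.aestronglyMeasurable _).enorm)
    measurable_const measurable_const (by simp)
    (fun ξ => by
      simp only [mul_one]
      rw [lintegral_sub_right_eq_self k ξ, hkM])
    (ae_of_all _ fun η => by
      simp only [mul_one, one_mul]
      rw [lintegral_sub_left_eq_self k η, hkM])
  have hpt : ∀ ξ, ENNReal.ofReal (sobolevWeight s ξ) * ‖𝓕 (fun x => χ x * F x) ξ‖ₑ ^ 2 ≤
      (∫⁻ η, k (η - ξ) * (ENNReal.ofReal (sobolevWeight (s / 2) η) *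
        ‖(𝓕 F : Lp ℂ 2 (volume : Measure ℝ)) η‖ₑ)) ^ 2 := by
    intro ξ
    rw [weighted_enorm_sq, ENNReal.rpow_ofNat]
    gcongr
    rw [fourier_schwartz_mul]
    calc _ ≤ ENNReal.ofReal (sobolevWeight (s / 2) ξ) *
          ∫⁻ η, ‖𝓕⁻ χ (η - ξ) * (𝓕 F : Lp ℂ 2 (volume : Measure ℝ)) η‖ₑ := by
          gcongr
          exact enorm_integral_le_lintegral_enorm _
      _ = ∫⁻ η, ENNReal.ofReal (sobolevWeight (s / 2) ξ) *
          ‖𝓕⁻ χ (η - ξ) * (𝓕 F : Lp ℂ 2 (volume : Measure ℝ)) η‖ₑ :=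
          (lintegral_const_mul' _ _ ENNReal.ofReal_ne_top).symm
      _ ≤ _ := by
          refine lintegral_mono fun η => ?_
          have h1 : ENNReal.ofReal (sobolevWeight (s / 2) ξ) ≤ ENNReal.ofReal (2 ^ (s / 2)) *
              ENNReal.ofReal (sobolevWeight (s / 2) (η - ξ)) *
              ENNReal.ofReal (sobolevWeight (s / 2) η) := by
            rw [← ENNReal.ofReal_mul (by positivity), ← ENNReal.ofReal_mul
              (mul_nonneg (by positivity) (sobolevWeight_pos _ _).le)]
            exact ENNReal.ofReal_le_ofReal (sobolevWeight_le_mul (by linarith) ξ η)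
          rw [enorm_mul]
          calc _ ≤ (ENNReal.ofReal (2 ^ (s / 2)) *
              ENNReal.ofReal (sobolevWeight (s / 2) (η - ξ)) *
              ENNReal.ofReal (sobolevWeight (s / 2) η)) *
              (‖𝓕⁻ χ (η - ξ)‖ₑ * ‖(𝓕 F : Lp ℂ 2 (volume : Measure ℝ)) η‖ₑ) := by gcongr
            _ = _ := by rw [hk]; ring
  calc _ ≤ (M * M * ∫⁻ η, (ENNReal.ofReal (sobolevWeight (s / 2) η) *
        ‖(𝓕 F : Lp ℂ 2 (volume : Measure ℝ)) η‖ₑ) ^ 2) ^ (1 / 2 : ℝ) := by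
        gcongr
        exact (lintegral_mono hpt).trans hschur
    _ = _ := by
        rw [ENNReal.mul_rpow_of_nonneg _ _ (by norm_num), ← pow_two, ← ENNReal.rpow_ofNat,
          ← ENNReal.rpow_mul]
        simp only [weighted_enorm_sq, ENNReal.rpow_ofNat]
        norm_num

/-- The bump function `b`, rescaled by `R`, as a Schwartz function. -/
noncomputable def bumpSchwartz {c : ℝ} (b : ContDiffBump c) (R : ℝ) (hR : 0 < R) :
    SchwartzMap ℝ ℂ :=
  HasCompactSupport.toSchwartzMap (f := fun x : ℝ => ((b (x / R) : ℝ) : ℂ))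
    (by
      have h1 : HasCompactSupport (fun x : ℝ => b (x * R⁻¹)) :=
        b.hasCompactSupport.comp_homeomorph (Homeomorph.mulRight₀ R⁻¹ (inv_ne_zero hR.ne'))
      simp only [div_eq_mul_inv]
      exact h1.comp_left (g := fun y : ℝ => (y : ℂ)) Complex.ofReal_zero)
    (Complex.ofRealCLM.contDiff.comp (b.contDiff.comp (contDiff_id.div_const R)))

theorem bumpSchwartz_apply {c : ℝ} (b : ContDiffBump c) (R : ℝ) (hR : 0 < R) (x : ℝ) :
    bumpSchwartz b R hR x = (b (x / R) : ℝ) := rfl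

theorem fourierInv_bumpSchwartz {c : ℝ} (b : ContDiffBump c) (R : ℝ) (hR : 0 < R) (a : ℝ) :
    𝓕⁻ (bumpSchwartz b R hR) a = R * 𝓕⁻ (bumpSchwartz b 1 one_pos) (a * R) := by
  rw [SchwartzMap.fourierInv_coe, SchwartzMap.fourierInv_coe, Real.fourierInv_eq', Real.fourierInv_eq']
  simp only [bumpSchwartz_apply, div_one]
  have h := Measure.integral_comp_div (fun y : ℝ =>
    Complex.exp (↑(2 * Real.pi * inner ℝ y (a * R)) * Complex.I) • ((b y : ℝ) : ℂ)) R
  rw [abs_of_pos hR, Complex.real_smul] at h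
  rw [← h]
  refine integral_congr_ae (ae_of_all _ fun x => ?_)
  simp only
  congr 4
  simp only [RCLike.inner_apply, conj_trivial]
  field_simp

/-- Stretching a function by `R ≥ 1` concentrates its transform near the origin, where the weight is
smaller, without changing the `L¹` norm of the transform. Cutoffs at every scale `R ≥ 1` thus have a
common multiplier bound, which makes the later estimate uniform in `T`. -/
theorem multiplierConst_bumpSchwartz_le {c : ℝ} (b : ContDiffBump c) {s : ℝ} (hs : 0 ≤ s) {R : ℝ}
    (hR : 1 ≤ R) :
    multiplierConst s (bumpSchwartz b R (by linarith)) ≤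
      multiplierConst s (bumpSchwartz b 1 one_pos) := by
  have hR0 : 0 < R := by linarith
  unfold multiplierConst
  refine mul_le_mul_right ?_ _
  set k : ℝ → ℝ≥0∞ := fun a => ENNReal.ofReal (sobolevWeight (s / 2) a) *
    ‖𝓕⁻ (bumpSchwartz b 1 one_pos) a‖ₑ with hk
  have hkm : Measurable k :=
    ((continuous_sobolevWeight _).measurable.ennreal_ofReal).mul
      (𝓕⁻ (bumpSchwartz b 1 one_pos)).continuous.enorm.measurable
  have h1 : ∫⁻ a, k (a * R) = ENNReal.ofReal R⁻¹ * ∫⁻ a, k a := by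
    have := Real.map_volume_mul_right hR0.ne'
    rw [← lintegral_map hkm (by fun_prop : Measurable fun a : ℝ => a * R), this,
      lintegral_smul_measure, abs_of_pos (by positivity), smul_eq_mul]
  calc _ ≤ ∫⁻ a, ENNReal.ofReal R * k (a * R) := by
        refine lintegral_mono fun a => ?_
        simp only [hk]
        rw [fourierInv_bumpSchwartz, enorm_mul, ← mul_assoc, ← mul_assoc]
        gcongr ?_ * _
        have e : ‖(R : ℂ)‖ₑ = ENNReal.ofReal R := by
          rw [← ofReal_norm, Complex.norm_real, Real.norm_of_nonneg hR0.le]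
        rw [e, mul_comm]
        gcongr
        unfold sobolevWeight
        gcongr ?_ ^ _
        have h2 : (2 * Real.pi * a) ^ 2 ≤ (2 * Real.pi * (a * R)) ^ 2 := by
          rw [show 2 * Real.pi * (a * R) = (2 * Real.pi * a) * R by ring, mul_pow _ R]
          exact le_mul_of_one_le_right (sq_nonneg _) (one_le_pow₀ hR)
        linarith
    _ = _ := by
        rw [lintegral_const_mul' _ _ ENNReal.ofReal_ne_top, h1, ← mul_assoc,
          ← ENNReal.ofReal_mul hR0.le, mul_inv_cancel₀ hR0.ne']
        simp

/-! ### Extension by zero -/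

theorem integrable_of_memLp_two_of_bounded_support {f : ℝ → ℂ} (hf : MemLp f 2 volume) {a b : ℝ}
    (h : ∀ᵐ x, x ∉ Icc a b → f x = 0) : Integrable f := by
  have h1 : IntegrableOn f (Icc a b) := (hf.restrict (Icc a b)).integrable (by norm_num)
  have h2 : (Icc a b).indicator f =ᵐ[volume] f := by
    filter_upwards [h] with x hx
    by_cases hxs : x ∈ Icc a b
    · rw [indicator_of_mem hxs]
    · rw [indicator_of_notMem hxs, hx hxs]
  exact (h1.integrable_indicator measurableSet_Icc).congr h2

/-- If `s - 1/2` is not an integer, the norm in `H^s(ℝ)` of a function supported in `[0, T]` is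
controlled by that of any other extension of its restriction to `(0, T)`, uniformly in `T`. -/
theorem exists_sobolevNorm_le_of_ae_eq {n : ℕ} {θ : ℝ} (hθ : |θ| < 1 / 2) (hs : 0 ≤ n + θ) :
    ∃ C : ℝ, 0 < C ∧ ∀ T : ℝ, 0 < T → ∀ g G : Lp ℂ 2 (volume : Measure ℝ),
      (∀ᵐ x, x ∉ Icc 0 T → g x = 0) → sobolevNorm (n + θ) g < ⊤ →
      (∀ᵐ x ∂(volume.restrict (Ioo 0 T)), G x = g x) →
      sobolevNorm (n + θ) g ≤ ENNReal.ofReal C * sobolevNorm (n + θ) G := by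
  set s : ℝ := n + θ with hsdef
  let b : ContDiffBump (0 : ℝ) := ⟨1, 2, one_pos, one_lt_two⟩
  set M := multiplierConst s (bumpSchwartz b 1 one_pos) with hMdef
  have hM : M ≠ ⊤ := (multiplierConst_lt_top hs _).ne
  set c := 1 / Real.cos (Real.pi * θ) with hc
  have hc0 : 0 < c := by
    refine one_div_pos.mpr (Real.cos_pos_of_mem_Ioo ⟨?_, ?_⟩) <;>
      nlinarith [Real.pi_pos, (abs_lt.mp hθ).1, (abs_lt.mp hθ).2]
  refine ⟨c * ((1 + c) * M.toReal) + 1, by positivity, fun T hT g G hg hgs hGg => ?_⟩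
  rcases eq_or_ne (sobolevNorm s G) ⊤ with htop | hGtop
  · rw [htop, ENNReal.mul_top]
    · exact le_top
    · simp only [ne_eq, ENNReal.ofReal_eq_zero, not_le]; positivity
  -- At least `1` for the uniform multiplier bound, at least `T` so that the cutoff equals `1` on
  -- `(0, T)`.
  set R := max T 1 with hR
  have hR1 : 1 ≤ R := le_max_right _ _
  have hRT : T ≤ R := le_max_left _ _
  have hR0 : 0 < R := by linarith
  set G₁ := schwartzMul (bumpSchwartz b R hR0) G with hG₁
  have hG₁n : sobolevNorm s G₁ ≤ M * sobolevNorm s G :=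
    (sobolevNorm_schwartzMul_le hs _ _).trans (by
      gcongr
      exact multiplierConst_bumpSchwartz_le b hs hR1)
  have hG₁top : sobolevNorm s G₁ < ⊤ :=
    hG₁n.trans_lt (ENNReal.mul_lt_top hM.lt_top hGtop.lt_top)
  set z := G₁ - g with hz
  have hztop : sobolevNorm s z < ⊤ :=
    (sobolevNorm_sub_le s G₁ g).trans_lt (ENNReal.add_lt_top.mpr ⟨hG₁top, hgs⟩)
  -- The difference `z` vanishes on `(0, T)` and outside `[-2R, 2R]`. The bump centred at `2R` is
  -- `1` on `[T, 2R]` and `0` on `x ≤ 0`, so it cuts `z` in the gap into a piece right of `T` and a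
  -- piece left of `0`.
  let b' : ContDiffBump (2 * R) := ⟨2 * R - T, 2 * R, by linarith, by linarith⟩
  set zp := schwartzMul (bumpSchwartz b' 1 one_pos) z with hzp
  set zm := z - zp with hzm
  -- The multiplier constant of this bump depends on `T`, but only the finiteness of the norm is
  -- used.
  have hzptop : sobolevNorm s zp < ⊤ :=
    (sobolevNorm_schwartzMul_le hs _ _).trans_lt
      (ENNReal.mul_lt_top (multiplierConst_lt_top hs _) hztop)
  have hzmtop : sobolevNorm s zm < ⊤ :=
    (sobolevNorm_sub_le s z zp).trans_lt (ENNReal.add_lt_top.mpr ⟨hztop, hzptop⟩)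
  have hne : ∀ c : ℝ, ∀ᵐ x : ℝ, x ≠ c := fun c => by
    simp [ae_iff]
  have hpt : ∀ᵐ x : ℝ, z x = b (x / R) * G x - g x := by
    filter_upwards [Lp.coeFn_sub G₁ g, coeFn_schwartzMul (bumpSchwartz b R hR0) G] with x h1 h2
    rw [h1, Pi.sub_apply, h2, bumpSchwartz_apply]
  have hptp : ∀ᵐ x : ℝ, zp x = b' x * z x := by
    filter_upwards [coeFn_schwartzMul (bumpSchwartz b' 1 one_pos) z] with x h1
    rw [h1, bumpSchwartz_apply, div_one]
  have hb1 : ∀ x : ℝ, |x| ≤ R → b (x / R) = 1 := fun x hx => by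
    refine b.one_of_mem_closedBall ?_
    rw [Metric.mem_closedBall, dist_zero_right, Real.norm_eq_abs, abs_div, abs_of_pos hR0]
    exact (div_le_one hR0).mpr hx
  have hb0 : ∀ x : ℝ, 2 * R ≤ |x| → b (x / R) = 0 := fun x hx => by
    refine b.zero_of_le_dist ?_
    rw [dist_zero_right, Real.norm_eq_abs, abs_div, abs_of_pos hR0]
    exact (le_div_iff₀ hR0).mpr hx
  have hb'1 : ∀ x : ℝ, T ≤ x → x ≤ 2 * R → b' x = 1 := fun x h1 h2 => by
    refine b'.one_of_mem_closedBall ?_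
    rw [Metric.mem_closedBall, Real.dist_eq, abs_le]
    constructor
    · change -(2 * R - T) ≤ _; linarith
    · change _ ≤ 2 * R - T; linarith
  have hb'0 : ∀ x : ℝ, x ≤ 0 → b' x = 0 := fun x h1 => by
    refine b'.zero_of_le_dist ?_
    rw [Real.dist_eq, abs_of_nonpos (by linarith)]
    change 2 * R ≤ _
    linarith
  rw [ae_restrict_iff' measurableSet_Ioo] at hGg
  have hz0 : ∀ᵐ x : ℝ, 0 < x → x < T → z x = 0 := by
    filter_upwards [hpt, hGg] with x h1 h2 h3 h4
    rw [h1, hb1 x (by rw [abs_of_pos h3]; linarith), h2 ⟨h3, h4⟩]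
    simp
  have hzout : ∀ᵐ x : ℝ, 2 * R ≤ |x| → z x = 0 := by
    filter_upwards [hpt, hg] with x h1 h2 h3
    rw [h1, hb0 x h3, h2]
    · simp
    · rintro ⟨h4, h5⟩
      rw [abs_of_nonneg h4] at h3
      linarith
  have hzp0 : ∀ᵐ x : ℝ, x < T → zp x = 0 := by
    filter_upwards [hptp, hz0, hne 0] with x h1 h2 h0 h3
    rw [h1]
    rcases lt_or_gt_of_ne h0 with h | h
    · rw [hb'0 x h.le]; simp
    · rw [h2 h h3]; simp
  have hzm0 : ∀ᵐ x : ℝ, 0 < x → zm x = 0 := by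
    filter_upwards [Lp.coeFn_sub z zp, hptp, hz0, hzout] with x h1 h2 h3 h4 h5
    rw [h1, Pi.sub_apply, h2]
    rcases lt_or_ge x T with h | h
    · rw [h3 h5 h]; simp
    rcases le_or_gt x (2 * R) with h' | h'
    · rw [hb'1 x h h']; simp
    · rw [h4 (by rw [abs_of_pos h5]; exact h'.le)]; simp
  have hgint : Integrable g := integrable_of_memLp_two_of_bounded_support (Lp.memLp g) hg
  have hzint : Integrable z :=
    ((integrable_coeFn_schwartzMul _ G).sub hgint).congr (Lp.coeFn_sub G₁ g).symm
  have hzpint : Integrable zp := integrable_coeFn_schwartzMul _ z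
  have hzmint : Integrable zm := (hzint.sub hzpint).congr (Lp.coeFn_sub z zp).symm
  set u := g + zp with hu
  have huint : Integrable u := (hgint.add hzpint).congr (Lp.coeFn_add g zp).symm
  have hutop : sobolevNorm s u < ⊤ :=
    (sobolevNorm_add_le s g zp).trans_lt (ENNReal.add_lt_top.mpr ⟨hgs, hzptop⟩)
  have hu0 : ∀ᵐ x : ℝ, x < 0 → u x = 0 := by
    filter_upwards [Lp.coeFn_add g zp, hg, hzp0] with x h1 h2 h3 h4
    rw [h1, Pi.add_apply, h2 (fun h => by linarith [h.1]), h3 (by linarith), add_zero]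
  have hsplit : u + zm = G₁ := by
    rw [hu, hzm, hz]; abel
  -- Splitting `G₁` at `0`: `zm` lies to the left, `g + zp` to the right.
  have step1 : sobolevNorm s zm ≤ ENNReal.ofReal c * sobolevNorm s G₁ := by
    have := sobolevNorm_le_of_disjoint_half_lines (n := n) hθ huint (Lp.memLp u) hu0 hzmint
      (Lp.memLp zm) hzm0 (by rwa [Lp.toLp_coeFn]) (by rwa [Lp.toLp_coeFn])
    rwa [Lp.toLp_coeFn, Lp.toLp_coeFn, hsplit] at this
  -- Splitting `g + zp` at `T`: `g` lies to the left, `zp` to the right.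
  have step2 : sobolevNorm s g ≤ ENNReal.ofReal c * sobolevNorm s u := by
    have := sobolevNorm_le_of_disjoint_half_lines (n := n) hθ hzpint (Lp.memLp zp) hzp0 hgint
      (Lp.memLp g) (by filter_upwards [hg] with x h1 h2; exact h1 fun h => by linarith [h.2])
      (by rwa [Lp.toLp_coeFn]) (by rwa [Lp.toLp_coeFn])
    rwa [Lp.toLp_coeFn, Lp.toLp_coeFn, add_comm zp g, ← hu] at this
  have step3 : sobolevNorm s u ≤ sobolevNorm s G₁ + sobolevNorm s zm := by
    have : u = G₁ - zm := by rw [← hsplit]; abel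
    rw [this]
    exact sobolevNorm_sub_le _ _ _
  calc sobolevNorm s g ≤ ENNReal.ofReal c * (sobolevNorm s G₁ + ENNReal.ofReal c * sobolevNorm s G₁) :=
        step2.trans (by gcongr; exact step3.trans (by gcongr))
    _ = ENNReal.ofReal c * ((1 + ENNReal.ofReal c) * sobolevNorm s G₁) := by ring
    _ ≤ ENNReal.ofReal c * ((1 + ENNReal.ofReal c) * (M * sobolevNorm s G)) := by gcongr
    _ = ENNReal.ofReal (c * ((1 + c) * M.toReal)) * sobolevNorm s G := by
        rw [ENNReal.ofReal_mul hc0.le, ENNReal.ofReal_mul (by positivity), ENNReal.ofReal_toReal hM,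
          ENNReal.ofReal_add zero_le_one hc0.le, ENNReal.ofReal_one]
        ring
    _ ≤ _ := by gcongr; linarith

end FokasHalfLine

namespace FokasHalfLine
open scoped FourierTransform ComplexConjugate

/-! ### The branches of the hyperbola -/

/-- The radicand `3β²m² + α² + 3βδ`. -/
def branchDisc (α β δ m : ℝ) : ℝ := 3 * β ^ 2 * m ^ 2 + α ^ 2 + 3 * β * δ

/-- Both branches of the hyperbola, `σ = 1` for the right one and `σ = -1` for the left one. -/
noncomputable def branch (α β δ σ m : ℝ) : ℂ :=
  (((α + σ * √(branchDisc α β δ m)) / (3 * β) : ℝ) : ℂ) + Complex.I * m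

/-- The derivative of `branch`. -/
noncomputable def branchDeriv (α β δ σ m : ℝ) : ℂ :=
  ((σ * (β * m / √(branchDisc α β δ m)) : ℝ) : ℂ) + Complex.I

theorem gammaRight_eq_branch (α β δ : ℝ) : gammaRight α β δ = branch α β δ 1 := by
  funext m
  simp [gammaRight, branch, branchDisc]

theorem gammaLeft_eq_branch (α β δ : ℝ) : gammaLeft α β δ = branch α β δ (-1) := by
  funext m
  simp [gammaLeft, branch, branchDisc, sub_eq_add_neg]

theorem branch_im (α β δ σ m : ℝ) : (branch α β δ σ m).im = m := by
  unfold branch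
  rw [Complex.add_im, Complex.ofReal_im]
  simp

theorem branch_re (α β δ σ m : ℝ) :
    (branch α β δ σ m).re = (α + σ * √(branchDisc α β δ m)) / (3 * β) := by
  unfold branch
  rw [Complex.add_re, Complex.ofReal_re]
  simp

theorem continuous_branchDisc (α β δ : ℝ) : Continuous (branchDisc α β δ) := by
  unfold branchDisc; fun_prop

theorem continuous_branch (α β δ σ : ℝ) : Continuous (branch α β δ σ) := by
  have := continuous_branchDisc α β δ
  unfold branch
  fun_prop

theorem measurable_branchDeriv (α β δ σ : ℝ) : Measurable (branchDeriv α β δ σ) := by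
  have := (continuous_branchDisc α β δ).measurable
  unfold branchDeriv
  fun_prop

theorem continuousAt_branchDeriv {α β δ σ m : ℝ} (h : 0 < branchDisc α β δ m) :
    ContinuousAt (branchDeriv α β δ σ) m := by
  unfold branchDeriv
  refine ContinuousAt.add (Complex.continuous_ofReal.continuousAt.comp ?_) continuousAt_const
  refine continuousAt_const.mul (ContinuousAt.div (by fun_prop) ?_ (Real.sqrt_ne_zero'.mpr h))
  exact (continuous_branchDisc α β δ).sqrt.continuousAt

theorem hasDerivAt_branch {α β δ : ℝ} (hβ : 0 < β) (σ : ℝ) {m : ℝ} (h : 0 < branchDisc α β δ m) :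
    HasDerivAt (branch α β δ σ) (branchDeriv α β δ σ m) m := by
  have h1 : HasDerivAt (branchDisc α β δ) (3 * β ^ 2 * (2 * m)) m := by
    unfold branchDisc
    have := ((((hasDerivAt_id m).pow 2).const_mul (3 * β ^ 2)).add_const (α ^ 2)).add_const
      (3 * β * δ)
    simpa using this
  have h2 : HasDerivAt (fun m => (α + σ * √(branchDisc α β δ m)) / (3 * β))
      (σ * (β * m / √(branchDisc α β δ m))) m := by
    refine ((((h1.sqrt h.ne').const_mul σ).const_add α).div_const (3 * β)).congr_deriv ?_
    have := Real.sqrt_ne_zero'.mpr h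
    field_simp
  have h3 : HasDerivAt (fun m : ℝ => Complex.I * (m : ℂ)) (Complex.I * 1) m :=
    Complex.ofRealCLM.hasDerivAt.const_mul Complex.I
  rw [mul_one] at h3
  exact h2.ofReal_comp.add h3

theorem hasDerivAt_gammaMid (h m : ℝ) : HasDerivAt (gammaMid h) 1 m :=
  (Complex.ofRealCLM.hasDerivAt (x := m)).add_const _

theorem continuous_gammaMid (h : ℝ) : Continuous (gammaMid h) := by
  unfold gammaMid; fun_prop

/-- A height above which the branches are smooth curves. -/
def RegularHeight (α β δ h : ℝ) : Prop := 0 ≤ h ∧ ∀ m, h ≤ m → 0 < branchDisc α β δ m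

theorem AdmissibleHeight.regularHeight {α β δ h : ℝ} (hβ : 0 < β) (H : AdmissibleHeight α β δ h) :
    RegularHeight α β δ h := by
  rcases lt_or_ge 0 (α ^ 2 + 3 * β * δ) with hD | hD
  · refine ⟨(H.1 hD).ge, fun m _ => ?_⟩
    unfold branchDisc
    have : 0 ≤ 3 * β ^ 2 * m ^ 2 := by positivity
    linarith
  · have h1 := H.2 hD
    set r := √(-(α ^ 2 + 3 * β * δ)) with hr
    have hr0 : 0 ≤ r := Real.sqrt_nonneg _
    have hr2 : r ^ 2 = -(α ^ 2 + 3 * β * δ) := Real.sq_sqrt (by linarith)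
    have h0 : 0 < h := lt_of_le_of_lt (by positivity) h1
    refine ⟨h0.le, fun m hm => ?_⟩
    rw [div_lt_iff₀ (by positivity)] at h1
    -- Squared, this says that `-(α² + 3βδ)` is below `(9/4) β² m²`, hence below `3 β² m²`.
    have h2 : 2 * r < m * (3 * β) := h1.trans_le (by gcongr)
    unfold branchDisc
    nlinarith [mul_self_lt_mul_self (by positivity) h2, mul_pos hβ (h0.trans_le hm)]

theorem RegularHeight.mono {α β δ h M : ℝ} (H : RegularHeight α β δ h) (hM : h ≤ M) :
    RegularHeight α β δ M := ⟨H.1.trans hM, fun m hm => H.2 m (hM.trans hm)⟩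

theorem setIntegral_comp_branch {α β δ : ℝ} (hβ : 0 < β) (σ : ℝ) {h M : ℝ}
    (H : RegularHeight α β δ h) (hM : h ≤ M) {f P : ℂ → ℂ} (hf : Continuous f)
    (hP : ∀ z, HasDerivAt P (f z) z) :
    ∫ m in Ioc h M, f (branch α β δ σ m) * branchDeriv α β δ σ m =
      P (branch α β δ σ M) - P (branch α β δ σ h) := by
  rw [← intervalIntegral.integral_of_le hM]
  refine intervalIntegral.integral_eq_sub_of_hasDerivAt
    (f := fun m => P (branch α β δ σ m)) (fun m hm => ?_) ?_
  · rw [uIcc_of_le hM] at hm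
    exact (hP _).comp_of_eq m (hasDerivAt_branch hβ σ (H.2 m hm.1)) rfl
  · refine ContinuousOn.intervalIntegrable fun m hm => ?_
    rw [uIcc_of_le hM] at hm
    exact ((hf.comp (continuous_branch α β δ σ)).continuousAt.mul
      (continuousAt_branchDeriv (H.2 m hm.1))).continuousWithinAt

theorem integrableOn_Ioc_comp_branch {α β δ : ℝ} (σ : ℝ) {h M : ℝ}
    (H : RegularHeight α β δ h) {f : ℂ → ℂ} (hf : Continuous f) :
    IntegrableOn (fun m => f (branch α β δ σ m) * branchDeriv α β δ σ m) (Ioc h M) := by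
  refine IntegrableOn.mono_set (ContinuousOn.integrableOn_compact isCompact_Icc fun m hm => ?_)
    Ioc_subset_Icc_self
  exact ((hf.comp (continuous_branch α β δ σ)).continuousAt.mul
      (continuousAt_branchDeriv (H.2 m hm.1))).continuousWithinAt

theorem branch_left_re_le (α β δ : ℝ) (hβ : 0 < β) (h : ℝ) :
    (branch α β δ (-1) h).re ≤ (branch α β δ 1 h).re := by
  rw [branch_re, branch_re]
  have := Real.sqrt_nonneg (branchDisc α β δ h)
  gcongr
  linarith

theorem gammaMid_branch_re (α β δ σ h : ℝ) :
    gammaMid h (branch α β δ σ h).re = branch α β δ σ h := by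
  apply Complex.ext <;> simp [gammaMid, branch_im]

theorem setIntegral_comp_gammaMid {α β δ : ℝ} (hβ : 0 < β) {h : ℝ} {f P : ℂ → ℂ}
    (hf : Continuous f) (hP : ∀ z, HasDerivAt P (f z) z) :
    ∫ m in Ioo (branch α β δ (-1) h).re (branch α β δ 1 h).re, f (gammaMid h m) =
      P (branch α β δ 1 h) - P (branch α β δ (-1) h) := by
  have hle := branch_left_re_le α β δ hβ h
  rw [← integral_Ioc_eq_integral_Ioo, ← intervalIntegral.integral_of_le hle]
  have := intervalIntegral.integral_eq_sub_of_hasDerivAt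
    (f := fun m => P (gammaMid h m)) (f' := fun m => f (gammaMid h m))
    (a := (branch α β δ (-1) h).re) (b := (branch α β δ 1 h).re) (fun m _ => ?_) ?_
  · rw [this, gammaMid_branch_re, gammaMid_branch_re]
  · exact ((hP _).comp_of_eq m (hasDerivAt_gammaMid h m) rfl).congr_deriv (mul_one _)
  · exact (hf.comp (continuous_gammaMid h)).intervalIntegrable _ _

/-- The contour integral with the parametrizations differentiated. -/
theorem contourIntegral_eq {α β δ : ℝ} (hβ : 0 < β) {h : ℝ} (H : RegularHeight α β δ h)
    (f : ℂ → ℂ) :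
    contourIntegral α β δ h f =
      -(∫ m in Ioi h, f (branch α β δ (-1) m) * branchDeriv α β δ (-1) m)
      + (∫ m in Ioo (branch α β δ (-1) h).re (branch α β δ 1 h).re, f (gammaMid h m))
      + ∫ m in Ioi h, f (branch α β δ 1 m) * branchDeriv α β δ 1 m := by
  unfold contourIntegral pathIntegral
  rw [gammaLeft_eq_branch, gammaRight_eq_branch]
  congr 1
  · congr 1
    · congr 1
      refine setIntegral_congr_fun measurableSet_Ioi fun m hm => ?_
      rw [(hasDerivAt_branch hβ (-1) (H.2 m (le_of_lt hm))).deriv]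
    · refine integral_congr_ae (ae_of_all _ fun m => ?_)
      simp only
      rw [(hasDerivAt_gammaMid h m).deriv, mul_one]
  · refine setIntegral_congr_fun measurableSet_Ioi fun m hm => ?_
    rw [(hasDerivAt_branch hβ 1 (H.2 m (le_of_lt hm))).deriv]

/-- The contour can be moved up inside the domain where the integrand is entire. -/
theorem contourIntegral_eq_of_le {α β δ : ℝ} (hβ : 0 < β) {h M : ℝ} (H : RegularHeight α β δ h)
    (hM : h ≤ M) {f : ℂ → ℂ} (hf : Differentiable ℂ f)
    (hi : ∀ σ : ℝ, σ ^ 2 = 1 →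
      IntegrableOn (fun m => f (branch α β δ σ m) * branchDeriv α β δ σ m) (Ioi M)) :
    contourIntegral α β δ h f = contourIntegral α β δ M f := by
  -- An entire function has a primitive, so the pieces between the two heights are differences of
  -- values of `P` at the corners, and they cancel.
  obtain ⟨P, hP⟩ := hf.isExactOn_univ
  have hP' : ∀ z, HasDerivAt P (f z) z := fun z => hP z (mem_univ z)
  rw [contourIntegral_eq hβ H, contourIntegral_eq hβ (H.mono hM),
    setIntegral_comp_gammaMid hβ hf.continuous hP', setIntegral_comp_gammaMid hβ hf.continuous hP',
    ← Ioc_union_Ioi_eq_Ioi hM,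
    setIntegral_union Ioc_disjoint_Ioi_same measurableSet_Ioi
      (integrableOn_Ioc_comp_branch _ H hf.continuous) (hi (-1) (by norm_num)),
    setIntegral_union Ioc_disjoint_Ioi_same measurableSet_Ioi
      (integrableOn_Ioc_comp_branch _ H hf.continuous) (hi 1 (by norm_num)),
    setIntegral_comp_branch hβ _ H hM hf.continuous hP',
    setIntegral_comp_branch hβ _ H hM hf.continuous hP']
  ring

/-! ### The spectral function on the contour -/

theorem differentiable_omega (α β δ : ℝ) : Differentiable ℂ (omega α β δ) := by
  unfold omega; fun_prop

theorem deriv_omega (α β δ : ℝ) (k : ℂ) :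
    deriv (omega α β δ) k = -Complex.I * β * (3 * k ^ 2) + Complex.I * α * (2 * k) +
      Complex.I * δ := by
  have h := (((((hasDerivAt_id k).pow 3).const_mul (-Complex.I * β)).add
    (((hasDerivAt_id k).pow 2).const_mul (Complex.I * α))).add
    ((hasDerivAt_id k).const_mul (Complex.I * δ)))
  have h2 := h.deriv
  simp only [id, mul_one, Nat.cast_ofNat, Nat.add_one_sub_one, pow_one] at h2
  exact h2

theorem differentiable_deriv_omega (α β δ : ℝ) : Differentiable ℂ (deriv (omega α β δ)) := by
  rw [show deriv (omega α β δ) = fun k => -Complex.I * β * (3 * k ^ 2) + Complex.I * α * (2 * k) +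
      Complex.I * δ from funext (deriv_omega α β δ)]
  fun_prop

theorem norm_deriv_omega_le {α β δ : ℝ} (hβ : 0 < β) {k : ℂ} {r : ℝ} (hr : 1 ≤ r) (hk : ‖k‖ ≤ r) :
    ‖deriv (omega α β δ) k‖ ≤ (3 * β + 2 * |α| + |δ|) * r ^ 2 := by
  rw [deriv_omega]
  refine (norm_add_le _ _).trans ((add_le_add (norm_add_le _ _) le_rfl).trans ?_)
  simp only [norm_mul, norm_neg, Complex.norm_I, Complex.norm_real, norm_pow, one_mul,
    Real.norm_eq_abs, abs_of_pos hβ, Complex.norm_ofNat]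
  have h1 : ‖k‖ ^ 2 ≤ r ^ 2 := by gcongr
  have h2 : ‖k‖ ≤ r ^ 2 := hk.trans (by nlinarith)
  have h3 : 1 ≤ r ^ 2 := by nlinarith
  calc β * (3 * ‖k‖ ^ 2) + |α| * (2 * ‖k‖) + |δ| ≤
      β * (3 * r ^ 2) + |α| * (2 * r ^ 2) + |δ| * r ^ 2 := by
        gcongr
        exact le_mul_of_one_le_right (abs_nonneg _) h3
    _ = _ := by ring

theorem norm_omega_le {α β δ : ℝ} (hβ : 0 < β) {k : ℂ} {r : ℝ} (hr : 1 ≤ r) (hk : ‖k‖ ≤ r) :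
    ‖omega α β δ k‖ ≤ (β + |α| + |δ|) * r ^ 3 := by
  unfold omega
  refine (norm_add_le _ _).trans ((add_le_add (norm_add_le _ _) le_rfl).trans ?_)
  simp only [norm_mul, norm_neg, Complex.norm_I, Complex.norm_real, norm_pow, one_mul,
    Real.norm_eq_abs, abs_of_pos hβ]
  have h1 : ‖k‖ ^ 3 ≤ r ^ 3 := by gcongr
  have h2 : ‖k‖ ^ 2 ≤ r ^ 3 := by
    calc ‖k‖ ^ 2 ≤ r ^ 2 := by gcongr
      _ ≤ r ^ 3 := pow_le_pow_right₀ hr (by norm_num)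
  have h3 : ‖k‖ ≤ r ^ 3 := hk.trans (le_self_pow₀ hr (by norm_num))
  calc β * ‖k‖ ^ 3 + |α| * ‖k‖ ^ 2 + |δ| * ‖k‖ ≤
      β * r ^ 3 + |α| * r ^ 3 + |δ| * r ^ 3 := by gcongr
    _ = _ := by ring

theorem omega_re (α β δ : ℝ) (k : ℂ) :
    (omega α β δ k).re = k.im * (3 * β * k.re ^ 2 - β * k.im ^ 2 - 2 * α * k.re - δ) := by
  unfold omega
  simp [pow_succ, -mul_eq_mul_left_iff]
  ring

theorem omega_im (α β δ : ℝ) (k : ℂ) :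
    (omega α β δ k).im = -β * (k.re ^ 3 - 3 * k.re * k.im ^ 2) + α * (k.re ^ 2 - k.im ^ 2) +
      δ * k.re := by
  unfold omega
  simp [pow_succ, -mul_eq_mul_left_iff]
  ring

theorem omega_branch_re {α β δ : ℝ} (hβ : 0 < β) {σ : ℝ} (hσ : σ ^ 2 = 1) {m : ℝ}
    (h : 0 ≤ branchDisc α β δ m) : (omega α β δ (branch α β δ σ m)).re = 0 := by
  rw [omega_re, branch_im, branch_re]
  have hs := Real.sq_sqrt h
  set s := √(branchDisc α β δ m)
  have h1 : (σ * s) ^ 2 = 3 * β ^ 2 * m ^ 2 + α ^ 2 + 3 * β * δ := by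
    rw [mul_pow, hσ, hs, one_mul, branchDisc]
  have : 3 * β * ((α + σ * s) / (3 * β)) ^ 2 - β * m ^ 2 - 2 * α * ((α + σ * s) / (3 * β)) - δ =
      ((σ * s) ^ 2 - (3 * β ^ 2 * m ^ 2 + α ^ 2 + 3 * β * δ)) / (3 * β) := by
    field_simp
    ring
  rw [this, h1, sub_self]
  simp

/-- Between the branches `(3β Re k - α)²` is at most the radicand, which says that the second factor
of `Re ω` is nonpositive. On the segment the kernel of the time transform is therefore bounded by
`1`. -/
theorem omega_gammaMid_re_nonpos {α β δ : ℝ} (hβ : 0 < β) {h : ℝ} (h0 : 0 ≤ h)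
    (hd : 0 ≤ branchDisc α β δ h) {m : ℝ}
    (hm : m ∈ Ioo (branch α β δ (-1) h).re (branch α β δ 1 h).re) :
    (omega α β δ (gammaMid h m)).re ≤ 0 := by
  rw [omega_re]
  rw [branch_re, branch_re, mem_Ioo, div_lt_iff₀ (by positivity), lt_div_iff₀ (by positivity)] at hm
  have hs := Real.sq_sqrt hd
  set s := √(branchDisc α β δ h)
  have h1 : (3 * β * m - α) ^ 2 ≤ s ^ 2 := by
    exact sq_le_sq' (by linarith [hm.1]) (by linarith [hm.2])
  rw [hs, branchDisc] at h1
  simp only [gammaMid, Complex.add_im, Complex.ofReal_im, Complex.mul_im, Complex.I_re,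
    mul_zero, Complex.I_im, Complex.ofReal_re, one_mul, zero_add, Complex.add_re, Complex.mul_re,
    zero_mul, sub_self, add_zero]
  refine mul_nonpos_of_nonneg_of_nonpos h0 ?_
  have : 3 * β * (3 * β * m ^ 2 - β * h ^ 2 - 2 * α * m - δ) ≤ 0 := by nlinarith
  by_contra hcon
  push Not at hcon
  have : 0 < 3 * β * (3 * β * m ^ 2 - β * h ^ 2 - 2 * α * m - δ) := by positivity
  linarith

/-- The constant term in the values of `omega` on the branches. -/
noncomputable def omegaOffset (α β δ : ℝ) : ℝ := 2 * α ^ 3 / (27 * β ^ 2) + α * δ / (3 * β)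

/-- On the hyperbola `m²` is a function of the radicand. Eliminating it leaves, apart from a
constant, an odd cubic polynomial in `u = σ √(branchDisc α β δ m)`; in this form growth and
monotonicity of the frequency can be read off. -/
theorem omega_branch_im {α β δ : ℝ} (hβ : 0 < β) {σ : ℝ} (hσ : σ ^ 2 = 1) {m : ℝ}
    (h : 0 ≤ branchDisc α β δ m) :
    (omega α β δ (branch α β δ σ m)).im = omegaOffset α β δ +
      σ * (√(branchDisc α β δ m) * (8 * branchDisc α β δ m - 6 * (α ^ 2 + 3 * β * δ)) /
        (27 * β ^ 2)) := by
  rw [omega_im, branch_im, branch_re]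
  have hs := Real.sq_sqrt h
  set s := √(branchDisc α β δ m)
  have hm : m ^ 2 = (s ^ 2 - α ^ 2 - 3 * β * δ) / (3 * β ^ 2) := by
    rw [hs, branchDisc]; field_simp; ring
  rw [← hs, hm]
  have h3 : σ ^ 3 = σ := by rw [pow_succ, hσ, one_mul]
  unfold omegaOffset
  have e : ∀ u : ℝ, u ^ 2 = s ^ 2 →
      -β * (((α + u) / (3 * β)) ^ 3 - 3 * ((α + u) / (3 * β)) *
        ((s ^ 2 - α ^ 2 - 3 * β * δ) / (3 * β ^ 2))) +
        α * (((α + u) / (3 * β)) ^ 2 - (s ^ 2 - α ^ 2 - 3 * β * δ) / (3 * β ^ 2)) +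
        δ * ((α + u) / (3 * β)) =
      2 * α ^ 3 / (27 * β ^ 2) + α * δ / (3 * β) +
        u * (8 * s ^ 2 - 6 * (α ^ 2 + 3 * β * δ)) / (27 * β ^ 2) := by
    intro u hu
    rw [← hu]
    field_simp
    ring
  rw [e (σ * s) (by rw [mul_pow, hσ, one_mul])]
  ring

/-! ### Bounds above a large height -/

/-- A height above which `|γ(m)|` is comparable to `m` on the branches. -/
noncomputable def largeHeight (α β δ : ℝ) : ℝ := 1 + √|α ^ 2 + 3 * β * δ| / β

theorem one_le_largeHeight {β : ℝ} (α δ : ℝ) (hβ : 0 < β) : 1 ≤ largeHeight α β δ := by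
  unfold largeHeight
  have : 0 ≤ √|α ^ 2 + 3 * β * δ| / β := by positivity
  linarith

theorem abs_disc_le {α β δ : ℝ} (hβ : 0 < β) {m : ℝ} (hm : largeHeight α β δ ≤ m) :
    |α ^ 2 + 3 * β * δ| ≤ β ^ 2 * m ^ 2 := by
  have h1 : √|α ^ 2 + 3 * β * δ| / β ≤ m := by unfold largeHeight at hm; linarith
  rw [div_le_iff₀ hβ] at h1
  calc |α ^ 2 + 3 * β * δ| = √|α ^ 2 + 3 * β * δ| ^ 2 := (Real.sq_sqrt (abs_nonneg _)).symm
    _ ≤ (m * β) ^ 2 := by gcongr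
    _ = _ := by ring

theorem branchDisc_bounds {α β δ : ℝ} (hβ : 0 < β) {m : ℝ} (hm : largeHeight α β δ ≤ m) :
    2 * β ^ 2 * m ^ 2 ≤ branchDisc α β δ m ∧ branchDisc α β δ m ≤ 4 * β ^ 2 * m ^ 2 := by
  have := abs_le.mp (abs_disc_le hβ hm)
  unfold branchDisc
  constructor <;> nlinarith

theorem regularHeight_largeHeight {α β δ : ℝ} (hβ : 0 < β) :
    RegularHeight α β δ (largeHeight α β δ) := by
  refine ⟨by linarith [one_le_largeHeight α δ hβ], fun m hm => ?_⟩
  have := (branchDisc_bounds hβ hm).1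
  have : 0 < m := by linarith [one_le_largeHeight α δ hβ]
  have : 0 < 2 * β ^ 2 * m ^ 2 := by positivity
  linarith

theorem sqrt_branchDisc_bounds {α β δ : ℝ} (hβ : 0 < β) {m : ℝ} (hm : largeHeight α β δ ≤ m) :
    β * m ≤ √(branchDisc α β δ m) ∧ √(branchDisc α β δ m) ≤ 2 * β * m := by
  have h := branchDisc_bounds hβ hm
  have hm0 : 0 < m := by linarith [one_le_largeHeight α δ hβ]
  constructor
  · apply Real.le_sqrt_of_sq_le
    nlinarith [sq_nonneg (β * m)]
  · rw [Real.sqrt_le_left (by positivity)]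
    nlinarith

theorem norm_branchDeriv_le {α β δ : ℝ} (hβ : 0 < β) {σ : ℝ} (hσ : σ ^ 2 = 1) {m : ℝ}
    (hm : largeHeight α β δ ≤ m) : ‖branchDeriv α β δ σ m‖ ≤ 2 := by
  have h := sqrt_branchDisc_bounds hβ hm
  have hm0 : 0 < m := by linarith [one_le_largeHeight α δ hβ]
  have hσ' : |σ| = 1 := by rwa [← sq_eq_sq₀ (abs_nonneg _) zero_le_one, sq_abs, one_pow]
  unfold branchDeriv
  refine (norm_add_le _ _).trans ?_
  rw [Complex.norm_real, Complex.norm_I, Real.norm_eq_abs, abs_mul, hσ', one_mul, abs_of_nonneg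
    (by positivity)]
  have : β * m / √(branchDisc α β δ m) ≤ 1 := by
    rw [div_le_one (lt_of_lt_of_le (by positivity) h.1)]
    exact h.1
  linarith

theorem abs_branch_re_le {α β δ : ℝ} (hβ : 0 < β) {σ : ℝ} (hσ : σ ^ 2 = 1) {m : ℝ}
    (hm : largeHeight α β δ ≤ m) : |(branch α β δ σ m).re| ≤ (|α| / (3 * β) + 1) * m := by
  have h := sqrt_branchDisc_bounds hβ hm
  have hm1 : 1 ≤ m := (one_le_largeHeight α δ hβ).trans hm
  have hσ' : |σ| = 1 := by rwa [← sq_eq_sq₀ (abs_nonneg _) zero_le_one, sq_abs, one_pow]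
  rw [branch_re, abs_div, abs_of_pos (by positivity : 0 < 3 * β), div_le_iff₀ (by positivity)]
  refine (abs_add_le _ _).trans ?_
  rw [abs_mul, hσ', one_mul, abs_of_nonneg (Real.sqrt_nonneg _)]
  have e : (|α| / (3 * β) + 1) * m * (3 * β) = |α| * m + 3 * β * m := by field_simp
  rw [e]
  have : |α| ≤ |α| * m := le_mul_of_one_le_right (abs_nonneg _) hm1
  nlinarith

/-- A constant with `|γ(m)| ≤ branchConst * m` on the branches. -/
noncomputable def branchConst (α β : ℝ) : ℝ := |α| / (3 * β) + 2

theorem two_le_branchConst {β : ℝ} (α : ℝ) (hβ : 0 < β) : 2 ≤ branchConst α β := by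
  unfold branchConst
  have : 0 ≤ |α| / (3 * β) := by positivity
  linarith

theorem norm_branch_le {α β δ : ℝ} (hβ : 0 < β) {σ : ℝ} (hσ : σ ^ 2 = 1) {m : ℝ}
    (hm : largeHeight α β δ ≤ m) : ‖branch α β δ σ m‖ ≤ branchConst α β * m := by
  have hm1 : 1 ≤ m := (one_le_largeHeight α δ hβ).trans hm
  refine (Complex.norm_le_abs_re_add_abs_im _).trans ?_
  rw [branch_im, abs_of_pos (by linarith : 0 < m)]
  have := abs_branch_re_le hβ hσ hm
  unfold branchConst
  linarith

theorem norm_gammaMid_le {α β δ : ℝ} (hβ : 0 < β) {h : ℝ} (hh : largeHeight α β δ ≤ h) {m : ℝ}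
    (hm : m ∈ Ioo (branch α β δ (-1) h).re (branch α β δ 1 h).re) :
    |m| ≤ (|α| / (3 * β) + 1) * h ∧ ‖gammaMid h m‖ ≤ branchConst α β * h := by
  have h1 := abs_le.mp (abs_branch_re_le (σ := 1) hβ (by norm_num) hh)
  have h2 := abs_le.mp (abs_branch_re_le (σ := -1) hβ (by norm_num) hh)
  have h3 : |m| ≤ (|α| / (3 * β) + 1) * h := abs_le.mpr ⟨by linarith [hm.1], by linarith [hm.2]⟩
  have hh0 : 0 < h := by linarith [one_le_largeHeight α δ hβ]
  refine ⟨h3, (Complex.norm_le_abs_re_add_abs_im _).trans ?_⟩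
  simp only [gammaMid, Complex.add_re, Complex.ofReal_re, Complex.mul_re, Complex.I_re, zero_mul,
    Complex.I_im, Complex.ofReal_im, mul_zero, sub_self, add_zero, Complex.add_im, Complex.mul_im,
    one_mul, zero_add]
  rw [abs_of_pos hh0]
  unfold branchConst
  linarith

/-! ### The real frequency on the branches -/

/-- The value `τ` with `ω(γ(m)) = iτ(m)` on the branches. -/
noncomputable def branchFreq (α β δ σ m : ℝ) : ℝ := (omega α β δ (branch α β δ σ m)).im

/-- The derivative of `branchFreq`. -/
noncomputable def branchFreqDeriv (α β δ σ m : ℝ) : ℝ :=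
  (deriv (omega α β δ) (branch α β δ σ m) * branchDeriv α β δ σ m).im

theorem omega_branch {α β δ : ℝ} (hβ : 0 < β) {σ : ℝ} (hσ : σ ^ 2 = 1) {m : ℝ}
    (hm : largeHeight α β δ ≤ m) :
    omega α β δ (branch α β δ σ m) = Complex.I * branchFreq α β δ σ m := by
  apply Complex.ext
  · rw [omega_branch_re hβ hσ ((regularHeight_largeHeight hβ).2 m hm).le]
    simp
  · simp [branchFreq]

theorem hasDerivAt_omega_branch {α β δ : ℝ} (hβ : 0 < β) (σ : ℝ) {m : ℝ}
    (hm : largeHeight α β δ ≤ m) :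
    HasDerivAt (fun m => omega α β δ (branch α β δ σ m))
      (deriv (omega α β δ) (branch α β δ σ m) * branchDeriv α β δ σ m) m :=
  ((differentiable_omega α β δ) _).hasDerivAt.comp_of_eq m
    (hasDerivAt_branch hβ σ ((regularHeight_largeHeight hβ).2 m hm)) rfl

theorem hasDerivAt_branchFreq {α β δ : ℝ} (hβ : 0 < β) (σ : ℝ) {m : ℝ}
    (hm : largeHeight α β δ ≤ m) :
    HasDerivAt (branchFreq α β δ σ) (branchFreqDeriv α β δ σ m) m :=
  Complex.imCLM.hasFDerivAt.comp_hasDerivAt m (hasDerivAt_omega_branch hβ σ hm)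

/-- Since `ω` is purely imaginary along a branch, so is its derivative in the parameter. The
inequality is strict because the derivative is taken on both sides of `m`. -/
theorem deriv_omega_branch_mul {α β δ : ℝ} (hβ : 0 < β) {σ : ℝ} (hσ : σ ^ 2 = 1) {m : ℝ}
    (hm : largeHeight α β δ < m) :
    deriv (omega α β δ) (branch α β δ σ m) * branchDeriv α β δ σ m =
      Complex.I * branchFreqDeriv α β δ σ m := by
  have h1 := Complex.reCLM.hasFDerivAt.comp_hasDerivAt m (hasDerivAt_omega_branch hβ σ hm.le)
  have h2 : HasDerivAt (fun m => Complex.reCLM (omega α β δ (branch α β δ σ m))) 0 m := by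
    refine (hasDerivAt_const m (0 : ℝ)).congr_of_eventuallyEq ?_
    filter_upwards [lt_mem_nhds hm] with y hy
    exact omega_branch_re hβ hσ ((regularHeight_largeHeight hβ).2 y hy.le).le
  have h3 := h1.unique h2
  apply Complex.ext
  · simpa using h3
  · simp [branchFreqDeriv]

theorem abs_branchFreqDeriv_le {α β δ : ℝ} (hβ : 0 < β) {σ : ℝ} (hσ : σ ^ 2 = 1) {m : ℝ}
    (hm : largeHeight α β δ ≤ m) :
    |branchFreqDeriv α β δ σ m| ≤
      2 * ((3 * β + 2 * |α| + |δ|) * branchConst α β ^ 2) * m ^ 2 := by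
  have hm1 : 1 ≤ m := (one_le_largeHeight α δ hβ).trans hm
  have hb := two_le_branchConst α hβ
  refine (Complex.abs_im_le_norm _).trans ?_
  rw [norm_mul]
  calc _ ≤ ((3 * β + 2 * |α| + |δ|) * (branchConst α β * m) ^ 2) * 2 := by
        gcongr
        · exact norm_deriv_omega_le hβ (by nlinarith) (norm_branch_le hβ hσ hm)
        · exact norm_branchDeriv_le hβ hσ hm
    _ = _ := by ring

theorem branchFreq_eq {α β δ : ℝ} (hβ : 0 < β) {σ : ℝ} (hσ : σ ^ 2 = 1) {m : ℝ}
    (hm : largeHeight α β δ ≤ m) :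
    branchFreq α β δ σ m = omegaOffset α β δ +
      σ * (√(branchDisc α β δ m) * (8 * branchDisc α β δ m - 6 * (α ^ 2 + 3 * β * δ)) /
        (27 * β ^ 2)) :=
  omega_branch_im hβ hσ ((regularHeight_largeHeight hβ).2 m hm).le

theorem strictMonoOn_branchFreq {α β δ : ℝ} (hβ : 0 < β) {σ : ℝ} (hσ : σ ^ 2 = 1) :
    StrictMonoOn (fun m => σ * branchFreq α β δ σ m) (Ici (largeHeight α β δ)) := by
  intro m hm m' hm' hlt
  have hm : largeHeight α β δ ≤ m := hm
  have hm' : largeHeight α β δ ≤ m' := hm'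
  have hm1 : 1 ≤ m := (one_le_largeHeight α δ hβ).trans hm
  simp only
  rw [branchFreq_eq hβ hσ hm, branchFreq_eq hβ hσ hm']
  have e : ∀ y z : ℝ, σ * (y + σ * z) = σ * y + z := fun y z => by linear_combination z * hσ
  rw [e, e]
  have hd : branchDisc α β δ m < branchDisc α β δ m' := by
    unfold branchDisc
    have : m ^ 2 < m' ^ 2 := by nlinarith
    have : 3 * β ^ 2 * m ^ 2 < 3 * β ^ 2 * m' ^ 2 := by gcongr
    linarith
  have hd0 := (regularHeight_largeHeight hβ).2 m hm
  have h1 := (branchDisc_bounds hβ hm).1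
  have h2 := (abs_le.mp (abs_disc_le hβ hm)).2
  have h3 : 0 < 8 * branchDisc α β δ m - 6 * (α ^ 2 + 3 * β * δ) := by nlinarith
  have h4 : √(branchDisc α β δ m) < √(branchDisc α β δ m') := Real.sqrt_lt_sqrt hd0.le hd
  have h5 : 0 < √(branchDisc α β δ m) := Real.sqrt_pos.mpr hd0
  have : √(branchDisc α β δ m) * (8 * branchDisc α β δ m - 6 * (α ^ 2 + 3 * β * δ)) <
      √(branchDisc α β δ m') * (8 * branchDisc α β δ m' - 6 * (α ^ 2 + 3 * β * δ)) := by
    apply mul_lt_mul'' h4 (by linarith) h5.le h3.le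
  gcongr

/-- The frequency is genuinely cubic in `m`. This lower bound is what exchanges three powers of the
wave number for one power of the frequency. -/
theorem cube_le_branchFreq {α β δ : ℝ} (hβ : 0 < β) {σ : ℝ} (hσ : σ ^ 2 = 1) {m : ℝ}
    (hm : largeHeight α β δ ≤ m) :
    m ^ 3 ≤ (27 / β * (1 + |omegaOffset α β δ|)) * (1 + |branchFreq α β δ σ m|) := by
  have hm1 : 1 ≤ m := (one_le_largeHeight α δ hβ).trans hm
  have hσ' : |σ| = 1 := by rwa [← sq_eq_sq₀ (abs_nonneg _) zero_le_one, sq_abs, one_pow]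
  have h0 := sqrt_branchDisc_bounds hβ hm
  have h1 := (branchDisc_bounds hβ hm).1
  have h2 := (abs_le.mp (abs_disc_le hβ hm)).2
  have e := branchFreq_eq hβ hσ hm
  set X := √(branchDisc α β δ m) * (8 * branchDisc α β δ m - 6 * (α ^ 2 + 3 * β * δ)) /
        (27 * β ^ 2) with hX
  have hX1 : β * m ^ 3 / 27 ≤ X := by
    rw [hX, div_le_div_iff₀ (by norm_num) (by positivity)]
    have : β ^ 2 * m ^ 2 ≤ 8 * branchDisc α β δ m - 6 * (α ^ 2 + 3 * β * δ) := by nlinarith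
    have : (β * m) * (β ^ 2 * m ^ 2) ≤ √(branchDisc α β δ m) *
      (8 * branchDisc α β δ m - 6 * (α ^ 2 + 3 * β * δ)) := by
      gcongr
      exact h0.1
    nlinarith
  have hXle : X ≤ |branchFreq α β δ σ m| + |omegaOffset α β δ| := by
    have h3 : |σ * X| = |branchFreq α β δ σ m - omegaOffset α β δ| := by rw [e]; congr 1; ring
    rw [abs_mul, hσ', one_mul] at h3
    calc X ≤ |X| := le_abs_self _
      _ = _ := h3
      _ ≤ _ := abs_sub _ _
  have h4 : m ^ 3 = 27 / β * (β * m ^ 3 / 27) := by field_simp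
  rw [h4, mul_assoc (27 / β)]
  gcongr
  nlinarith [abs_nonneg (branchFreq α β δ σ m), abs_nonneg (omegaOffset α β δ)]

end FokasHalfLine

namespace FokasHalfLine
open scoped FourierTransform ComplexConjugate

/-! ### Superpositions of plane waves -/

/-- The superposition `∫ e^{iγx - Ωt} W dμ` of plane waves. -/
noncomputable def waveIntegral (μ : Measure ℝ) (γ Ω W : ℝ → ℂ) (x t : ℝ) : ℂ :=
  ∫ m, Complex.exp (Complex.I * γ m * x - Ω m * t) * W m ∂μ

/-- Wave numbers `γ` in the upper half-plane with frequencies `Ω` of at most cubic growth and of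
bounded real part. -/
structure WaveData (μ : Measure ℝ) (γ Ω : ℝ → ℂ) (B : ℝ) : Prop where
  measurable_wave : Measurable γ
  measurable_freq : Measurable Ω
  im_nonneg : ∀ᵐ m ∂μ, 0 ≤ (γ m).im
  re_freq : ∀ᵐ m ∂μ, |(Ω m).re| ≤ B
  cubic : ∃ C : ℝ, ∀ᵐ m ∂μ, ‖Ω m‖ ≤ C * (1 + ‖γ m‖) ^ 3

/-- Weights with all moments against `e^{-Im γ x}`, `x > 0`. -/
def WaveWeight (μ : Measure ℝ) (γ W : ℝ → ℂ) : Prop :=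
  AEStronglyMeasurable W μ ∧ ∀ x : ℝ, 0 < x → ∀ n : ℕ,
    Integrable (fun m => (1 + ‖γ m‖) ^ n * Real.exp (-(γ m).im * x) * ‖W m‖) μ

theorem WaveWeight.of_norm_le {μ : Measure ℝ} {γ W V : ℝ → ℂ} (hW : WaveWeight μ γ W)
    (hγ : Measurable γ) (hV : AEStronglyMeasurable V μ) {C : ℝ} {j : ℕ}
    (h : ∀ᵐ m ∂μ, ‖V m‖ ≤ C * (1 + ‖γ m‖) ^ j * ‖W m‖) : WaveWeight μ γ V := by
  refine ⟨hV, fun x hx n => ((hW.2 x hx (n + j)).const_mul C).mono' ?_ ?_⟩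
  · exact ((by fun_prop : Measurable fun m => (1 + ‖γ m‖) ^ n *
      Real.exp (-(γ m).im * x)).aestronglyMeasurable).mul hV.norm
  · filter_upwards [h] with m hm
    rw [Real.norm_of_nonneg (by positivity)]
    calc _ ≤ (1 + ‖γ m‖) ^ n * Real.exp (-(γ m).im * x) * (C * (1 + ‖γ m‖) ^ j * ‖W m‖) := by
          gcongr
      _ = _ := by ring

section

variable {μ : Measure ℝ} {γ Ω W : ℝ → ℂ} {B : ℝ}

theorem WaveWeight.wave_mul (hW : WaveWeight μ γ W) (hd : WaveData μ γ Ω B) :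
    WaveWeight μ γ (fun m => Complex.I * γ m * W m) := by
  refine hW.of_norm_le hd.measurable_wave
    ((hd.measurable_wave.const_mul _).aestronglyMeasurable.mul hW.1) (C := 1) (j := 1)
    (ae_of_all _ fun m => ?_)
  rw [norm_mul, norm_mul, Complex.norm_I]
  gcongr
  linarith

theorem WaveWeight.freq_mul (hW : WaveWeight μ γ W) (hd : WaveData μ γ Ω B) :
    WaveWeight μ γ (fun m => -Ω m * W m) := by
  obtain ⟨C, hC⟩ := hd.cubic
  refine hW.of_norm_le hd.measurable_wave
    (hd.measurable_freq.neg.aestronglyMeasurable.mul hW.1) (C := C) (j := 3) ?_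
  filter_upwards [hC] with m hm
  rw [norm_mul, norm_neg]
  gcongr

theorem norm_wave_le {γ Ω : ℂ} (hγ : 0 ≤ γ.im) (hΩ : |Ω.re| ≤ B) {x x' t t' : ℝ} (hx : x' ≤ x)
    (ht : |t| ≤ t') :
    ‖Complex.exp (Complex.I * γ * x - Ω * t)‖ ≤ Real.exp (B * t') * Real.exp (-γ.im * x') := by
  rw [Complex.norm_exp, ← Real.exp_add, Real.exp_le_exp]
  have h1 : (Complex.I * γ * x - Ω * t).re = -γ.im * x - Ω.re * t := by simp
  rw [h1]
  have h2 : -(Ω.re * t) ≤ |Ω.re| * |t| := by rw [← abs_mul]; exact neg_le_abs _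
  have h3 : |Ω.re| * |t| ≤ B * t' :=
    mul_le_mul hΩ ht (abs_nonneg _) ((abs_nonneg _).trans hΩ)
  have h4 : γ.im * x' ≤ γ.im * x := by gcongr
  linarith

theorem aestronglyMeasurable_wave (hd : WaveData μ γ Ω B) (hW : AEStronglyMeasurable W μ)
    (x t : ℝ) :
    AEStronglyMeasurable (fun m => Complex.exp (Complex.I * γ m * x - Ω m * t) * W m) μ := by
  have h1 := hd.measurable_wave
  have h2 := hd.measurable_freq
  exact ((by fun_prop : Measurable fun m =>
    Complex.exp (Complex.I * γ m * x - Ω m * t)).aestronglyMeasurable).mul hW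

theorem norm_wave_mul_le (hd : WaveData μ γ Ω B) (V : ℝ → ℂ) :
    ∀ᵐ m ∂μ, ∀ x x' t t' : ℝ, x' ≤ x → |t| ≤ t' →
      ‖Complex.exp (Complex.I * γ m * x - Ω m * t) * V m‖ ≤
        Real.exp (B * t') * ((1 + ‖γ m‖) ^ 0 * Real.exp (-(γ m).im * x') * ‖V m‖) := by
  filter_upwards [hd.im_nonneg, hd.re_freq] with m h1 h2 x x' t t' hx ht
  rw [norm_mul, pow_zero, one_mul, ← mul_assoc]
  gcongr
  exact norm_wave_le h1 h2 hx ht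

theorem integrable_wave (hd : WaveData μ γ Ω B) (hW : WaveWeight μ γ W) {x : ℝ} (hx : 0 < x)
    (t : ℝ) : Integrable (fun m => Complex.exp (Complex.I * γ m * x - Ω m * t) * W m) μ := by
  refine ((hW.2 x hx 0).const_mul (Real.exp (B * |t|))).mono'
    (aestronglyMeasurable_wave hd hW.1 x t) ?_
  filter_upwards [norm_wave_mul_le hd W] with m hm
  exact hm x x t |t| le_rfl le_rfl

/-- Near `x` the factor `e^{-Im γ y}` is dominated by `e^{-Im γ x/2}`, against which the weight
still has all moments. -/
theorem hasDerivAt_waveIntegral_space (hd : WaveData μ γ Ω B) (hW : WaveWeight μ γ W) {x : ℝ}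
    (hx : 0 < x) (t : ℝ) :
    HasDerivAt (fun x => waveIntegral μ γ Ω W x t)
      (waveIntegral μ γ Ω (fun m => Complex.I * γ m * W m) x t) x := by
  refine (hasDerivAt_integral_of_dominated_loc_of_deriv_le
    (F := fun (x : ℝ) m => Complex.exp (Complex.I * γ m * x - Ω m * t) * W m)
    (F' := fun (x : ℝ) m =>
      Complex.exp (Complex.I * γ m * x - Ω m * t) * (Complex.I * γ m * W m))
    (bound := fun m => Real.exp (B * |t|) * ((1 + ‖γ m‖) ^ 0 * Real.exp (-(γ m).im * (x / 2)) *
      ‖Complex.I * γ m * W m‖)) (s := Ioi (x / 2))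
    (Ioi_mem_nhds (by linarith)) ?_ ?_ ?_ ?_ ?_ ?_).2
  · exact Eventually.of_forall fun y => aestronglyMeasurable_wave hd hW.1 y t
  · exact integrable_wave hd hW hx t
  · exact aestronglyMeasurable_wave hd (hW.wave_mul hd).1 x t
  · filter_upwards [norm_wave_mul_le hd (fun m => Complex.I * γ m * W m)] with m hm y hy
    exact hm y (x / 2) t |t| (le_of_lt hy) le_rfl
  · exact ((hW.wave_mul hd).2 (x / 2) (by linarith) 0).const_mul _
  · refine ae_of_all _ fun m y _ => ?_
    have h1 : HasDerivAt (fun y : ℝ => Complex.I * γ m * (y : ℂ) - Ω m * t)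
        (Complex.I * γ m * 1) y :=
      ((Complex.ofRealCLM.hasDerivAt (x := y)).const_mul _).sub_const _
    refine (h1.cexp.mul_const (W m)).congr_deriv ?_
    ring

theorem hasDerivAt_waveIntegral_time (hd : WaveData μ γ Ω B) (hW : WaveWeight μ γ W) {x : ℝ}
    (hx : 0 < x) (t : ℝ) :
    HasDerivAt (fun t => waveIntegral μ γ Ω W x t)
      (waveIntegral μ γ Ω (fun m => -Ω m * W m) x t) t := by
  refine (hasDerivAt_integral_of_dominated_loc_of_deriv_le
    (F := fun (t : ℝ) m => Complex.exp (Complex.I * γ m * x - Ω m * t) * W m)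
    (F' := fun (t : ℝ) m =>
      Complex.exp (Complex.I * γ m * x - Ω m * t) * (-Ω m * W m))
    (bound := fun m => Real.exp (B * (|t| + 1)) * ((1 + ‖γ m‖) ^ 0 * Real.exp (-(γ m).im * x) *
      ‖-Ω m * W m‖)) (s := Metric.ball t 1)
    (Metric.ball_mem_nhds t one_pos) ?_ ?_ ?_ ?_ ?_ ?_).2
  · exact Eventually.of_forall fun y => aestronglyMeasurable_wave hd hW.1 x y
  · exact integrable_wave hd hW hx t
  · exact aestronglyMeasurable_wave hd (hW.freq_mul hd).1 x t
  · filter_upwards [norm_wave_mul_le hd (fun m => -Ω m * W m)] with m hm y hy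
    refine hm x x y (|t| + 1) le_rfl ?_
    rw [Metric.mem_ball, Real.dist_eq] at hy
    linarith [abs_sub_abs_le_abs_sub y t]
  · exact ((hW.freq_mul hd).2 x hx 0).const_mul _
  · refine ae_of_all _ fun m y _ => ?_
    have h1 : HasDerivAt (fun y : ℝ => Complex.I * γ m * x - Ω m * (y : ℂ))
        (-(Ω m * 1)) y :=
      ((Complex.ofRealCLM.hasDerivAt (x := y)).const_mul _).const_sub _
    refine (h1.cexp.mul_const (W m)).congr_deriv ?_
    ring

theorem continuousOn_waveIntegral (hd : WaveData μ γ Ω B) (hW : WaveWeight μ γ W) :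
    ContinuousOn (fun p : ℝ × ℝ => waveIntegral μ γ Ω W p.1 p.2) (Ioi 0 ×ˢ univ) := by
  rintro ⟨x, t⟩ ⟨hx, -⟩
  have hx' : (0 : ℝ) < x := hx
  refine ContinuousAt.continuousWithinAt ?_
  refine continuousAt_of_dominated (bound := fun m => Real.exp (B * (|t| + 1)) *
    ((1 + ‖γ m‖) ^ 0 * Real.exp (-(γ m).im * (x / 2)) * ‖W m‖)) ?_ ?_ ?_ ?_
  · exact Eventually.of_forall fun p => aestronglyMeasurable_wave hd hW.1 p.1 p.2
  · have hn : Ioi (x / 2) ×ˢ Metric.ball t 1 ∈ 𝓝 (x, t) :=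
      prod_mem_nhds (Ioi_mem_nhds (by linarith)) (Metric.ball_mem_nhds t one_pos)
    filter_upwards [hn] with p hp
    filter_upwards [norm_wave_mul_le hd W] with m hm
    refine hm p.1 (x / 2) p.2 (|t| + 1) (le_of_lt hp.1) ?_
    have := hp.2
    rw [Metric.mem_ball, Real.dist_eq] at this
    linarith [abs_sub_abs_le_abs_sub p.2 t]
  · exact (hW.2 (x / 2) (by linarith) 0).const_mul _
  · exact ae_of_all _ fun m => by fun_prop

end

/-- A function on the half-line with successive derivatives `f 1, f 2, …` is smooth there. -/
theorem contDiffOn_of_hasDerivAt_succ {f : ℕ → ℝ → ℂ}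
    (h : ∀ n, ∀ x ∈ Ioi (0 : ℝ), HasDerivAt (f n) (f (n + 1) x) x) (j : ℕ) :
    (∀ n, ContDiffOn ℝ j (f n) (Ioi 0)) ∧
      ∀ x ∈ Ioi (0 : ℝ), iteratedDeriv j (f 0) x = f j x := by
  constructor
  · induction j with
    | zero =>
      intro n
      exact contDiffOn_zero.mpr fun x hx => (h n x hx).continuousAt.continuousWithinAt
    | succ j ih =>
      intro n
      rw [Nat.cast_add, Nat.cast_one, contDiffOn_succ_iff_deriv_of_isOpen isOpen_Ioi]
      refine ⟨fun x hx => (h n x hx).differentiableAt.differentiableWithinAt, by simp, ?_⟩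
      exact (ih (n + 1)).congr fun x hx => (h n x hx).deriv
  · induction j with
    | zero => intro x _; simp
    | succ j ih =>
      intro x hx
      rw [iteratedDeriv_succ]
      have : iteratedDeriv j (f 0) =ᶠ[𝓝 x] f j := by
        filter_upwards [isOpen_Ioi.mem_nhds hx] with y hy using ih y hy
      rw [this.deriv_eq, (h j x hx).deriv]

/-! ### The time transform -/

theorem norm_timeTransform_le {g : ℝ → ℂ} {T : ℝ} (hT : 0 ≤ T)
    (hg : IntervalIntegrable g volume 0 T) {κ : ℂ} (hκ : κ.re ≤ 0) :
    ‖timeTransform g κ T‖ ≤ ∫ t in (0 : ℝ)..T, ‖g t‖ := by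
  refine intervalIntegral.norm_integral_le_of_norm_le hT ?_ hg.norm
  refine ae_of_all _ fun t ht => ?_
  rw [norm_mul, Complex.norm_exp]
  refine mul_le_of_le_one_left (norm_nonneg _) ?_
  rw [Real.exp_le_one_iff]
  have : (κ * t).re = κ.re * t := by simp
  rw [this]
  exact mul_nonpos_of_nonpos_of_nonneg hκ ht.1.le

theorem differentiable_timeTransform {g : ℝ → ℂ} {T : ℝ}
    (hg : IntervalIntegrable g volume 0 T) : Differentiable ℂ fun κ => timeTransform g κ T := by
  intro κ₀
  refine HasDerivAt.differentiableAt (intervalIntegral.hasDerivAt_integral_of_dominated_loc_of_deriv_le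
    (F := fun (κ : ℂ) (t : ℝ) => Complex.exp (κ * t) * g t)
    (F' := fun (κ : ℂ) (t : ℝ) => Complex.exp (κ * t) * (t * g t))
    (bound := fun t => Real.exp ((‖κ₀‖ + 1) * |T|) * (|T| * ‖g t‖))
    (s := Metric.ball κ₀ 1) (Metric.ball_mem_nhds κ₀ one_pos) ?_ ?_ ?_ ?_ ?_ ?_).2
  · exact Eventually.of_forall fun κ => (by fun_prop : Continuous fun t : ℝ =>
      Complex.exp (κ * t)).aestronglyMeasurable.mul (intervalIntegrable_iff.mp hg).aestronglyMeasurable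
  · exact hg.continuousOn_mul (by fun_prop)
  · exact (by fun_prop : Continuous fun t : ℝ =>
      Complex.exp (κ₀ * t)).aestronglyMeasurable.mul ((by fun_prop : Continuous fun t : ℝ =>
      (t : ℂ)).aestronglyMeasurable.mul (intervalIntegrable_iff.mp hg).aestronglyMeasurable)
  · refine ae_of_all _ fun t ht κ hκ => ?_
    have htT : |t| ≤ |T| := by
      have := abs_sub_left_of_mem_uIcc (uIoc_subset_uIcc ht)
      simpa using this
    rw [norm_mul, norm_mul, Complex.norm_exp, Complex.norm_real, Real.norm_eq_abs]
    gcongr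
    refine (Complex.re_le_norm _).trans ?_
    rw [norm_mul, Complex.norm_real, Real.norm_eq_abs]
    gcongr
    rw [Metric.mem_ball, dist_eq_norm] at hκ
    linarith [norm_sub_norm_le κ κ₀]
  · exact (hg.norm.const_mul _).const_mul _
  · refine ae_of_all _ fun t _ κ _ => ?_
    have h1 : HasDerivAt (fun κ : ℂ => κ * (t : ℂ)) (t : ℂ) κ := by
      simpa using (hasDerivAt_id κ).mul_const (t : ℂ)
    refine (h1.cexp.mul_const (g t)).congr_deriv ?_
    ring

/-! ### The integrals over the pieces of the contour -/

section

variable {α β δ : ℝ} {T : ℝ} {g : ℝ → ℂ}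

/-- The weight of the plane waves on a branch. -/
noncomputable def branchWeight (α β δ σ T : ℝ) (g : ℝ → ℂ) (m : ℝ) : ℂ :=
  deriv (omega α β δ) (branch α β δ σ m) * timeTransform g (omega α β δ (branch α β δ σ m)) T *
    branchDeriv α β δ σ m

/-- The weight of the plane waves on the horizontal part. -/
noncomputable def midWeight (α β δ h T : ℝ) (g : ℝ → ℂ) (m : ℝ) : ℂ :=
  deriv (omega α β δ) (gammaMid h m) * timeTransform g (omega α β δ (gammaMid h m)) T

theorem continuous_deriv_omega_mul_timeTransform (hg : IntervalIntegrable g volume 0 T) :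
    Continuous fun k => deriv (omega α β δ) k * timeTransform g (omega α β δ k) T :=
  (differentiable_deriv_omega α β δ).continuous.mul
    ((differentiable_timeTransform hg).continuous.comp (differentiable_omega α β δ).continuous)

theorem waveData_branch (hβ : 0 < β) {σ : ℝ} (hσ : σ ^ 2 = 1) {M : ℝ} (hM : largeHeight α β δ ≤ M) :
    WaveData (volume.restrict (Ioi M)) (branch α β δ σ)
      (fun m => omega α β δ (branch α β δ σ m)) 0 where
  measurable_wave := (continuous_branch α β δ σ).measurable
  measurable_freq :=
    ((differentiable_omega α β δ).continuous.comp (continuous_branch α β δ σ)).measurable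
  im_nonneg := (ae_restrict_iff' measurableSet_Ioi).mpr (ae_of_all _ fun m hm => by
    rw [branch_im]
    have : M < m := hm
    linarith [one_le_largeHeight α δ hβ])
  re_freq := (ae_restrict_iff' measurableSet_Ioi).mpr (ae_of_all _ fun m hm => by
    rw [omega_branch_re hβ hσ ((regularHeight_largeHeight hβ).2 m (hM.trans (le_of_lt hm))).le,
      abs_zero])
  cubic := ⟨β + |α| + |δ|, ae_of_all _ fun m => by
    have := norm_nonneg (branch α β δ σ m)
    exact norm_omega_le hβ (by linarith) (by linarith)⟩

theorem norm_branchWeight_le (hβ : 0 < β) (hT : 0 ≤ T) (hg : IntervalIntegrable g volume 0 T)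
    {σ : ℝ} (hσ : σ ^ 2 = 1) {m : ℝ} (hm : largeHeight α β δ ≤ m) :
    ‖branchWeight α β δ σ T g m‖ ≤ 2 * ((3 * β + 2 * |α| + |δ|) * branchConst α β ^ 2) *
      (∫ t in (0 : ℝ)..T, ‖g t‖) * m ^ 2 := by
  have hm1 : 1 ≤ m := (one_le_largeHeight α δ hβ).trans hm
  have hb := two_le_branchConst α hβ
  unfold branchWeight
  rw [norm_mul, norm_mul]
  calc _ ≤ ((3 * β + 2 * |α| + |δ|) * (branchConst α β * m) ^ 2) *
        (∫ t in (0 : ℝ)..T, ‖g t‖) * 2 := by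
        gcongr
        · exact mul_nonneg (by positivity)
            (intervalIntegral.integral_nonneg hT fun _ _ => norm_nonneg _)
        · exact norm_deriv_omega_le hβ (by nlinarith) (norm_branch_le hβ hσ hm)
        · exact norm_timeTransform_le hT hg (omega_branch_re hβ hσ
            ((regularHeight_largeHeight hβ).2 m hm).le).le
        · exact norm_branchDeriv_le hβ hσ hm
    _ = _ := by ring

theorem aestronglyMeasurable_branchWeight (hg : IntervalIntegrable g volume 0 T) (σ : ℝ)
    (μ : Measure ℝ) : AEStronglyMeasurable (branchWeight α β δ σ T g) μ := by
  have h1 : Measurable fun m => deriv (omega α β δ) (branch α β δ σ m) *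
      timeTransform g (omega α β δ (branch α β δ σ m)) T :=
    ((continuous_deriv_omega_mul_timeTransform hg).comp (continuous_branch α β δ σ)).measurable
  exact (h1.mul (measurable_branchDeriv α β δ σ)).aestronglyMeasurable

theorem waveWeight_branch (hβ : 0 < β) (hT : 0 ≤ T) (hg : IntervalIntegrable g volume 0 T)
    {σ : ℝ} (hσ : σ ^ 2 = 1) {M : ℝ} (hM : largeHeight α β δ ≤ M) :
    WaveWeight (volume.restrict (Ioi M)) (branch α β δ σ) (branchWeight α β δ σ T g) := by
  have hmeas := aestronglyMeasurable_branchWeight (α := α) (β := β) (δ := δ) hg σ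
    (volume.restrict (Ioi M))
  have hM1 : 1 ≤ M := (one_le_largeHeight α δ hβ).trans hM
  refine ⟨hmeas, fun x hx n => ?_⟩
  set L := 2 * ((3 * β + 2 * |α| + |δ|) * branchConst α β ^ 2) * (∫ t in (0 : ℝ)..T, ‖g t‖) with hL
  have h0 : IntegrableOn (fun m : ℝ => m ^ ((n + 2 : ℕ) : ℝ) * Real.exp (-x * m)) (Ioi 0) := by
    have := integrableOn_rpow_mul_exp_neg_mul_rpow (p := 1) (s := ((n + 2 : ℕ) : ℝ)) (b := x)
      (by push_cast; linarith [Nat.cast_nonneg (α := ℝ) n]) one_pos hx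
    simpa using this
  have h1 : IntegrableOn (fun m : ℝ => ((1 + branchConst α β) ^ n * L) *
      (m ^ ((n + 2 : ℕ) : ℝ) * Real.exp (-x * m))) (Ioi M) :=
    (h0.mono_set (Ioi_subset_Ioi (by linarith))).const_mul _
  refine h1.mono' ?_ ?_
  · have := continuous_branch α β δ σ
    exact ((by fun_prop : Continuous fun m => (1 + ‖branch α β δ σ m‖) ^ n *
      Real.exp (-(branch α β δ σ m).im * x)).aestronglyMeasurable).mul hmeas.norm
  · refine (ae_restrict_iff' measurableSet_Ioi).mpr (ae_of_all _ fun m hm => ?_)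
    have hm' : largeHeight α β δ ≤ m := hM.trans (le_of_lt hm)
    have hm1 : 1 ≤ m := (one_le_largeHeight α δ hβ).trans hm'
    have hb := two_le_branchConst α hβ
    rw [Real.norm_of_nonneg (by positivity), branch_im, Real.rpow_natCast]
    calc _ ≤ ((1 + branchConst α β) * m) ^ n * Real.exp (-m * x) * (L * m ^ 2) := by
          gcongr
          · linarith [norm_branch_le (δ := δ) hβ hσ hm']
          · exact norm_branchWeight_le hβ hT hg hσ hm'
      _ = _ := by
          rw [mul_pow, show -m * x = -x * m by ring]
          ring

theorem waveData_mid (hβ : 0 < β) {h : ℝ} (hh : largeHeight α β δ ≤ h) :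
    WaveData (volume.restrict (Ioo (branch α β δ (-1) h).re (branch α β δ 1 h).re)) (gammaMid h)
      (fun m => omega α β δ (gammaMid h m))
      ((β + |α| + |δ|) * (branchConst α β * h) ^ 3) where
  measurable_wave := (continuous_gammaMid h).measurable
  measurable_freq :=
    ((differentiable_omega α β δ).continuous.comp (continuous_gammaMid h)).measurable
  im_nonneg := ae_of_all _ fun m => by
    have := one_le_largeHeight α δ hβ
    simp only [gammaMid, Complex.add_im, Complex.ofReal_im, Complex.mul_im, Complex.I_re,
      mul_zero, Complex.I_im, Complex.ofReal_re, one_mul, zero_add]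
    linarith
  re_freq := (ae_restrict_iff' measurableSet_Ioo).mpr (ae_of_all _ fun m hm => by
    refine (Complex.abs_re_le_norm _).trans (norm_omega_le hβ ?_ (norm_gammaMid_le hβ hh hm).2)
    nlinarith [one_le_largeHeight α δ hβ, two_le_branchConst α hβ])
  cubic := ⟨β + |α| + |δ|, ae_of_all _ fun m => by
    have := norm_nonneg (gammaMid h m)
    exact norm_omega_le hβ (by linarith) (by linarith)⟩

theorem continuous_midWeight (hg : IntervalIntegrable g volume 0 T) (h : ℝ) :
    Continuous (midWeight α β δ h T g) :=
  (continuous_deriv_omega_mul_timeTransform hg).comp (continuous_gammaMid h)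

theorem waveWeight_mid (hg : IntervalIntegrable g volume 0 T) (h a b : ℝ) :
    WaveWeight (volume.restrict (Ioo a b)) (gammaMid h) (midWeight α β δ h T g) := by
  have hW := continuous_midWeight (α := α) (β := β) (δ := δ) hg h
  have hγ := continuous_gammaMid h
  refine ⟨hW.aestronglyMeasurable, fun x _ n => ?_⟩
  have : Continuous fun m => (1 + ‖gammaMid h m‖) ^ n * Real.exp (-(gammaMid h m).im * x) *
      ‖midWeight α β δ h T g m‖ := by fun_prop
  exact (this.continuousOn.integrableOn_compact isCompact_Icc).mono_set Ioo_subset_Icc_self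

/-- The part of the solution coming from a branch above height `h`. -/
noncomputable def branchPart (α β δ σ h T : ℝ) (g : ℝ → ℂ) : ℝ → ℝ → ℂ :=
  waveIntegral (volume.restrict (Ioi h)) (branch α β δ σ)
    (fun m => omega α β δ (branch α β δ σ m)) (branchWeight α β δ σ T g)

/-- The part of the solution coming from the horizontal segment at height `h`. -/
noncomputable def midPart (α β δ h T : ℝ) (g : ℝ → ℂ) : ℝ → ℝ → ℂ :=
  waveIntegral (volume.restrict (Ioo (branch α β δ (-1) h).re (branch α β δ 1 h).re)) (gammaMid h)
    (fun m => omega α β δ (gammaMid h m)) (midWeight α β δ h T g)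

theorem fokasSolution_eq_parts (hβ : 0 < β) {h : ℝ} (H : RegularHeight α β δ h) (x t : ℝ) :
    fokasSolution α β δ h T g x t = -(Complex.I / (2 * Real.pi)) *
      (-branchPart α β δ (-1) h T g x t + midPart α β δ h T g x t +
        branchPart α β δ 1 h T g x t) := by
  unfold fokasSolution branchPart midPart waveIntegral branchWeight midWeight
  rw [contourIntegral_eq hβ H]
  simp only [mul_assoc]

theorem differentiable_fokas_integrand (hg : IntervalIntegrable g volume 0 T) (x t : ℝ) :
    Differentiable ℂ fun k => Complex.exp (Complex.I * k * x - omega α β δ k * t) *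
      deriv (omega α β δ) k * timeTransform g (omega α β δ k) T := by
  have h1 := differentiable_omega α β δ
  have h2 := differentiable_deriv_omega α β δ
  have h3 := (differentiable_timeTransform hg).comp h1
  exact ((by fun_prop : Differentiable ℂ fun k =>
    Complex.exp (Complex.I * k * x - omega α β δ k * t)).mul h2).mul h3

/-- Above `largeHeight` the integrand on the branches is at most a polynomial times `e^{-mx}`, and
`x > 0` makes it integrable, as moving the contour requires. -/
theorem contourIntegral_fokas_eq_of_le (hβ : 0 < β) (hT : 0 ≤ T)
    (hg : IntervalIntegrable g volume 0 T) {h M : ℝ} (H : RegularHeight α β δ h) (hM : h ≤ M)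
    (hM' : largeHeight α β δ ≤ M) {x : ℝ} (hx : 0 < x) (t : ℝ) :
    fokasSolution α β δ h T g x t = fokasSolution α β δ M T g x t := by
  unfold fokasSolution
  congr 1
  refine contourIntegral_eq_of_le hβ H hM (differentiable_fokas_integrand hg x t) fun σ hσ => ?_
  have := integrable_wave (waveData_branch hβ hσ hM') (waveWeight_branch hβ hT hg hσ hM') hx t
  refine this.congr (ae_of_all _ fun m => ?_)
  simp only [branchWeight]
  ring

/-- The solution does not depend on the height of the horizontal part of the contour. -/
theorem fokasSolution_eq_largeHeight (hβ : 0 < β) (hT : 0 ≤ T)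
    (hg : IntervalIntegrable g volume 0 T) {h : ℝ} (H : RegularHeight α β δ h) {x : ℝ} (hx : 0 < x)
    (t : ℝ) :
    fokasSolution α β δ h T g x t = fokasSolution α β δ (largeHeight α β δ) T g x t := by
  -- The height `h` may lie on either side of `largeHeight`, so both are compared with their
  -- maximum.
  rw [contourIntegral_fokas_eq_of_le hβ hT hg H (le_max_left h (largeHeight α β δ))
    (le_max_right _ _) hx t, contourIntegral_fokas_eq_of_le hβ hT hg (regularHeight_largeHeight hβ)
    (le_max_right h _) (le_max_right _ _) hx t]

/-! ### The initial condition -/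

/-- At `t = 0` there is no factor `e^{-ωt}`, and `Re ω ≤ 0` on and between the branches keeps the
time transform bounded. The value does not change when the contour is raised to height `M`; there
the segment contributes `O(M³ e^{-xM})` and the branches contribute tails of convergent integrals.
-/
theorem fokasSolution_initial (hβ : 0 < β) (hT : 0 ≤ T) (hg : IntervalIntegrable g volume 0 T)
    {x : ℝ} (hx : 0 < x) : fokasSolution α β δ (largeHeight α β δ) T g x 0 = 0 := by
  set h₀ := largeHeight α β δ with hh₀
  have hreg : RegularHeight α β δ h₀ := regularHeight_largeHeight hβ
  have hbr : ∀ σ : ℝ, σ ^ 2 = 1 →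
      Tendsto (fun M => branchPart α β δ σ M T g x 0) atTop (𝓝 0) := by
    intro σ hσ
    have hi := integrable_wave
      (waveData_branch (α := α) (δ := δ) (M := h₀) hβ hσ hh₀.ge)
      (waveWeight_branch (α := α) (δ := δ) (M := h₀) hβ hT hg hσ hh₀.ge) hx 0
    have h1 := tendsto_setIntegral_of_antitone (fun _ => measurableSet_Ioi)
      (fun a b hab => Ioi_subset_Ioi hab) ⟨h₀, hi⟩
    have h2 : ⋂ M : ℝ, Ioi M = (∅ : Set ℝ) := by
      ext y
      simp only [mem_iInter, mem_Ioi, mem_empty_iff_false, iff_false, not_forall, not_lt]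
      exact ⟨y, le_rfl⟩
    rw [h2, setIntegral_empty] at h1
    exact h1
  have hmid : Tendsto (fun M => midPart α β δ M T g x 0) atTop (𝓝 0) := by
    set K := branchConst α β
    set J := ∫ t in (0 : ℝ)..T, ‖g t‖ with hJ
    set L := (3 * β + 2 * |α| + |δ|) * K ^ 2 * J * (2 * K) with hL
    have h1 : Tendsto (fun M : ℝ => L * (M ^ (3 : ℝ) * Real.exp (-x * M))) atTop (𝓝 0) := by
      simpa using (tendsto_rpow_mul_exp_neg_mul_atTop_nhds_zero 3 x hx).const_mul L
    refine squeeze_zero_norm' ?_ h1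
    filter_upwards [eventually_ge_atTop h₀] with M hM
    have hM1 : 1 ≤ M := (one_le_largeHeight α δ hβ).trans hM
    have hK : 2 ≤ K := two_le_branchConst α hβ
    have hle := branch_left_re_le α β δ hβ M
    have hJ0 : 0 ≤ J := intervalIntegral.integral_nonneg hT fun _ _ => norm_nonneg _
    have hb := norm_setIntegral_le_of_norm_le_const (μ := volume)
      (s := Ioo (branch α β δ (-1) M).re (branch α β δ 1 M).re)
      (f := fun m => Complex.exp (Complex.I * gammaMid M m * x -
        omega α β δ (gammaMid M m) * (0 : ℝ)) * midWeight α β δ M T g m)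
      (C := Real.exp (-x * M) * ((3 * β + 2 * |α| + |δ|) * (K * M) ^ 2 * J))
      (by rw [Real.volume_Ioo]; exact ENNReal.ofReal_lt_top) (fun m hm => by
        have hnm := (norm_gammaMid_le hβ hM hm).2
        unfold midWeight
        rw [norm_mul, norm_mul, Complex.norm_exp]
        have e : (Complex.I * gammaMid M m * x - omega α β δ (gammaMid M m) * (0 : ℝ)).re =
            -x * M := by
          simp [gammaMid]; ring
        rw [e]
        gcongr
        · exact norm_deriv_omega_le hβ (by nlinarith) hnm
        · exact norm_timeTransform_le hT hg (omega_gammaMid_re_nonpos hβ (by linarith)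
            (hreg.2 M hM).le hm))
    refine hb.trans ?_
    rw [Measure.real, Real.volume_Ioo, ENNReal.toReal_ofReal (by linarith)]
    have hlen : (branch α β δ 1 M).re - (branch α β δ (-1) M).re ≤ 2 * K * M := by
      have a1 := abs_le.mp (abs_branch_re_le (σ := 1) hβ (by norm_num) hM)
      have a2 := abs_le.mp (abs_branch_re_le (σ := -1) hβ (by norm_num) hM)
      have : K = |α| / (3 * β) + 2 := rfl
      rw [this]
      linarith
    calc _ ≤ Real.exp (-x * M) * ((3 * β + 2 * |α| + |δ|) * (K * M) ^ 2 * J) * (2 * K * M) := by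
          gcongr
      _ = _ := by
          rw [hL, show (3 : ℝ) = ((3 : ℕ) : ℝ) by norm_num, Real.rpow_natCast]
          ring
  have hlim : Tendsto (fun M => fokasSolution α β δ M T g x 0) atTop
      (𝓝 (-(Complex.I / (2 * Real.pi)) * (-0 + 0 + 0))) := by
    refine Tendsto.congr' ?_
      ((((hbr (-1) (by norm_num)).neg.add hmid).add (hbr 1 (by norm_num))).const_mul
        (-(Complex.I / (2 * Real.pi))))
    filter_upwards [eventually_ge_atTop h₀] with M hM
    exact (fokasSolution_eq_parts hβ (hreg.mono hM) x 0).symm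
  have hconst : Tendsto (fun M => fokasSolution α β δ M T g x 0) atTop
      (𝓝 (fokasSolution α β δ h₀ T g x 0)) := by
    refine tendsto_const_nhds.congr' ?_
    filter_upwards [eventually_ge_atTop h₀] with M hM
    exact contourIntegral_fokas_eq_of_le hβ hT hg hreg hM hM hx 0
  simpa using tendsto_nhds_unique hconst hlim

end

end FokasHalfLine

namespace FokasHalfLine
open scoped FourierTransform ComplexConjugate

/-! ### The differential equation -/

/-- A function `f 0` on the quarter plane with spatial derivatives `f 1, f 2, …` which satisfies
the equation. -/
structure IsWaveFamily (α β δ : ℝ) (f : ℕ → ℝ → ℝ → ℂ) : Prop where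
  space : ∀ n, ∀ x : ℝ, 0 < x → ∀ t, HasDerivAt (fun x => f n x t) (f (n + 1) x t) x
  time : ∀ x : ℝ, 0 < x → ∀ t,
    HasDerivAt (fun t => f 0 x t) (-β * f 3 x t + Complex.I * α * f 2 x t - δ * f 1 x t) t
  continuousOn : ContinuousOn (fun p : ℝ × ℝ => f 0 p.1 p.2) (Ioi 0 ×ˢ univ)

section

variable {α β δ : ℝ} {f g : ℕ → ℝ → ℝ → ℂ}

theorem IsWaveFamily.add (hf : IsWaveFamily α β δ f) (hg : IsWaveFamily α β δ g) :
    IsWaveFamily α β δ (fun n x t => f n x t + g n x t) where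
  space n x hx t := (hf.space n x hx t).add (hg.space n x hx t)
  time x hx t := ((hf.time x hx t).add (hg.time x hx t)).congr_deriv (by ring)
  continuousOn := hf.continuousOn.add hg.continuousOn

theorem IsWaveFamily.const_mul (c : ℂ) (hf : IsWaveFamily α β δ f) :
    IsWaveFamily α β δ (fun n x t => c * f n x t) where
  space n x hx t := (hf.space n x hx t).const_mul c
  time x hx t := ((hf.time x hx t).const_mul c).congr_deriv (by ring)
  continuousOn := continuousOn_const.mul hf.continuousOn

theorem WaveWeight.wave_pow_mul {μ : Measure ℝ} {γ Ω W : ℝ → ℂ} {B : ℝ} (hW : WaveWeight μ γ W)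
    (hd : WaveData μ γ Ω B) (n : ℕ) : WaveWeight μ γ (fun m => (Complex.I * γ m) ^ n * W m) := by
  induction n with
  | zero => simpa using hW
  | succ n ih =>
    have := ih.wave_mul hd
    simp only [← mul_assoc, ← pow_succ'] at this
    exact this

/-- The dispersion relation `-ω(k) = -β(ik)³ + iα(ik)² - δ(ik)` turns the time derivative into
spatial ones under the integral. -/
theorem isWaveFamily_waveIntegral {μ : Measure ℝ} {γ Ω W : ℝ → ℂ} {B : ℝ}
    (hW : WaveWeight μ γ W) (hd : WaveData μ γ Ω B) (hΩ : ∀ m, Ω m = omega α β δ (γ m)) :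
    IsWaveFamily α β δ (fun n => waveIntegral μ γ Ω (fun m => (Complex.I * γ m) ^ n * W m)) where
  space n x hx t := by
    have := hasDerivAt_waveIntegral_space hd (hW.wave_pow_mul hd n) hx t
    simp only [← mul_assoc, ← pow_succ'] at this
    exact this
  time x hx t := by
    have h0 := hasDerivAt_waveIntegral_time hd hW hx t
    simp only [pow_zero, one_mul]
    refine h0.congr_deriv ?_
    have h1 := (integrable_wave hd (hW.wave_pow_mul hd 1) hx t).const_mul (δ : ℂ)
    have h2 := (integrable_wave hd (hW.wave_pow_mul hd 2) hx t).const_mul (Complex.I * α)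
    have h3 := (integrable_wave hd (hW.wave_pow_mul hd 3) hx t).const_mul (-β : ℂ)
    unfold waveIntegral
    rw [← integral_const_mul, ← integral_const_mul, ← integral_const_mul]
    refine Eq.trans (integral_congr_ae (ae_of_all _ fun m => ?_))
      ((integral_sub (h3.add h2) h1).trans (congrArg₂ _ (integral_add h3 h2) rfl))
    simp only [hΩ, omega, Pi.add_apply]
    have hI : Complex.I ^ 2 = -1 := Complex.I_sq
    have hI3 : Complex.I ^ 3 = -Complex.I := by rw [pow_succ, hI]; ring
    simp only [mul_pow, hI, hI3]
    ring
  continuousOn := by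
    simp only [pow_zero, one_mul]
    exact continuousOn_waveIntegral hd hW

end

section

variable {α β δ T : ℝ} {g : ℝ → ℂ}

theorem exists_isWaveFamily_fokasSolution (hβ : 0 < β) (hT : 0 ≤ T)
    (hg : IntervalIntegrable g volume 0 T) :
    ∃ f, IsWaveFamily α β δ f ∧ f 0 = fokasSolution α β δ (largeHeight α β δ) T g := by
  have hbr : ∀ σ : ℝ, σ ^ 2 = 1 → _ := fun σ hσ => isWaveFamily_waveIntegral
    (waveWeight_branch (α := α) (β := β) (δ := δ) (σ := σ) hβ hT hg hσ le_rfl)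
    (waveData_branch hβ hσ le_rfl) (fun _ => rfl)
  have hmid := isWaveFamily_waveIntegral (waveWeight_mid (α := α) (β := β) (δ := δ) hg _ _ _)
    (waveData_mid (α := α) (δ := δ) hβ le_rfl) (fun _ => rfl)
  refine ⟨_, ((((hbr (-1) (by norm_num)).const_mul (-1)).add hmid).add
    (hbr 1 (by norm_num))).const_mul (-(Complex.I / (2 * Real.pi))), ?_⟩
  funext x t
  rw [fokasSolution_eq_parts hβ (regularHeight_largeHeight hβ)]
  simp only [pow_zero, one_mul, neg_one_mul]
  rfl

/-- The classical part of the assertion that the Fokas solution solves the problem. -/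
theorem fokasSolution_classical (hβ : 0 < β) (hT : 0 ≤ T)
    (hg : IntervalIntegrable g volume 0 T) {h : ℝ} (H : RegularHeight α β δ h) :
    (∀ x ∈ Ioi (0 : ℝ), ∀ t,
      DifferentiableAt ℝ (fun t' => fokasSolution α β δ h T g x t') t ∧
      ContDiffAt ℝ 3 (fun x' => fokasSolution α β δ h T g x' t) x ∧
      Complex.I * deriv (fun t' => fokasSolution α β δ h T g x t') t
        + Complex.I * β * iteratedDeriv 3 (fun x' => fokasSolution α β δ h T g x' t) x
        + α * iteratedDeriv 2 (fun x' => fokasSolution α β δ h T g x' t) x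
        + Complex.I * δ * deriv (fun x' => fokasSolution α β δ h T g x' t) x = 0) ∧
    ContinuousOn (fun p : ℝ × ℝ => fokasSolution α β δ h T g p.1 p.2) (Ioi 0 ×ˢ univ) := by
  obtain ⟨f, hf, hf0⟩ := exists_isWaveFamily_fokasSolution (α := α) (δ := δ) hβ hT hg
  have heq : ∀ x : ℝ, 0 < x → ∀ t, fokasSolution α β δ h T g x t = f 0 x t := fun x hx t => by
    rw [hf0, fokasSolution_eq_largeHeight hβ hT hg H hx]
  refine ⟨fun x hx t => ?_, hf.continuousOn.congr fun p hp => heq p.1 hp.1 p.2⟩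
  have ht : (fun t' => fokasSolution α β δ h T g x t') = fun t' => f 0 x t' :=
    funext fun t' => heq x hx t'
  have hxt : (fun x' => fokasSolution α β δ h T g x' t) =ᶠ[𝓝 x] fun x' => f 0 x' t := by
    filter_upwards [isOpen_Ioi.mem_nhds hx] with y hy using heq y hy t
  have hd := contDiffOn_of_hasDerivAt_succ (f := fun n x => f n x t)
    (fun n x hx => hf.space n x hx t)
  rw [ht, (hf.time x hx t).deriv, hxt.deriv_eq, (hf.space 0 x hx t).deriv, hxt.iteratedDeriv_eq,
    hxt.iteratedDeriv_eq, (hd 3).2 x hx, (hd 2).2 x hx]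
  refine ⟨(hf.time x hx t).differentiableAt,
    (((hd 3).1 0).contDiffAt (isOpen_Ioi.mem_nhds hx)).congr_of_eventuallyEq hxt, ?_⟩
  linear_combination (α * f 2 x t) * Complex.I_sq

/-! ### The frequency as a parameter -/

/-- The right branch carries all frequencies above one threshold and the left branch all below
another. The segment has to account for the interval between them. -/
theorem branchFreq_image (hβ : 0 < β) :
    branchFreq α β δ 1 '' Ioi (largeHeight α β δ) =
      Ioi (branchFreq α β δ 1 (largeHeight α β δ)) ∧
    branchFreq α β δ (-1) '' Ioi (largeHeight α β δ) =
      Iio (branchFreq α β δ (-1) (largeHeight α β δ)) := by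
  set h₀ := largeHeight α β δ
  have key : ∀ σ : ℝ, σ ^ 2 = 1 → (fun m => σ * branchFreq α β δ σ m) '' Ioi h₀ =
      Ioi (σ * branchFreq α β δ σ h₀) := by
    intro σ hσ
    have hmono := strictMonoOn_branchFreq (α := α) (δ := δ) hβ hσ
    have hcont : ContinuousOn (fun m => σ * branchFreq α β δ σ m) (Ici h₀) := fun m hm =>
      ((hasDerivAt_branchFreq hβ σ hm).continuousAt.const_mul σ).continuousWithinAt
    refine Subset.antisymm ?_ fun y hy => ?_
    · rintro _ ⟨m, hm, rfl⟩
      exact hmono self_mem_Ici (mem_Ici_of_Ioi hm) hm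
    · set C := 27 / β * (1 + |omegaOffset α β δ|) with hC
      have hC0 : 0 < C := by positivity
      -- With this `M` the cubic lower bound gives `|τ(M)| ≥ 1 + |y| + 2|τ(h₀)|`. As `σ τ(M) ≥ σ
      -- τ(h₀)`, the sign of `σ τ(M)` cannot be negative, so `σ τ(M)` exceeds `y`.
      set M := max h₀ (C * (2 + |y| + 2 * |σ * branchFreq α β δ σ h₀|)) with hM
      have hM0 : h₀ ≤ M := le_max_left _ _
      have hM1 : 1 ≤ M := (one_le_largeHeight α δ hβ).trans hM0
      have h1 := cube_le_branchFreq (δ := δ) (α := α) hβ hσ hM0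
      have h2 : M ≤ M ^ 3 := le_self_pow₀ hM1 (by norm_num)
      have h3 : C * (2 + |y| + 2 * |σ * branchFreq α β δ σ h₀|) ≤
          C * (1 + |branchFreq α β δ σ M|) := (le_max_right _ _).trans (h2.trans h1)
      have h4 := le_of_mul_le_mul_left h3 hC0
      have hσ' : |σ| = 1 := by rwa [← sq_eq_sq₀ (abs_nonneg _) zero_le_one, sq_abs, one_pow]
      have h5 : |branchFreq α β δ σ M| = |σ * branchFreq α β δ σ M| := by
        rw [abs_mul, hσ', one_mul]
      have h6 : σ * branchFreq α β δ σ h₀ ≤ σ * branchFreq α β δ σ M :=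
        hmono.monotoneOn self_mem_Ici hM0 hM0
      have h7 : y ≤ σ * branchFreq α β δ σ M := by
        rw [h5] at h4
        have := neg_abs_le (σ * branchFreq α β δ σ h₀)
        have := le_abs_self y
        have := abs_nonneg (σ * branchFreq α β δ σ h₀)
        rcases abs_cases (σ * branchFreq α β δ σ M) with ⟨e, -⟩ | ⟨e, -⟩ <;> linarith
      obtain ⟨m, hm, rfl⟩ := intermediate_value_Icc hM0 (hcont.mono Icc_subset_Ici_self)
        ⟨le_of_lt hy, h7⟩
      refine ⟨m, lt_of_le_of_ne hm.1 ?_, rfl⟩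
      rintro rfl
      exact lt_irrefl (σ * branchFreq α β δ σ h₀) hy
  constructor
  · simpa using key 1 (by norm_num)
  · have := key (-1) (by norm_num)
    simp only [neg_one_mul] at this
    have h2 := congrArg (fun s => Neg.neg '' s) this
    simp only [image_image, neg_neg, image_neg_eq_neg, neg_Ioi] at h2
    exact h2

theorem branchFreqDeriv_nonneg (hβ : 0 < β) {σ : ℝ} (hσ : σ ^ 2 = 1) {m : ℝ}
    (hm : largeHeight α β δ < m) : 0 ≤ σ * branchFreqDeriv α β δ σ m := by
  have h1 := ((hasDerivAt_branchFreq (α := α) (δ := δ) hβ σ hm.le).const_mul σ).hasDerivWithinAt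
    (s := Ici (largeHeight α β δ))
  rw [← h1.derivWithin ((uniqueDiffOn_Ici _) _ hm.le)]
  exact (strictMonoOn_branchFreq hβ hσ).monotoneOn.derivWithin_nonneg

theorem injOn_branchFreq (hβ : 0 < β) {σ : ℝ} (hσ : σ ^ 2 = 1) :
    InjOn (branchFreq α β δ σ) (Ioi (largeHeight α β δ)) := fun _ hm _ hm' h =>
  (strictMonoOn_branchFreq hβ hσ).injOn (mem_Ici_of_Ioi hm) (mem_Ici_of_Ioi hm')
    (congrArg (σ * ·) h)

/-- The wave number of the branch with the frequency `τ`. -/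
noncomputable def branchOfFreq (α β δ σ τ : ℝ) : ℂ :=
  branch α β δ σ (Function.invFunOn (branchFreq α β δ σ) (Ioi (largeHeight α β δ)) τ)

theorem branchOfFreq_branchFreq (hβ : 0 < β) {σ : ℝ} (hσ : σ ^ 2 = 1) {m : ℝ}
    (hm : largeHeight α β δ < m) :
    branchOfFreq α β δ σ (branchFreq α β δ σ m) = branch α β δ σ m := by
  unfold branchOfFreq
  rw [(injOn_branchFreq hβ hσ).leftInvOn_invFunOn hm]

/-- The change of variables `m ↦ τ`. The weight contains `dω = i dτ`, and the Jacobian is `|τ'| = σ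
τ'`, so the two differ by the constant `iσ`. -/
theorem branchPart_eq_freq (hβ : 0 < β) (hT : 0 ≤ T) (hg : IntervalIntegrable g volume 0 T)
    {σ : ℝ} (hσ : σ ^ 2 = 1) {x : ℝ} (hx : 0 < x) (t : ℝ) :
    IntegrableOn (fun τ : ℝ => Complex.exp (Complex.I * branchOfFreq α β δ σ τ * x) *
        Complex.exp (-(Complex.I * τ * t)) * timeTransform g (Complex.I * τ) T)
      (branchFreq α β δ σ '' Ioi (largeHeight α β δ)) ∧
    branchPart α β δ σ (largeHeight α β δ) T g x t = Complex.I * σ *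
      ∫ τ in branchFreq α β δ σ '' Ioi (largeHeight α β δ),
        Complex.exp (Complex.I * branchOfFreq α β δ σ τ * x) *
        Complex.exp (-(Complex.I * τ * t)) * timeTransform g (Complex.I * τ) T := by
  have hd : ∀ m ∈ Ioi (largeHeight α β δ), HasDerivWithinAt (branchFreq α β δ σ)
      (branchFreqDeriv α β δ σ m) (Ioi (largeHeight α β δ)) m := fun m hm =>
    (hasDerivAt_branchFreq hβ σ (le_of_lt hm)).hasDerivWithinAt
  have hpt : ∀ m ∈ Ioi (largeHeight α β δ),
      |branchFreqDeriv α β δ σ m| • (Complex.exp (Complex.I * branchOfFreq α β δ σ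
        (branchFreq α β δ σ m) * x) * Complex.exp (-(Complex.I * (branchFreq α β δ σ m) * t)) *
        timeTransform g (Complex.I * (branchFreq α β δ σ m)) T) =
      (-Complex.I * σ) * (Complex.exp (Complex.I * branch α β δ σ m * x -
        omega α β δ (branch α β δ σ m) * t) * branchWeight α β δ σ T g m) := by
    intro m hm
    have hσ' : |σ| = 1 := by rwa [← sq_eq_sq₀ (abs_nonneg _) zero_le_one, sq_abs, one_pow]
    have h1 : |branchFreqDeriv α β δ σ m| = σ * branchFreqDeriv α β δ σ m := by
      rw [← abs_of_nonneg (branchFreqDeriv_nonneg hβ hσ hm), abs_mul, hσ', one_mul]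
    rw [branchOfFreq_branchFreq hβ hσ hm, h1, branchWeight, mul_right_comm (deriv _ _),
      deriv_omega_branch_mul hβ hσ hm, omega_branch hβ hσ (le_of_lt hm), sub_eq_add_neg,
      Complex.exp_add, Complex.real_smul]
    push_cast
    linear_combination (σ * branchFreqDeriv α β δ σ m *
      Complex.exp (Complex.I * branch α β δ σ m * x) *
      Complex.exp (-(Complex.I * (branchFreq α β δ σ m) * t)) *
        timeTransform g (Complex.I * (branchFreq α β δ σ m)) T) * Complex.I_sq
  have hi := integrable_wave (waveData_branch (α := α) (δ := δ) hβ hσ le_rfl)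
    (waveWeight_branch (α := α) (δ := δ) hβ hT hg hσ le_rfl) hx t
  constructor
  · rw [integrableOn_image_iff_integrableOn_abs_deriv_smul measurableSet_Ioi hd
      (injOn_branchFreq hβ hσ)]
    exact (integrableOn_congr_fun hpt measurableSet_Ioi).mpr (hi.const_mul _)
  · rw [integral_image_eq_integral_abs_deriv_smul measurableSet_Ioi hd (injOn_branchFreq hβ hσ),
      setIntegral_congr_fun measurableSet_Ioi hpt, integral_const_mul, branchPart, waveIntegral]
    have hσ2 : (σ : ℂ) ^ 2 = 1 := by exact_mod_cast hσ
    rw [← mul_assoc]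
    have : Complex.I * σ * (-Complex.I * σ) = 1 := by
      linear_combination -(σ : ℂ) ^ 2 * Complex.I_sq + hσ2
    rw [this, one_mul]

end

end FokasHalfLine

namespace FokasHalfLine
open scoped FourierTransform ComplexConjugate

/-! ### The boundary value -/

theorem integral_smul_fourierInv_swap {f g : ℝ → ℂ} (hf : Integrable f) (hg : Integrable g) :
    ∫ ξ, g ξ • 𝓕⁻ f ξ = ∫ x, 𝓕⁻ g x • f x := by
  have h := integral_smul_fourier_swap hf hg.comp_neg
  rw [← integral_neg_eq_self] at h
  simp only [neg_neg, ← Real.fourierInv_eq_fourier_neg] at h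
  rw [h]
  refine integral_congr_ae (ae_of_all _ fun x => ?_)
  simp only [Real.fourierInv_eq_fourier_comp_neg]

/-- On `L¹ ∩ L²` the inverse `L²` Fourier transform is the inverse Fourier integral. -/
theorem fourierInv_toLp_ae_eq {f : ℝ → ℂ} (hf : Integrable f) (hf2 : MemLp f 2) :
    ((𝓕⁻ (hf2.toLp f) : Lp ℂ 2 (volume : Measure ℝ)) : ℝ → ℂ) =ᵐ[volume] 𝓕⁻ f := by
  refine ae_eq_of_integral_contDiff_smul_eq
    ((Lp.memLp (𝓕⁻ (hf2.toLp f) : Lp ℂ 2 (volume : Measure ℝ))).locallyIntegrable (by norm_num))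
    (Continuous.locallyIntegrable ?_) ?_
  · rw [show 𝓕⁻ f = fun ξ => 𝓕 f (-ξ) from funext fun ξ => Real.fourierInv_eq_fourier_neg f ξ]
    exact (VectorFourier.fourierIntegral_continuous Real.continuous_fourierChar
      (by exact continuous_inner) hf).comp continuous_neg
  intro g g_smooth g_cpt
  have hg₁ : HasCompactSupport (Complex.ofRealCLM ∘ g) := g_cpt.comp_left rfl
  have hg₂ : ContDiff ℝ ((⊤ : ℕ∞) : WithTop ℕ∞) (Complex.ofRealCLM ∘ g) :=
    Complex.ofRealCLM.contDiff.comp g_smooth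
  have h1 := integral_smul_fourierInv_Lp (hf2.toLp f) (hg₁.toSchwartzMap hg₂)
  have h2 := integral_smul_fourierInv_swap hf (hg₁.toSchwartzMap hg₂).integrable
  have h3 : ∫ x, 𝓕⁻ (hg₁.toSchwartzMap hg₂) x • (hf2.toLp f) x =
      ∫ x, 𝓕⁻ (⇑(hg₁.toSchwartzMap hg₂)) x • f x := by
    refine integral_congr_ae ?_
    filter_upwards [hf2.coeFn_toLp] with x hx
    rw [hx, SchwartzMap.fourierInv_coe]
  rw [h3, ← h2] at h1
  simpa using h1

theorem tendsto_eLpNorm_two_of_dominated {ι : Type*} {l : Filter ι} [l.IsCountablyGenerated]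
    {f : ι → ℝ → ℂ} {G : ℝ → ℂ} (hG : MemLp G 2) (C : ℝ)
    (hf : ∀ᶠ i in l, AEStronglyMeasurable (f i) volume)
    (hb : ∀ᶠ i in l, ∀ᵐ x, ‖f i x‖ ≤ C * ‖G x‖)
    (hlim : ∀ᵐ x, Tendsto (fun i => f i x) l (𝓝 0)) :
    Tendsto (fun i => eLpNorm (f i) 2 volume) l (𝓝 0) := by
  have hG' : MemLp (fun x => C * ‖G x‖) 2 := hG.norm.const_mul C
  have hGfin := lintegral_rpow_enorm_lt_top_of_eLpNorm_lt_top (by norm_num) (by norm_num) hG'.2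
  have key : Tendsto (fun i => ∫⁻ x, ‖f i x‖ₑ ^ (2 : ℝ)) l (𝓝 (∫⁻ _ : ℝ, 0)) := by
    refine tendsto_of_seq_tendsto fun u hu => ?_
    obtain ⟨N, hN⟩ := eventually_atTop.mp (hu.eventually (hf.and hb))
    rw [← tendsto_add_atTop_iff_nat N]
    refine tendsto_lintegral_of_dominated_convergence' (fun x => ‖C * ‖G x‖‖ₑ ^ (2 : ℝ))
      (fun n => (hN (n + N) (by omega)).1.enorm.pow_const _)
      (fun n => ?_) (by simpa using hGfin.ne) ?_
    · filter_upwards [(hN (n + N) (by omega)).2] with x hx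
      gcongr
      exact enorm_le_iff_norm_le.mpr (hx.trans (le_abs_self _))
    · filter_upwards [hlim] with x hx
      have h1 : Tendsto (fun n => f (u (n + N)) x) atTop (𝓝 0) :=
        (hx.comp hu).comp (tendsto_add_atTop_nat N)
      have h2 := (h1.enorm).ennrpow_const (2 : ℝ)
      simpa using h2
  have h2 := key.ennrpow_const (1 / 2 : ℝ)
  refine Tendsto.congr (fun i => ?_) (by simpa using h2)
  rw [eLpNorm_eq_lintegral_rpow_enorm_toReal (by norm_num) (by norm_num)]
  simp

section

variable {α β δ T : ℝ} {g : ℝ → ℂ}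

/-- The factor `e^{ik(τ)x}` on the frequencies of the branches, and `1` in between. -/
noncomputable def freqMultiplier (α β δ x τ : ℝ) : ℂ :=
  open Classical in
  if branchFreq α β δ 1 (largeHeight α β δ) < τ then
    Complex.exp (Complex.I * branchOfFreq α β δ 1 τ * x)
  else if τ < branchFreq α β δ (-1) (largeHeight α β δ) then
    Complex.exp (Complex.I * branchOfFreq α β δ (-1) τ * x)
  else 1

theorem branchFreq_left_le (hβ : 0 < β) :
    branchFreq α β δ (-1) (largeHeight α β δ) ≤ branchFreq α β δ 1 (largeHeight α β δ) := by
  rw [branchFreq_eq hβ (by norm_num) le_rfl, branchFreq_eq hβ (by norm_num) le_rfl]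
  have h1 := (branchDisc_bounds (α := α) (δ := δ) hβ le_rfl).1
  have h2 := (abs_le.mp (abs_disc_le (α := α) (δ := δ) hβ le_rfl)).2
  have h3 : 0 ≤ 8 * branchDisc α β δ (largeHeight α β δ) - 6 * (α ^ 2 + 3 * β * δ) := by
    nlinarith [sq_nonneg (β * largeHeight α β δ)]
  have h4 : 0 ≤ √(branchDisc α β δ (largeHeight α β δ)) *
      (8 * branchDisc α β δ (largeHeight α β δ) - 6 * (α ^ 2 + 3 * β * δ)) / (27 * β ^ 2) := by
    positivity
  linarith

theorem branchOfFreq_im_nonneg (hβ : 0 < β) {σ τ : ℝ}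
    (hτ : τ ∈ branchFreq α β δ σ '' Ioi (largeHeight α β δ)) :
    0 ≤ (branchOfFreq α β δ σ τ).im := by
  have h := Function.invFunOn_mem hτ
  unfold branchOfFreq
  rw [branch_im]
  have h' : largeHeight α β δ < _ := h
  linarith [one_le_largeHeight α δ hβ]

theorem norm_freqMultiplier_le (hβ : 0 < β) {x : ℝ} (hx : 0 ≤ x) (τ : ℝ) :
    ‖freqMultiplier α β δ x τ‖ ≤ 1 := by
  have key : ∀ k : ℂ, 0 ≤ k.im → ‖Complex.exp (Complex.I * k * x)‖ ≤ 1 := fun k hk => by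
    rw [Complex.norm_exp, Real.exp_le_one_iff]
    have : (Complex.I * k * x).re = -(k.im * x) := by simp
    rw [this]
    exact neg_nonpos.mpr (mul_nonneg hk hx)
  unfold freqMultiplier
  split_ifs with h1 h2
  · exact key _ (branchOfFreq_im_nonneg hβ ((branchFreq_image hβ).1.ge h1))
  · exact key _ (branchOfFreq_im_nonneg hβ ((branchFreq_image hβ).2.ge h2))
  · simp

theorem tendsto_freqMultiplier (τ : ℝ) :
    Tendsto (fun x => freqMultiplier α β δ x τ) (𝓝[>] 0) (𝓝 1) := by
  have key : ∀ k : ℂ, Tendsto (fun x : ℝ => Complex.exp (Complex.I * k * x)) (𝓝[>] 0) (𝓝 1) := by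
    intro k
    have h : Continuous fun x : ℝ => Complex.exp (Complex.I * k * x) := by fun_prop
    have h0 := h.tendsto 0
    simp only [Complex.ofReal_zero, mul_zero, Complex.exp_zero] at h0
    exact h0.mono_left nhdsWithin_le_nhds
  unfold freqMultiplier
  split_ifs
  · exact key _
  · exact key _
  · exact tendsto_const_nhds

/-- For `x = 0` the integrand is the pull-back under `ω` of an entire function. Its integral depends
only on the endpoints, whose images are `iτ` with `τ` the two threshold frequencies, so the path may
be replaced by a segment of the imaginary axis. -/
theorem midPart_zero_eq (hβ : 0 < β) (hg : IntervalIntegrable g volume 0 T) (t : ℝ) :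
    midPart α β δ (largeHeight α β δ) T g 0 t = Complex.I *
      ∫ τ in (branchFreq α β δ (-1) (largeHeight α β δ))..(branchFreq α β δ 1
        (largeHeight α β δ)), Complex.exp (-(Complex.I * τ * t)) *
          timeTransform g (Complex.I * τ) T := by
  have hf : Differentiable ℂ fun z => Complex.exp (-(z * t)) * timeTransform g z T :=
    (by fun_prop : Differentiable ℂ fun z : ℂ => Complex.exp (-(z * t))).mul
      (differentiable_timeTransform hg)
  obtain ⟨P, hP⟩ := hf.isExactOn_univ
  have hP' : ∀ z, HasDerivAt P (Complex.exp (-(z * t)) * timeTransform g z T) z :=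
    fun z => hP z (mem_univ z)
  have hω := differentiable_omega α β δ
  have h1 := setIntegral_comp_gammaMid (α := α) (δ := δ) (h := largeHeight α β δ) hβ
    (f := fun k => Complex.exp (-(omega α β δ k * t)) * timeTransform g (omega α β δ k) T *
      deriv (omega α β δ) k) (P := fun k => P (omega α β δ k))
    (((hf.comp hω).mul (differentiable_deriv_omega α β δ)).continuous)
    (fun z => (hP' _).comp z (hω z).hasDerivAt)
  have h2 := intervalIntegral.integral_eq_sub_of_hasDerivAt
    (f := fun τ : ℝ => P (Complex.I * τ))
    (f' := fun τ : ℝ => Complex.exp (-(Complex.I * τ * t)) *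
          timeTransform g (Complex.I * τ) T * Complex.I)
    (a := branchFreq α β δ (-1) (largeHeight α β δ)) (b := branchFreq α β δ 1 (largeHeight α β δ))
    (fun τ _ => by
      have h3 : HasDerivAt (fun τ : ℝ => Complex.I * (τ : ℂ)) Complex.I τ := by
        simpa using (Complex.ofRealCLM.hasDerivAt (x := τ)).const_mul Complex.I
      exact (hP' _).comp_of_eq τ h3 rfl)
    (by
      have hc := hf.continuous.comp (by fun_prop : Continuous fun τ : ℝ => Complex.I * (τ : ℂ))
      exact (hc.mul continuous_const).intervalIntegrable _ _)
  rw [intervalIntegral.integral_mul_const, mul_comm] at h2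
  rw [h2, ← omega_branch hβ (by norm_num) le_rfl, ← omega_branch hβ (by norm_num) le_rfl, ← h1]
  unfold midPart waveIntegral midWeight
  refine integral_congr_ae (ae_of_all _ fun m => ?_)
  simp only [Complex.ofReal_zero, mul_zero, zero_sub]
  ring

/-- The two branches and the segment taken at `x = 0` together cover every real frequency exactly
once. The last term is the price for freezing `x = 0` on the segment. -/
theorem fokasSolution_eq_integral_freq (hβ : 0 < β) (hT : 0 ≤ T)
    (hg : IntervalIntegrable g volume 0 T) {x : ℝ} (hx : 0 < x) (t : ℝ) :
    Integrable (fun τ : ℝ => Complex.exp (-(Complex.I * τ * t)) *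
      (freqMultiplier α β δ x τ * timeTransform g (Complex.I * τ) T)) ∧
    fokasSolution α β δ (largeHeight α β δ) T g x t =
      (1 / (2 * Real.pi)) * (∫ τ : ℝ, Complex.exp (-(Complex.I * τ * t)) *
        (freqMultiplier α β δ x τ * timeTransform g (Complex.I * τ) T)) -
      Complex.I / (2 * Real.pi) * (midPart α β δ (largeHeight α β δ) T g x t -
        midPart α β δ (largeHeight α β δ) T g 0 t) := by
  set τR := branchFreq α β δ 1 (largeHeight α β δ) with hR
  set τL := branchFreq α β δ (-1) (largeHeight α β δ) with hL
  have hle : τL ≤ τR := branchFreq_left_le hβ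
  obtain ⟨i1, e1⟩ := branchPart_eq_freq (α := α) (δ := δ) (σ := 1) hβ hT hg (by norm_num) hx t
  obtain ⟨i2, e2⟩ := branchPart_eq_freq (α := α) (δ := δ) (σ := -1) hβ hT hg (by norm_num) hx t
  rw [(branchFreq_image hβ).1, ← hR] at i1 e1
  rw [(branchFreq_image hβ).2, ← hL] at i2 e2
  have e3 := midPart_zero_eq (α := α) (δ := δ) hβ hg t
  rw [← hL, ← hR, intervalIntegral.integral_of_le hle, ← integral_Icc_eq_integral_Ioc] at e3
  set Φ := fun τ : ℝ => Complex.exp (-(Complex.I * τ * t)) *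
      (freqMultiplier α β δ x τ * timeTransform g (Complex.I * τ) T) with hΦ
  have c1 : EqOn (fun τ : ℝ => Complex.exp (Complex.I * branchOfFreq α β δ 1 τ * x) *
        Complex.exp (-(Complex.I * τ * t)) * timeTransform g (Complex.I * τ) T) Φ (Ioi τR) := by
    intro τ hτ
    have hτ' : branchFreq α β δ 1 (largeHeight α β δ) < τ := hτ
    simp only [hΦ, freqMultiplier, if_pos hτ']
    ring
  have c2 : EqOn (fun τ : ℝ => Complex.exp (Complex.I * branchOfFreq α β δ (-1) τ * x) *
        Complex.exp (-(Complex.I * τ * t)) * timeTransform g (Complex.I * τ) T) Φ (Iio τL) := by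
    intro τ hτ
    have hτ' : τ < branchFreq α β δ (-1) (largeHeight α β δ) := hτ
    have hτ'' : ¬ branchFreq α β δ 1 (largeHeight α β δ) < τ := by
      rw [← hR, not_lt]; exact (le_of_lt hτ).trans hle
    simp only [hΦ, freqMultiplier, if_pos hτ', if_neg hτ'']
    ring
  have c3 : EqOn (fun τ : ℝ => Complex.exp (-(Complex.I * τ * t)) *
      timeTransform g (Complex.I * τ) T) Φ (Icc τL τR) := by
    intro τ hτ
    have h1 : ¬ branchFreq α β δ 1 (largeHeight α β δ) < τ := not_lt.mpr hτ.2
    have h2 : ¬ τ < branchFreq α β δ (-1) (largeHeight α β δ) := not_lt.mpr hτ.1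
    simp only [hΦ, freqMultiplier, if_neg h1, if_neg h2, one_mul]
  have j1 : IntegrableOn Φ (Ioi τR) := i1.congr_fun c1 measurableSet_Ioi
  have j2 : IntegrableOn Φ (Iio τL) := i2.congr_fun c2 measurableSet_Iio
  have j3 : IntegrableOn Φ (Icc τL τR) := by
    have hc : Continuous fun τ : ℝ => Complex.exp (-(Complex.I * τ * t)) *
        timeTransform g (Complex.I * τ) T :=
      (by fun_prop : Continuous fun τ : ℝ => Complex.exp (-(Complex.I * τ * t))).mul
        ((differentiable_timeTransform hg).continuous.comp (by fun_prop))
    exact (hc.continuousOn.integrableOn_compact isCompact_Icc).congr_fun c3 measurableSet_Icc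
  have hU1 : Iio τL ∪ Icc τL τR = Iic τR := Iio_union_Icc_eq_Iic hle
  have j4 : IntegrableOn Φ (Iic τR) := hU1 ▸ j2.union j3
  have j5 : Integrable Φ := by
    rw [← integrableOn_univ, ← Iic_union_Ioi (a := τR)]
    exact j4.union j1
  refine ⟨j5, ?_⟩
  have s1 : ∫ τ, Φ τ = (∫ τ in Iio τL, Φ τ) + (∫ τ in Icc τL τR, Φ τ) + ∫ τ in Ioi τR, Φ τ := by
    have hdisj : Disjoint (Iio τL) (Icc τL τR) :=
      disjoint_left.mpr fun τ h1 h2 => absurd h2.1 (not_le.mpr h1)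
    rw [← intervalIntegral.integral_Iic_add_Ioi j4 j1, ← hU1,
      setIntegral_union hdisj measurableSet_Icc j2 j3]
  rw [setIntegral_congr_fun measurableSet_Ioi c1] at e1
  rw [setIntegral_congr_fun measurableSet_Iio c2] at e2
  rw [setIntegral_congr_fun measurableSet_Icc c3] at e3
  rw [fokasSolution_eq_parts hβ (regularHeight_largeHeight hβ), e1, e2, e3, s1]
  push_cast
  linear_combination (-(1 / (2 * Real.pi)) * ((∫ τ in Iio τL, Φ τ) + (∫ τ in Icc τL τR, Φ τ) +
    ∫ τ in Ioi τR, Φ τ)) * Complex.I_sq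

theorem timeTransform_eq_fourierInv (hT : 0 ≤ T)
    (hsupp : ∀ᵐ t : ℝ, t ∉ Ico 0 T → g t = 0) (ξ : ℝ) :
    timeTransform g (Complex.I * ((2 * Real.pi * ξ : ℝ) : ℂ)) T = 𝓕⁻ g ξ := by
  rw [Real.fourierInv_eq', timeTransform, intervalIntegral.integral_of_le hT,
    integral_Ioc_eq_integral_Ioo, ← integral_Ico_eq_integral_Ioo]
  have : ∀ᵐ t : ℝ, t ∉ Ico 0 T → Complex.exp (((2 * Real.pi * inner ℝ t ξ : ℝ) : ℂ) *
      Complex.I) • g t = 0 := by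
    filter_upwards [hsupp] with t ht h
    rw [ht h, smul_zero]
  rw [← setIntegral_eq_integral_of_ae_compl_eq_zero this]
  refine integral_congr_ae (ae_of_all _ fun t => ?_)
  simp only [smul_eq_mul, RCLike.inner_apply, conj_trivial]
  congr 2
  push_cast
  ring

/-- On the segment `k` is bounded, so `|e^{ikx} - 1| = O(x)`, uniformly for `t ∈ [0, T]`. -/
theorem norm_midPart_sub_le (hβ : 0 < β) (hg : IntervalIntegrable g volume 0 T) :
    ∃ C : ℝ, ∀ᶠ x in 𝓝[>] (0 : ℝ), ∀ t ∈ Icc 0 T,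
      ‖midPart α β δ (largeHeight α β δ) T g x t - midPart α β δ (largeHeight α β δ) T g 0 t‖ ≤
        C * x := by
  set h₀ := largeHeight α β δ with hh₀
  set K := branchConst α β * h₀ with hK
  have hh1 : 1 ≤ h₀ := one_le_largeHeight α δ hβ
  have hK1 : 0 < K := by have := two_le_branchConst α hβ; positivity
  have hW := continuous_midWeight (α := α) (β := β) (δ := δ) hg h₀
  set S := Ioo (branch α β δ (-1) h₀).re (branch α β δ 1 h₀).re with hS
  have hWi : IntegrableOn (fun m => ‖midWeight α β δ h₀ T g m‖) S :=
    (hW.norm.continuousOn.integrableOn_compact isCompact_Icc).mono_set Ioo_subset_Icc_self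
  set B := (β + |α| + |δ|) * K ^ 3 with hB
  refine ⟨∫ m in S, Real.exp (B * T) * (2 * K) * ‖midWeight α β δ h₀ T g m‖, ?_⟩
  have hx1 : ∀ᶠ x in 𝓝[>] (0 : ℝ), x < 1 / K :=
    nhdsWithin_le_nhds (Iio_mem_nhds (by positivity))
  filter_upwards [hx1, self_mem_nhdsWithin] with x hx hx0 t ht
  have hx0 : 0 < x := hx0
  have hcont : ∀ y : ℝ, IntegrableOn (fun m => Complex.exp (Complex.I * gammaMid h₀ m * y -
      omega α β δ (gammaMid h₀ m) * t) * midWeight α β δ h₀ T g m) S := fun y => by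
    have h1 := continuous_gammaMid h₀
    have h2 := (differentiable_omega α β δ).continuous.comp h1
    have h2' : Continuous fun m => omega α β δ (gammaMid h₀ m) := h2
    have : Continuous fun m => Complex.exp (Complex.I * gammaMid h₀ m * y -
      omega α β δ (gammaMid h₀ m) * t) * midWeight α β δ h₀ T g m := by fun_prop
    exact (this.continuousOn.integrableOn_compact isCompact_Icc).mono_set Ioo_subset_Icc_self
  unfold midPart waveIntegral
  rw [← integral_sub (hcont x) (hcont 0), ← integral_mul_const]
  refine norm_integral_le_of_norm_le ((hWi.const_mul _).mul_const x) ?_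
  refine (ae_restrict_iff' measurableSet_Ioo).mpr (ae_of_all _ fun m hm => ?_)
  have hnm := (norm_gammaMid_le (α := α) (δ := δ) hβ hh₀.ge hm).2
  have e : Complex.exp (Complex.I * gammaMid h₀ m * x - omega α β δ (gammaMid h₀ m) * t) *
      midWeight α β δ h₀ T g m - Complex.exp (Complex.I * gammaMid h₀ m * (0 : ℝ) -
      omega α β δ (gammaMid h₀ m) * t) * midWeight α β δ h₀ T g m =
      Complex.exp (-(omega α β δ (gammaMid h₀ m) * t)) *
        (Complex.exp (Complex.I * gammaMid h₀ m * x) - 1) * midWeight α β δ h₀ T g m := by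
    rw [sub_eq_add_neg (Complex.I * gammaMid h₀ m * x), Complex.exp_add]
    simp only [Complex.ofReal_zero, mul_zero, zero_sub]
    ring
  rw [e, norm_mul, norm_mul]
  have hz : ‖Complex.I * gammaMid h₀ m * x‖ ≤ K * x := by
    rw [norm_mul, norm_mul, Complex.norm_I, one_mul, Complex.norm_real, Real.norm_of_nonneg hx0.le]
    gcongr
  have hKx : K * x ≤ 1 := by
    rw [lt_div_iff₀ hK1] at hx
    linarith
  have b1 : ‖Complex.exp (-(omega α β δ (gammaMid h₀ m) * t))‖ ≤ Real.exp (B * T) := by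
    rw [Complex.norm_exp, Real.exp_le_exp]
    refine (Complex.re_le_norm _).trans ?_
    rw [norm_neg, norm_mul, Complex.norm_real, Real.norm_of_nonneg ht.1]
    have := norm_omega_le (α := α) (δ := δ) hβ (by have := two_le_branchConst α hβ; nlinarith) hnm
    exact mul_le_mul this ht.2 ht.1 (by positivity)
  have b2 : ‖Complex.exp (Complex.I * gammaMid h₀ m * x) - 1‖ ≤ 2 * K * x := by
    refine (Complex.norm_exp_sub_one_le (hz.trans hKx)).trans ?_
    rw [mul_assoc 2 K]
    exact mul_le_mul_of_nonneg_left hz zero_le_two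
  calc _ ≤ Real.exp (B * T) * (2 * K * x) * ‖midWeight α β δ h₀ T g m‖ := by gcongr
    _ = _ := by ring

/-- Up to the error `O(x)` of the segment, the solution is the Fourier transform of `K x`, that is,
of `𝓕⁻ g` times a multiplier bounded by `1` and tending to `1`. Dominated convergence in `L²` and
Plancherel's theorem give the limit. -/
theorem fokasSolution_boundary (hβ : 0 < β) (hT : 0 ≤ T)
    (hsupp : ∀ᵐ t : ℝ, t ∉ Ico 0 T → g t = 0) (hg1 : Integrable g) (hg2 : MemLp g 2) {h : ℝ}
    (H : RegularHeight α β δ h) :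
    Tendsto (fun x => eLpNorm (fun t => fokasSolution α β δ h T g x t - g t) 2
      (volume.restrict (Ioo 0 T))) (𝓝[>] 0) (𝓝 0) := by
  have hg : IntervalIntegrable g volume 0 T := hg1.intervalIntegrable
  set K : ℝ → ℝ → ℂ := fun x ξ => freqMultiplier α β δ x (2 * Real.pi * ξ) * 𝓕⁻ g ξ with hK
  have h2π : (2 * Real.pi : ℝ) ≠ 0 := by positivity
  have hP : MemLp (𝓕⁻ g) 2 := (memLp_congr_ae (fourierInv_toLp_ae_eq hg1 hg2)).mp (Lp.memLp _)
  have hKi : ∀ x : ℝ, 0 < x → Integrable (K x) := fun x hx => by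
    have h1 := (fokasSolution_eq_integral_freq (α := α) (δ := δ) hβ hT hg hx 0).1
    simp only [Complex.ofReal_zero, mul_zero, neg_zero, Complex.exp_zero, one_mul] at h1
    have h2 := h1.comp_mul_left' h2π
    refine h2.congr (ae_of_all _ fun ξ => ?_)
    simp only [hK]
    rw [timeTransform_eq_fourierInv hT hsupp]
  have hKn : ∀ x : ℝ, 0 < x → ∀ ξ, ‖K x ξ‖ ≤ ‖𝓕⁻ g ξ‖ := fun x hx ξ => by
    rw [hK, norm_mul]
    exact mul_le_of_le_one_left (norm_nonneg _) (norm_freqMultiplier_le hβ hx.le _)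
  have hK2 : ∀ x : ℝ, 0 < x → MemLp (K x) 2 := fun x hx =>
    hP.mono (hKi x hx).aestronglyMeasurable (ae_of_all _ (hKn x hx))
  have hrep : ∀ x : ℝ, 0 < x → ∀ t, fokasSolution α β δ h T g x t = 𝓕 (K x) t -
      Complex.I / (2 * Real.pi) * (midPart α β δ (largeHeight α β δ) T g x t -
        midPart α β δ (largeHeight α β δ) T g 0 t) := fun x hx t => by
    rw [fokasSolution_eq_largeHeight hβ hT hg H hx,
      (fokasSolution_eq_integral_freq (α := α) (δ := δ) hβ hT hg hx t).2]
    congr 1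
    have h1 := Measure.integral_comp_mul_left (fun τ : ℝ => Complex.exp (-(Complex.I * τ * t)) *
      (freqMultiplier α β δ x τ * timeTransform g (Complex.I * τ) T)) (2 * Real.pi)
    rw [Real.fourier_eq']
    have h2 : |(2 * Real.pi)⁻¹| = (2 * Real.pi)⁻¹ := abs_of_pos (by positivity)
    rw [h2, Complex.real_smul] at h1
    rw [one_div]
    push_cast at h1
    rw [← h1]
    refine integral_congr_ae (ae_of_all _ fun ξ => ?_)
    have h3 := timeTransform_eq_fourierInv hT hsupp ξ
    push_cast at h3
    simp only [hK, smul_eq_mul, RCLike.inner_apply, conj_trivial, h3]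
    congr 2
    push_cast
    ring
  have hmain : Tendsto (fun x => eLpNorm (fun ξ => K x ξ - 𝓕⁻ g ξ) 2 volume) (𝓝[>] 0) (𝓝 0) := by
    refine tendsto_eLpNorm_two_of_dominated hP 2 ?_ ?_ (ae_of_all _ fun ξ => ?_)
    · filter_upwards [self_mem_nhdsWithin] with x hx
      exact (hKi x hx).aestronglyMeasurable.sub hP.1
    · filter_upwards [self_mem_nhdsWithin] with x hx
      refine ae_of_all _ fun ξ => (norm_sub_le _ _).trans ?_
      linarith [hKn x hx ξ]
    · have := ((tendsto_freqMultiplier (α := α) (β := β) (δ := δ) (2 * Real.pi * ξ)).mul_const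
        (𝓕⁻ g ξ)).sub_const (𝓕⁻ g ξ)
      simpa using this
  -- Plancherel's theorem. The Fourier integrals of `K x` and `g` are identified with their `L²`
  -- transforms, which is why integrability of `K x` was established along with square
  -- integrability.
  have hplan : ∀ x : ℝ, 0 < x → eLpNorm (fun t => 𝓕 (K x) t - g t) 2 volume =
      eLpNorm (fun ξ => K x ξ - 𝓕⁻ g ξ) 2 volume := fun x hx => by
    set G := hg2.toLp g
    set k := (hK2 x hx).toLp (K x)
    have h1 : eLpNorm (fun t => 𝓕 (K x) t - g t) 2 volume = ‖𝓕 k - G‖ₑ := by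
      rw [Lp.enorm_def]
      refine eLpNorm_congr_ae ?_
      filter_upwards [fourier_toLp_ae_eq (hKi x hx) (hK2 x hx), hg2.coeFn_toLp,
        Lp.coeFn_sub (𝓕 k) G] with t a1 a2 a3
      rw [a3, Pi.sub_apply, a1, a2]
    have h2 : eLpNorm (fun ξ => K x ξ - 𝓕⁻ g ξ) 2 volume = ‖k - 𝓕⁻ G‖ₑ := by
      rw [Lp.enorm_def]
      refine eLpNorm_congr_ae ?_
      filter_upwards [fourierInv_toLp_ae_eq hg1 hg2, (hK2 x hx).coeFn_toLp,
        Lp.coeFn_sub k (𝓕⁻ G)] with t a1 a2 a3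
      rw [a3, Pi.sub_apply, a1, a2]
    rw [h1, h2, enorm_eq_iff_norm_eq, ← Lp.norm_fourier_eq (k - 𝓕⁻ G)]
    congr 1
    have h3 : 𝓕 (k - 𝓕⁻ G) = 𝓕 k - 𝓕 (𝓕⁻ G) :=
      map_sub (Lp.fourierTransformₗᵢ ℝ ℂ) k (𝓕⁻ G)
    rw [h3, FourierTransform.fourier_fourierInv_eq]
  obtain ⟨C, hC⟩ := norm_midPart_sub_le (α := α) (δ := δ) hβ hg
  have herr : Tendsto (fun x : ℝ => (volume.restrict (Ioo 0 T)) univ ^ (2 : ℝ≥0∞).toReal⁻¹ *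
      ENNReal.ofReal (1 / (2 * Real.pi) * (C * x))) (𝓝[>] 0) (𝓝 0) := by
    have h1 : Tendsto (fun x : ℝ => ENNReal.ofReal (1 / (2 * Real.pi) * (C * x))) (𝓝[>] 0)
        (𝓝 0) := by
      have : Continuous fun x : ℝ => ENNReal.ofReal (1 / (2 * Real.pi) * (C * x)) :=
        ENNReal.continuous_ofReal.comp (by fun_prop)
      have h0 := (this.tendsto 0).mono_left (nhdsWithin_le_nhds (s := Ioi 0))
      simpa using h0
    have h2 : (volume.restrict (Ioo 0 T)) univ ^ (2 : ℝ≥0∞).toReal⁻¹ ≠ ∞ := by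
      refine ENNReal.rpow_ne_top_of_nonneg (by positivity) ?_
      simp
    simpa using ENNReal.Tendsto.const_mul h1 (Or.inr h2)
  refine tendsto_of_tendsto_of_tendsto_of_le_of_le' tendsto_const_nhds
    (by rw [← add_zero (0 : ℝ≥0∞)]; exact hmain.add herr) (Eventually.of_forall fun _ => zero_le) ?_
  filter_upwards [self_mem_nhdsWithin, hC] with x hx hxC
  have hx : 0 < x := hx
  have e : (fun t => fokasSolution α β δ h T g x t - g t) = fun t => (𝓕 (K x) t - g t) +
      (fokasSolution α β δ h T g x t - 𝓕 (K x) t) := by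
    funext t; ring
  have m1 : AEStronglyMeasurable (fun t => 𝓕 (K x) t) volume :=
    (VectorFourier.fourierIntegral_continuous Real.continuous_fourierChar
      (by exact continuous_inner) (hKi x hx)).aestronglyMeasurable
  have m2 : AEStronglyMeasurable (fun t => fokasSolution α β δ h T g x t) volume := by
    refine Continuous.aestronglyMeasurable (continuous_iff_continuousAt.mpr fun t => ?_)
    exact (((fokasSolution_classical hβ hT hg H).1 x hx t).1).continuousAt
  rw [e]
  refine (eLpNorm_add_le (m1.sub hg2.1).restrict (m2.sub m1).restrict (by norm_num)).trans ?_
  gcongr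
  · rw [← hplan x hx]
    exact eLpNorm_mono_measure _ Measure.restrict_le_self
  · refine eLpNorm_le_of_ae_bound
      ((ae_restrict_iff' measurableSet_Ioo).mpr (ae_of_all _ fun t ht => ?_))
    rw [Pi.sub_apply, hrep x hx t, sub_sub_cancel_left, norm_neg, norm_mul]
    have h1 : ‖Complex.I / (2 * Real.pi)‖ = 1 / (2 * Real.pi) := by
      rw [norm_div, Complex.norm_I, norm_mul, Complex.norm_real, Real.norm_of_nonneg Real.pi_pos.le]
      simp
    rw [h1]
    gcongr
    exact hxC t ⟨ht.1.le, ht.2.le⟩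

end

end FokasHalfLine

namespace FokasHalfLine
open scoped FourierTransform ComplexConjugate

/-! ### The Sobolev estimates -/

theorem const_mul_waveIntegral (c : ℂ) (μ : Measure ℝ) (γ Ω W : ℝ → ℂ) (x t : ℝ) :
    c * waveIntegral μ γ Ω W x t =
      ∫ m, Complex.exp (Complex.I * γ m * x) * (c * (Complex.exp (-(Ω m * t)) * W m)) ∂μ := by
  unfold waveIntegral
  rw [← integral_const_mul]
  refine integral_congr_ae (ae_of_all _ fun m => ?_)
  simp only [sub_eq_add_neg, Complex.exp_add]
  ring

section

variable {α β δ T : ℝ} {g : ℝ → ℂ}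

/-- Since `|τ'| ≲ m²`, the left side is at most a multiple of `m^{2s+2} = (m⁶)^{(s+1)/3}`, and `m⁶ ≲
1 + τ²`. -/
theorem exists_rpow_mul_branchFreqDeriv_le (hβ : 0 < β) {s : ℝ} (hs : 0 ≤ s) :
    ∃ C : ℝ, 0 < C ∧ ∀ σ : ℝ, σ ^ 2 = 1 → ∀ m, largeHeight α β δ ≤ m →
      (m ^ s) ^ 2 * |branchFreqDeriv α β δ σ m| ≤
        C * (1 + branchFreq α β δ σ m ^ 2) ^ ((s + 1) / 3) := by
  set A := 2 * ((3 * β + 2 * |α| + |δ|) * branchConst α β ^ 2) with hA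
  set B := 27 / β * (1 + |omegaOffset α β δ|) with hB
  have hA0 : 0 < A := by have := two_le_branchConst α hβ; positivity
  have hB0 : 0 < B := by positivity
  refine ⟨A * (2 * B ^ 2) ^ ((s + 1) / 3), by positivity, fun σ hσ m hm => ?_⟩
  have hm0 : 0 < m := by linarith [one_le_largeHeight α δ hβ]
  have h1 := abs_branchFreqDeriv_le hβ hσ hm
  have h2 := cube_le_branchFreq hβ hσ hm
  rw [← hA] at h1
  rw [← hB] at h2
  set τ := branchFreq α β δ σ m
  have h3 : (m ^ 3) ^ 2 ≤ (2 * B ^ 2) * (1 + τ ^ 2) := by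
    calc (m ^ 3) ^ 2 ≤ (B * (1 + |τ|)) ^ 2 := by gcongr
      _ = B ^ 2 * (1 + |τ|) ^ 2 := mul_pow _ _ _
      _ ≤ B ^ 2 * (2 * (1 + τ ^ 2)) := by
          gcongr
          nlinarith [sq_nonneg (|τ| - 1), sq_abs τ]
      _ = _ := by ring
  have h4 : (m ^ s) ^ 2 * m ^ 2 = ((m ^ 3) ^ 2) ^ ((s + 1) / 3) := by
    rw [← Real.rpow_natCast (m ^ s), ← Real.rpow_mul hm0.le, ← Real.rpow_natCast m 2,
      ← Real.rpow_add hm0, ← pow_mul, ← Real.rpow_natCast m (3 * 2), ← Real.rpow_mul hm0.le]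
    congr 1
    push_cast
    ring
  calc _ ≤ (m ^ s) ^ 2 * (A * m ^ 2) := by gcongr
    _ = A * ((m ^ 3) ^ 2) ^ ((s + 1) / 3) := by rw [← h4]; ring
    _ ≤ A * ((2 * B ^ 2) * (1 + τ ^ 2)) ^ ((s + 1) / 3) := by gcongr
    _ = _ := by rw [Real.mul_rpow (by positivity) (by positivity)]; ring

theorem lintegral_timeTransform_eq (hT : 0 ≤ T) (hsupp : ∀ᵐ t : ℝ, t ∉ Ico 0 T → g t = 0)
    (hg1 : Integrable g) (hg2 : MemLp g 2) (s : ℝ) :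
    (∫⁻ τ : ℝ, ENNReal.ofReal ((1 + τ ^ 2) ^ s) *
      ‖timeTransform g (Complex.I * τ) T‖ₑ ^ 2) ^ (1 / 2 : ℝ) =
    ENNReal.ofReal (2 * Real.pi) ^ (1 / 2 : ℝ) * sobolevNorm s (hg2.toLp g) := by
  -- The time transform has the kernel `e^{+iτt}`, so the substitution `τ = -2πξ` is needed to meet
  -- `𝓕` rather than `𝓕⁻`.
  have hne : (-(2 * Real.pi) : ℝ) ≠ 0 := by have := Real.pi_pos; linarith
  have h1 := lintegral_image_eq_lintegral_abs_deriv_mul (s := univ)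
    (f := fun ξ : ℝ => -(2 * Real.pi) * ξ) (f' := fun _ => -(2 * Real.pi)) MeasurableSet.univ
    (fun ξ _ => (((hasDerivAt_id ξ).const_mul (-(2 * Real.pi))).congr_deriv
      (mul_one _)).hasDerivWithinAt)
    (mul_right_injective₀ hne).injOn (fun τ : ℝ => ENNReal.ofReal ((1 + τ ^ 2) ^ s) *
      ‖timeTransform g (Complex.I * τ) T‖ₑ ^ 2)
  rw [image_univ, (mul_left_surjective₀ hne).range_eq, setLIntegral_univ, setLIntegral_univ,
    lintegral_const_mul' _ _ ENNReal.ofReal_ne_top, abs_neg,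
    abs_of_pos (by positivity : (0 : ℝ) < 2 * Real.pi)] at h1
  rw [h1, ENNReal.mul_rpow_of_nonneg _ _ (by norm_num),
    sobolevNorm_eq_of_ae (fourier_toLp_ae_eq hg1 hg2)]
  congr 2
  refine lintegral_congr fun ξ => ?_
  have h2 := timeTransform_eq_fourierInv hT hsupp (-ξ)
  rw [Real.fourierInv_eq_fourier_neg, neg_neg] at h2
  rw [← h2, sobolevWeight]
  congr 3
  · ring
  · congr 3
    ring

/-- One factor `τ'` of the squared weight is the Jacobian of the passage to the frequency; the other
one, together with `m^{2s}`, becomes the Sobolev weight of order `(s+1)/3`. The bound is uniform in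
`t` and `T` because `e^{-ωt}` is unimodular on the branch. -/
theorem exists_sobolevNormOn_branchPart_le (hβ : 0 < β) {s : ℝ} (hs : 0 ≤ s) :
    ∃ C : ℝ, 0 < C ∧ ∀ (σ : ℝ), σ ^ 2 = 1 → ∀ T : ℝ, 0 ≤ T → ∀ g : ℝ → ℂ,
      (∀ᵐ t : ℝ, t ∉ Ico 0 T → g t = 0) → Integrable g → ∀ (hg2 : MemLp g 2) (c : ℂ), ‖c‖ ≤ 1 →
      ∀ t : ℝ, sobolevNormOn s (Ioi 0)
        (fun x => c * branchPart α β δ σ (largeHeight α β δ) T g x t) ≤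
        ENNReal.ofReal C * sobolevNorm ((s + 1) / 3) (hg2.toLp g) := by
  obtain ⟨C₁, hC₁, h₁⟩ := exists_sobolevNormOn_branch_le (s := s) hs
    (K := |α| / (3 * β) + 1) (by positivity)
  obtain ⟨C₂, hC₂, h₂⟩ := exists_rpow_mul_branchFreqDeriv_le (α := α) (δ := δ) hβ hs
  refine ⟨C₁ * (C₂ ^ (1 / 2 : ℝ) * (2 * Real.pi) ^ (1 / 2 : ℝ)), by positivity,
    fun σ hσ T hT g hsupp hg1 hg2 c hc t => ?_⟩
  set h₀ := largeHeight α β δ with hh₀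
  have hg : IntervalIntegrable g volume 0 T := hg1.intervalIntegrable
  have hd := waveData_branch (α := α) (δ := δ) (M := h₀) hβ hσ hh₀.ge
  have hW := waveWeight_branch (α := α) (δ := δ) (M := h₀) hβ hT hg hσ hh₀.ge
  set G : ℝ → ℂ := fun m => c * (Complex.exp (-(omega α β δ (branch α β δ σ m) * t)) *
    branchWeight α β δ σ T g m) with hG
  have hfun : (fun x : ℝ => c * branchPart α β δ σ h₀ T g x t) = fun x : ℝ =>
      ∫ m in Ioi h₀, Complex.exp (Complex.I * branch α β δ σ m * x) * G m :=
    funext fun x => const_mul_waveIntegral _ _ _ _ _ _ _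
  have hGn : ∀ m ∈ Ioi h₀, ‖G m‖ ≤ ‖branchWeight α β δ σ T g m‖ := fun m hm => by
    have hre := omega_branch_re (α := α) (δ := δ) hβ hσ
      ((regularHeight_largeHeight hβ).2 m (le_of_lt hm)).le
    rw [hG]
    simp only
    rw [norm_mul, norm_mul, Complex.norm_exp]
    have : (-(omega α β δ (branch α β δ σ m) * t)).re = 0 := by simp [hre]
    rw [this, Real.exp_zero, one_mul]
    exact mul_le_of_le_one_left (norm_nonneg _) hc
  have hGm : AEStronglyMeasurable G (volume.restrict (Ioi h₀)) := by
    have := hd.measurable_freq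
    exact ((by fun_prop : Measurable fun m => Complex.exp
      (-(omega α β δ (branch α β δ σ m) * t))).aestronglyMeasurable.mul hW.1).const_mul c
  rw [hfun]
  refine (h₁ h₀ (branch α β δ σ) G (one_le_largeHeight α δ hβ) hd.measurable_wave
    (fun m hm => ⟨branch_im _ _ _ _ _, abs_branch_re_le hβ hσ (le_of_lt hm)⟩) hGm ?_ ?_).trans ?_
  · intro x hx
    refine (hW.2 x hx 0).mono' ?_ ((ae_restrict_iff' measurableSet_Ioi).mpr
      (ae_of_all _ fun m hm => ?_))
    · have := hd.measurable_wave
      exact (by fun_prop : Measurable fun m => Real.exp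
        (-(branch α β δ σ m).im * x)).aestronglyMeasurable.mul hGm.norm
    · rw [Real.norm_of_nonneg (by positivity), pow_zero, one_mul]
      gcongr
      exact hGn m hm
  · rw [← hfun]
    exact continuousOn_const.mul ((continuousOn_waveIntegral hd hW).comp
      (f := fun x : ℝ => (x, t)) (by fun_prop) fun x hx => ⟨hx, mem_univ _⟩)
  · have hle : ∫⁻ m in Ioi h₀, (ENNReal.ofReal (m ^ s) * ‖G m‖ₑ) ^ 2 ≤
        ENNReal.ofReal C₂ * ∫⁻ τ : ℝ, ENNReal.ofReal ((1 + τ ^ 2) ^ ((s + 1) / 3)) *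
          ‖timeTransform g (Complex.I * τ) T‖ₑ ^ 2 := by
      have himg := lintegral_image_eq_lintegral_abs_deriv_mul measurableSet_Ioi
        (fun m hm => (hasDerivAt_branchFreq (α := α) (δ := δ) hβ σ
          (le_of_lt hm)).hasDerivWithinAt) (injOn_branchFreq hβ hσ)
        (fun τ : ℝ => ENNReal.ofReal ((1 + τ ^ 2) ^ ((s + 1) / 3)) *
          ‖timeTransform g (Complex.I * τ) T‖ₑ ^ 2)
      -- A branch reaches only a half-line of frequencies; the integral is enlarged to all of them.
      refine le_trans ?_ (mul_le_mul_right (setLIntegral_le_lintegral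
        (branchFreq α β δ σ '' Ioi h₀) _) _)
      rw [himg, ← lintegral_const_mul' _ _ ENNReal.ofReal_ne_top]
      refine setLIntegral_mono' measurableSet_Ioi fun m hm => ?_
      have hm0 : 0 < m := by
        have : h₀ < m := hm
        linarith [one_le_largeHeight α δ hβ]
      have hw : ‖branchWeight α β δ σ T g m‖ = |branchFreqDeriv α β δ σ m| *
          ‖timeTransform g (Complex.I * branchFreq α β δ σ m) T‖ := by
        rw [branchWeight, mul_right_comm, deriv_omega_branch_mul hβ hσ hm,
          omega_branch hβ hσ (le_of_lt hm), norm_mul, norm_mul, Complex.norm_I, one_mul,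
          Complex.norm_real, Real.norm_eq_abs]
      have hGm' := hGn m hm
      rw [hw] at hGm'
      have hkey := h₂ σ hσ m (le_of_lt hm)
      simp only [← ofReal_norm]
      rw [← ENNReal.ofReal_mul (by positivity), ← ENNReal.ofReal_pow (by positivity),
        ← ENNReal.ofReal_pow (by positivity), ← ENNReal.ofReal_mul (by positivity),
        ← ENNReal.ofReal_mul (by positivity), ← ENNReal.ofReal_mul (by positivity)]
      refine ENNReal.ofReal_le_ofReal ?_
      set y := ‖timeTransform g (Complex.I * branchFreq α β δ σ m) T‖
      calc (m ^ s * ‖G m‖) ^ 2 ≤ (m ^ s * (|branchFreqDeriv α β δ σ m| * y)) ^ 2 := by gcongr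
        _ = ((m ^ s) ^ 2 * |branchFreqDeriv α β δ σ m|) *
            (|branchFreqDeriv α β δ σ m| * y ^ 2) := by ring
        _ ≤ (C₂ * (1 + branchFreq α β δ σ m ^ 2) ^ ((s + 1) / 3)) *
            (|branchFreqDeriv α β δ σ m| * y ^ 2) := by gcongr
        _ = _ := by ring
    calc _ ≤ ENNReal.ofReal C₁ * (ENNReal.ofReal C₂ * ∫⁻ τ : ℝ,
          ENNReal.ofReal ((1 + τ ^ 2) ^ ((s + 1) / 3)) *
          ‖timeTransform g (Complex.I * τ) T‖ₑ ^ 2) ^ (1 / 2 : ℝ) := by gcongr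
      _ = _ := by
        rw [ENNReal.mul_rpow_of_nonneg _ _ (by norm_num),
          lintegral_timeTransform_eq hT hsupp hg1 hg2, ENNReal.ofReal_mul hC₁.le,
          ENNReal.ofReal_mul (p := C₂ ^ (1 / 2 : ℝ)) (by positivity),
          ENNReal.ofReal_rpow_of_nonneg hC₂.le (by norm_num),
          ENNReal.ofReal_rpow_of_nonneg (by positivity) (by norm_num)]
        ring

/-- The Cauchy–Schwarz inequality on `(0, T)`; this is the source of the factor `√T`. -/
theorem ofReal_integral_norm_le {s : ℝ} (hs : 0 ≤ s) (hT : 0 ≤ T) (hg1 : Integrable g)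
    (hg2 : MemLp g 2) :
    ENNReal.ofReal (∫ t in (0 : ℝ)..T, ‖g t‖) ≤
      ENNReal.ofReal √T * sobolevNorm s (hg2.toLp g) := by
  rw [intervalIntegral.integral_of_le hT, ofReal_integral_norm_eq_lintegral_enorm hg1.restrict,
    ← eLpNorm_one_eq_lintegral_enorm]
  refine (eLpNorm_le_eLpNorm_mul_rpow_measure_univ (q := 2) (by norm_num)
    hg2.1.restrict).trans ?_
  rw [mul_comm]
  gcongr
  · rw [Measure.restrict_apply_univ, Real.volume_Ioc, sub_zero, Real.sqrt_eq_rpow,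
      ← ENNReal.ofReal_rpow_of_nonneg hT (by norm_num)]
    norm_num
  · refine (eLpNorm_mono_measure _ Measure.restrict_le_self).trans ?_
    rw [← Lp.enorm_toLp hg2]
    exact enorm_le_sobolevNorm hs _

/-- Since `Re ω ≤ 0` on the segment, the time transform is bounded by the `L¹` norm of `g`, whereas
`e^{-ωt}` can grow like `e^{BT}` with `B` a bound for `|ω|` there. The segment lies at a fixed
height `≥ 1`, so the estimate for bounded wave numbers applies with constants depending on the
coefficients and `s` only. -/
theorem exists_sobolevNormOn_midPart_le (hβ : 0 < β) {s : ℝ} (hs : 0 ≤ s) :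
    ∃ C B : ℝ, 0 < C ∧ 0 < B ∧ ∀ T : ℝ, 0 ≤ T → ∀ g : ℝ → ℂ,
      Integrable g → ∀ (hg2 : MemLp g 2) (c : ℂ), ‖c‖ ≤ 1 →
      ∀ t ∈ Icc 0 T, sobolevNormOn s (Ioi 0)
        (fun x => c * midPart α β δ (largeHeight α β δ) T g x t) ≤
        ENNReal.ofReal (C * (√T * Real.exp (B * T))) *
          sobolevNorm ((s + 1) / 3) (hg2.toLp g) := by
  set h₀ := largeHeight α β δ with hh₀
  have hh1 : 1 ≤ h₀ := one_le_largeHeight α δ hβ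
  obtain ⟨C₁, hC₁, h₁⟩ := exists_sobolevNormOn_bounded_le (s := s) hs
    (K := |α| / (3 * β) + 1) (H := h₀) (by positivity) (by linarith)
  set K := branchConst α β * h₀ with hK
  have hK1 : 1 ≤ K := by have := two_le_branchConst α hβ; nlinarith
  set B := (β + |α| + |δ|) * K ^ 3 with hB
  set D := (3 * β + 2 * |α| + |δ|) * K ^ 2 with hD
  set a := (branch α β δ (-1) h₀).re with ha
  set b := (branch α β δ 1 h₀).re with hb
  have hab : a ≤ b := branch_left_re_le α β δ hβ h₀
  have hB0 : 0 < B := by positivity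
  have hD0 : 0 < D := by positivity
  refine ⟨C₁ * (D * (b - a + 1)), B, by have : 0 < b - a + 1 := by linarith
                                        positivity, hB0, fun T hT g hg1 hg2 c hc t ht => ?_⟩
  have hg : IntervalIntegrable g volume 0 T := hg1.intervalIntegrable
  have hd := waveData_mid (α := α) (δ := δ) (h := h₀) hβ hh₀.ge
  have hW := waveWeight_mid (α := α) (β := β) (δ := δ) hg h₀ a b
  set J := ∫ t in (0 : ℝ)..T, ‖g t‖ with hJ
  have hJ0 : 0 ≤ J := intervalIntegral.integral_nonneg hT fun _ _ => norm_nonneg _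
  set G : ℝ → ℂ := fun m => c * (Complex.exp (-(omega α β δ (gammaMid h₀ m) * t)) *
    midWeight α β δ h₀ T g m) with hG
  have hfun : (fun x : ℝ => c * midPart α β δ h₀ T g x t) = fun x : ℝ =>
      ∫ m in Ioo a b, Complex.exp (Complex.I * gammaMid h₀ m * x) * G m :=
    funext fun x => const_mul_waveIntegral _ _ _ _ _ _ _
  have hGc : Continuous G := by
    have h2 : Continuous fun m => omega α β δ (gammaMid h₀ m) :=
      (differentiable_omega α β δ).continuous.comp (continuous_gammaMid h₀)
    have h3 := continuous_midWeight (α := α) (β := β) (δ := δ) hg h₀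
    rw [hG]
    fun_prop
  have hGi : IntegrableOn G (Ioo a b) :=
    (hGc.continuousOn.integrableOn_compact isCompact_Icc).mono_set Ioo_subset_Icc_self
  have hGn : ∀ m ∈ Ioo a b, ‖G m‖ ≤ Real.exp (B * T) * (D * J) := fun m hm => by
    have hnm := (norm_gammaMid_le (α := α) (δ := δ) hβ hh₀.ge hm).2
    have h3 : ‖Complex.exp (-(omega α β δ (gammaMid h₀ m) * t))‖ ≤ Real.exp (B * T) := by
      rw [Complex.norm_exp, Real.exp_le_exp]
      refine (Complex.re_le_norm _).trans ?_
      rw [norm_neg, norm_mul, Complex.norm_real, Real.norm_of_nonneg ht.1]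
      exact mul_le_mul (norm_omega_le hβ hK1 hnm) ht.2 ht.1 (by positivity)
    have h4 : ‖midWeight α β δ h₀ T g m‖ ≤ D * J := by
      unfold midWeight
      rw [norm_mul]
      gcongr
      · exact norm_deriv_omega_le hβ hK1 hnm
      · exact norm_timeTransform_le hT hg (omega_gammaMid_re_nonpos hβ (by linarith)
          ((regularHeight_largeHeight hβ).2 h₀ le_rfl).le hm)
    rw [hG]
    simp only
    rw [norm_mul, norm_mul]
    calc _ ≤ 1 * (Real.exp (B * T) * (D * J)) := by gcongr
      _ = _ := one_mul _
  rw [hfun]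
  refine (h₁ _ (gammaMid h₀) G inferInstance hd.measurable_wave
    ((ae_restrict_iff' measurableSet_Ioo).mpr (ae_of_all _ fun m hm => ?_)) hGi ?_).trans ?_
  · have him : (gammaMid h₀ m).im = h₀ := by simp [gammaMid]
    have hre : (gammaMid h₀ m).re = m := by simp [gammaMid]
    rw [him, hre]
    exact ⟨hh1, le_rfl, (norm_gammaMid_le (α := α) (δ := δ) hβ hh₀.ge hm).1⟩
  · rw [← hfun]
    exact continuousOn_const.mul ((continuousOn_waveIntegral hd hW).comp
      (f := fun x : ℝ => (x, t)) (by fun_prop) fun x hx => ⟨hx, mem_univ _⟩)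
  · have hle : ∫⁻ m in Ioo a b, ‖G m‖ₑ ≤
        ENNReal.ofReal (Real.exp (B * T) * (D * J)) * ENNReal.ofReal (b - a) := by
      rw [← Real.volume_Ioo, ← setLIntegral_const]
      refine setLIntegral_mono' measurableSet_Ioo fun m hm => ?_
      rw [← ofReal_norm]
      exact ENNReal.ofReal_le_ofReal (hGn m hm)
    have hJle := ofReal_integral_norm_le (s := (s + 1) / 3) (by positivity) hT hg1 hg2
    rw [← hJ] at hJle
    calc _ ≤ ENNReal.ofReal C₁ * (ENNReal.ofReal (Real.exp (B * T) * (D * J)) *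
          ENNReal.ofReal (b - a + 1)) := by
          gcongr
          refine hle.trans ?_
          gcongr
          linarith
      _ = ENNReal.ofReal (C₁ * (D * (b - a + 1))) * ENNReal.ofReal (Real.exp (B * T)) *
          ENNReal.ofReal J := by
          rw [← ENNReal.ofReal_mul (by positivity), ← ENNReal.ofReal_mul hC₁.le,
            ← ENNReal.ofReal_mul (mul_nonneg hC₁.le (mul_nonneg hD0.le (by linarith))),
            ← ENNReal.ofReal_mul (mul_nonneg (mul_nonneg hC₁.le
              (mul_nonneg hD0.le (by linarith))) (by positivity))]
          congr 1
          ring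
      _ ≤ ENNReal.ofReal (C₁ * (D * (b - a + 1))) * ENNReal.ofReal (Real.exp (B * T)) *
          (ENNReal.ofReal √T * sobolevNorm ((s + 1) / 3) (hg2.toLp g)) := by gcongr
      _ = _ := by
          rw [ENNReal.ofReal_mul (mul_nonneg hC₁.le (mul_nonneg hD0.le (by linarith))),
            ENNReal.ofReal_mul (Real.sqrt_nonneg T)]
          ring

/-- The estimate of the solution by the norm of the boundary datum on the line. -/
theorem exists_sobolevNormOn_fokasSolution_le (hβ : 0 < β) {s : ℝ} (hs : 0 ≤ s) :
    ∃ c : ℝ, 0 < c ∧ ∀ T : ℝ, 0 ≤ T → ∀ h : ℝ, RegularHeight α β δ h → ∀ g : ℝ → ℂ,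
      (∀ᵐ t : ℝ, t ∉ Ico 0 T → g t = 0) → Integrable g → ∀ hg2 : MemLp g 2, ∀ t ∈ Icc 0 T,
      sobolevNormOn s (Ioi 0) (fun x => fokasSolution α β δ h T g x t) ≤
        ENNReal.ofReal (c * (1 + √T * Real.exp (c * T))) *
          sobolevNorm ((s + 1) / 3) (hg2.toLp g) := by
  obtain ⟨C₁, hC₁, h₁⟩ := exists_sobolevNormOn_branchPart_le (α := α) (δ := δ) hβ hs
  obtain ⟨C₂, B, hC₂, hB, h₂⟩ := exists_sobolevNormOn_midPart_le (α := α) (δ := δ) hβ hs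
  -- A single constant for the two branches, the segment and the exponential rate.
  refine ⟨2 * C₁ + C₂ + B, by positivity, fun T hT h H g hsupp hg1 hg2 t ht => ?_⟩
  have hg : IntervalIntegrable g volume 0 T := hg1.intervalIntegrable
  set N := sobolevNorm ((s + 1) / 3) (hg2.toLp g)
  set c : ℂ := Complex.I / (2 * Real.pi) with hc
  have hcn : ‖c‖ ≤ 1 := by
    rw [hc, norm_div, Complex.norm_I, norm_mul, Complex.norm_real,
      Real.norm_of_nonneg Real.pi_pos.le, Complex.norm_ofNat]
    rw [div_le_one (by positivity)]
    linarith [Real.pi_gt_three]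
  have e : (fun x => fokasSolution α β δ h T g x t) =ᵐ[volume.restrict (Ioi 0)] fun x =>
      (c * branchPart α β δ (-1) (largeHeight α β δ) T g x t +
        -c * midPart α β δ (largeHeight α β δ) T g x t) +
        -c * branchPart α β δ 1 (largeHeight α β δ) T g x t := by
    refine (ae_restrict_iff' measurableSet_Ioi).mpr (ae_of_all _ fun x hx => ?_)
    simp only
    rw [fokasSolution_eq_largeHeight hβ hT hg H hx,
      fokasSolution_eq_parts hβ (regularHeight_largeHeight hβ)]
    ring
  rw [sobolevNormOn_congr e]
  have hcn' : ‖-c‖ ≤ 1 := by rwa [norm_neg]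
  calc _ ≤ (ENNReal.ofReal C₁ * N + ENNReal.ofReal (C₂ * (√T * Real.exp (B * T))) * N) +
        ENNReal.ofReal C₁ * N := by
        refine (sobolevNormOn_add_le _ _ _ _).trans (add_le_add
          ((sobolevNormOn_add_le _ _ _ _).trans (add_le_add ?_ ?_)) ?_)
        · exact h₁ (-1) (by norm_num) T hT g hsupp hg1 hg2 c hcn t
        · exact h₂ T hT g hg1 hg2 (-c) hcn' t ht
        · exact h₁ 1 (by norm_num) T hT g hsupp hg1 hg2 (-c) hcn' t
    _ = ENNReal.ofReal (C₁ + C₂ * (√T * Real.exp (B * T)) + C₁) * N := by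
        rw [ENNReal.ofReal_add (by positivity) hC₁.le, ENNReal.ofReal_add hC₁.le (by positivity)]
        ring
    _ ≤ _ := by
        gcongr
        have h3 : Real.exp (B * T) ≤ Real.exp ((2 * C₁ + C₂ + B) * T) := by
          rw [Real.exp_le_exp]
          gcongr
          linarith
        have h4 : C₂ * (√T * Real.exp (B * T)) ≤
            (2 * C₁ + C₂ + B) * (√T * Real.exp ((2 * C₁ + C₂ + B) * T)) := by
          gcongr
          linarith
        linarith

/-- The norm on the line of a function supported in `[0, T)` is controlled by the norm on `(0, T)`,
up to the exceptional orders. -/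
theorem exists_sobolevNorm_le_sobolevNormOn {s : ℝ} (hs : 0 ≤ s)
    (hs' : ∀ n : ℕ, s ≠ 1 / 2 + 3 * (n : ℝ)) :
    ∃ C : ℝ, 0 < C ∧ ∀ T : ℝ, 0 < T → ∀ F : Lp ℂ 2 (volume : Measure ℝ),
      (∀ᵐ x : ℝ, x ∉ Ico 0 T → F x = 0) → sobolevNorm ((s + 1) / 3) F < ⊤ →
      sobolevNorm ((s + 1) / 3) F ≤
        ENNReal.ofReal C * sobolevNormOn ((s + 1) / 3) (Ioo 0 T) F := by
  set σ := (s + 1) / 3 with hσ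
  -- The integer nearest to `σ`, so that `θ = σ - n` lies in `[-1/2, 1/2)`. The endpoint `θ = -1/2`
  -- means `s = 1/2 + 3(n - 1)`, which is excluded for `n ≥ 1` by hypothesis and for `n = 0` by `σ >
  -- 0`.
  set n := ⌊σ + 1 / 2⌋₊ with hn
  have h0 : 0 ≤ σ + 1 / 2 := by positivity
  have h1 : (n : ℝ) ≤ σ + 1 / 2 := Nat.floor_le h0
  have h2 : σ + 1 / 2 < n + 1 := Nat.lt_floor_add_one _
  have h3 : (n : ℝ) ≠ σ + 1 / 2 := by
    intro h
    rcases Nat.eq_zero_or_pos n with h4 | h4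
    · rw [h4, hσ] at h
      push_cast at h
      linarith
    · obtain ⟨k, hk⟩ := Nat.exists_eq_succ_of_ne_zero h4.ne'
      refine hs' k ?_
      rw [hk, hσ] at h
      push_cast at h
      linarith
  have hθ : |σ - n| < 1 / 2 := by
    have := lt_of_le_of_ne h1 h3
    rw [abs_lt]
    constructor <;> linarith
  have hnθ : (n : ℝ) + (σ - n) = σ := by ring
  obtain ⟨C, hC, h⟩ := exists_sobolevNorm_le_of_ae_eq hθ (by rw [hnθ]; positivity)
  rw [hnθ] at h
  refine ⟨C, hC, fun T hT F hF hfin => ?_⟩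
  unfold sobolevNormOn
  have hC0 : ENNReal.ofReal C ≠ 0 := by
    rw [ne_eq, ENNReal.ofReal_eq_zero, not_le]
    exact hC
  rw [ENNReal.mul_iInf_of_ne hC0 ENNReal.ofReal_ne_top]
  refine le_iInf fun G => ?_
  rw [ENNReal.mul_iInf_of_ne hC0 ENNReal.ofReal_ne_top]
  refine le_iInf fun hG => ?_
  refine h T hT F G ?_ hfin hG
  filter_upwards [hF] with x hx hx'
  exact hx fun hx'' => hx' (Ico_subset_Icc_self hx'')

end

end FokasHalfLine

/-! ### The theorem -/

theorem theorem2p4 (α β δ : ℝ) (hβ : 0 < β) (s : ℝ) (hs : 0 ≤ s) :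
    ∃ c : ℝ, 0 < c ∧
      ∀ (T : ℝ), 0 < T →
      ∀ (h : ℝ), FokasHalfLine.AdmissibleHeight α β δ h →
      ∀ (g₀ : ℝ → ℂ), (∀ᵐ t : ℝ, t ∉ Set.Ico 0 T → g₀ t = 0) →
        FokasHalfLine.sobolevNormOn ((s + 1) / 3) Set.univ g₀ < ⊤ →
        FokasHalfLine.SolvesReducedProblem α β δ T g₀
            (FokasHalfLine.fokasSolution α β δ h T g₀) ∧
        ∀ t ∈ Set.Icc (0 : ℝ) T,
          FokasHalfLine.sobolevNormOn s (Set.Ioi 0)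
              (fun x => FokasHalfLine.fokasSolution α β δ h T g₀ x t) ≤
            ENNReal.ofReal (c * (1 + √T * Real.exp (c * T))) *
              FokasHalfLine.sobolevNormOn ((s + 1) / 3) Set.univ g₀ ∧
          ((∀ n : ℕ, s ≠ 1 / 2 + 3 * (n : ℝ)) →
            FokasHalfLine.sobolevNormOn s (Set.Ioi 0)
                (fun x => FokasHalfLine.fokasSolution α β δ h T g₀ x t) ≤
              ENNReal.ofReal (c * (1 + √T * Real.exp (c * T))) *
                FokasHalfLine.sobolevNormOn ((s + 1) / 3) (Set.Ioo 0 T) g₀) := by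
  obtain ⟨c₁, hc₁, h₁⟩ := FokasHalfLine.exists_sobolevNormOn_fokasSolution_le (α := α) (δ := δ)
    hβ hs
  -- The constant of the theorem is chosen before it is known whether `s` is exceptional; in the
  -- exceptional case any positive `C` will do.
  obtain ⟨C, hC, h₂⟩ : ∃ C : ℝ, 0 < C ∧ ((∀ n : ℕ, s ≠ 1 / 2 + 3 * (n : ℝ)) →
      ∀ T : ℝ, 0 < T → ∀ F : Lp ℂ 2 (volume : Measure ℝ),
      (∀ᵐ x : ℝ, x ∉ Ico 0 T → F x = 0) → FokasHalfLine.sobolevNorm ((s + 1) / 3) F < ⊤ →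
      FokasHalfLine.sobolevNorm ((s + 1) / 3) F ≤
        ENNReal.ofReal C * FokasHalfLine.sobolevNormOn ((s + 1) / 3) (Ioo 0 T) F) := by
    by_cases hs' : ∀ n : ℕ, s ≠ 1 / 2 + 3 * (n : ℝ)
    · obtain ⟨C, hC, h⟩ := FokasHalfLine.exists_sobolevNorm_le_sobolevNormOn hs hs'
      exact ⟨C, hC, fun _ => h⟩
    · exact ⟨1, one_pos, fun h => absurd h hs'⟩
  -- The factor `1 + C` dominates both `1`, for the norm on the line, and `C`, for the norm on `(0,
  -- T)`; enlarging the rate in the exponential is harmless.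
  refine ⟨c₁ * (1 + C), by positivity, fun T hT h hh g₀ hsupp hfin => ?_⟩
  have H := hh.regularHeight hβ
  obtain ⟨F, hF⟩ : ∃ F : Lp ℂ 2 (volume : Measure ℝ), F =ᵐ[volume] g₀ := by
    unfold FokasHalfLine.sobolevNormOn at hfin
    obtain ⟨F, hF⟩ := iInf_lt_iff.mp hfin
    obtain ⟨hF, -⟩ := iInf_lt_iff.mp hF
    rw [Measure.restrict_univ] at hF
    exact ⟨F, hF⟩
  have hg2 : MemLp g₀ 2 := (memLp_congr_ae hF).mp (Lp.memLp F)
  have hg1 : Integrable g₀ := by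
    refine FokasHalfLine.integrable_of_memLp_two_of_bounded_support hg2 (a := 0) (b := T) ?_
    filter_upwards [hsupp] with x hx hx'
    exact hx fun hx'' => hx' (Ico_subset_Icc_self hx'')
  have hN := FokasHalfLine.sobolevNormOn_univ_eq (s := (s + 1) / 3) (hg2.toLp g₀) hg2.coeFn_toLp
  have hg : IntervalIntegrable g₀ volume 0 T := hg1.intervalIntegrable
  obtain ⟨hcl, hco⟩ := FokasHalfLine.fokasSolution_classical hβ hT.le hg H
  refine ⟨⟨fun x hx t _ => (hcl x hx t).1, fun x hx t _ => (hcl x hx t).2.1,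
    fun x hx t _ => (hcl x hx t).2.2, hco.mono (prod_mono_right (subset_univ _)), fun x hx => ?_,
    FokasHalfLine.fokasSolution_boundary hβ hT.le hsupp hg1 hg2 H⟩, fun t ht => ?_⟩
  · rw [FokasHalfLine.fokasSolution_eq_largeHeight hβ hT.le hg H hx,
      FokasHalfLine.fokasSolution_initial hβ hT.le hg hx]
  · have hb := h₁ T hT.le h H g₀ hsupp hg1 hg2 t ht
    have hexp : Real.exp (c₁ * T) ≤ Real.exp (c₁ * (1 + C) * T) := by
      rw [Real.exp_le_exp]
      gcongr
      nlinarith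
    have hle : c₁ * (1 + √T * Real.exp (c₁ * T)) * (1 + C) ≤
        c₁ * (1 + C) * (1 + √T * Real.exp (c₁ * (1 + C) * T)) := by
      rw [mul_right_comm]
      gcongr
    refine ⟨?_, fun hs' => ?_⟩
    · rw [hN]
      refine hb.trans (mul_le_mul_left (ENNReal.ofReal_le_ofReal ?_) _)
      refine le_trans ?_ hle
      exact le_mul_of_one_le_right (by positivity) (by linarith)
    · have hF' : ∀ᵐ x : ℝ, x ∉ Ico 0 T → (hg2.toLp g₀) x = 0 := by
        filter_upwards [hsupp, hg2.coeFn_toLp] with x h1 h2 h3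
        rw [h2, h1 h3]
      have h3 := h₂ hs' T hT (hg2.toLp g₀) hF' (hN ▸ hfin)
      rw [FokasHalfLine.sobolevNormOn_congr (ae_restrict_of_ae hg2.coeFn_toLp)] at h3
      refine hb.trans ?_
      calc _ ≤ ENNReal.ofReal (c₁ * (1 + √T * Real.exp (c₁ * T))) * (ENNReal.ofReal C *
            FokasHalfLine.sobolevNormOn ((s + 1) / 3) (Ioo 0 T) g₀) := by gcongr
        _ = ENNReal.ofReal (c₁ * (1 + √T * Real.exp (c₁ * T)) * C) *
            FokasHalfLine.sobolevNormOn ((s + 1) / 3) (Ioo 0 T) g₀ := by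
          rw [← mul_assoc, ← ENNReal.ofReal_mul (by positivity)]
        _ ≤ _ := by
          refine mul_le_mul_left (ENNReal.ofReal_le_ofReal (le_trans ?_ hle)) _
          gcongr
          linarith
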